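/- **Conventions.** A graph $G=(V,E)$ has a finite vertex set $V$, no loops, and any two distinct vertices are joined by at most one edge, which is an arrow $a\to b$ or a line $a-b$; two vertices are adjacent if they are joined by an edge. The skeleton is the underlying undirected graph; $G_W$ is the subgraph induced by $W\subseteq V$. A cycle is a sequence $(v_0,\dots,v_k=v_0)$, $k\ge 3$, with $v_0,\dots,v_{k-1}$ distinct and $v_{i-1}\to v_i$ or $v_{i-1}-v_i$ for each $i$; it is semi-directed if at least one of these edges is an arrow, undirected if all are lines, and an undirected cycle is chordless if $k\ge4$ and no two vertices nonconsecutive mod $k$ are adjacent. $G$ is a chain graph if it has no semi-directed cycle. A flag is an induced subgraph $a\to b-c$, an immorality is an induced subgraph $a\to b\leftarrow c$; a triplex $(\{a,c\},b)$ is an induced subgraph $a\to b-c$, $a-b\leftarrow c$ or $a\to b\leftarrow c$; a 2-biflag $[a,b;c,d]$ consists of $a\to c-d\leftarrow b$ with $a,d$ nonadjacent and $b,c$ nonadjacent. The chain components of $G$ are the connected components of the graph left after removing all arrows; a component is nontrivial if it has at least two vertices. **AMP essential graphs.** For $A\subseteq V$ let $\mathrm{An}(A)$ be the smallest set containing $A$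 and closed under parents, and $\mathrm{Co}(A)$ the smallest set containing $A$ and closed under neighbours ($u$ is a neighbour of $v$ if $u-v$). The extended subgraph $G[A]$ has vertex set $\mathrm{Co}(\mathrm{An}(A))$, and its edges are the edges of $G$ within $\mathrm{An}(A)$ and the lines of $G$ within $\mathrm{Co}(\mathrm{An}(A))$. The augmented graph $H^a$ of a graph $H$ is the undirected graph obtained by joining $a,b$ for every triplex $(\{a,b\},c)$ and every 2-biflag $[a,b;c,d]$ of $H$ and replacing all arrows by lines. A probability distribution on a product $\prod_{v\in V}X_v$ of standard Borel spaces satisfies the AMP Markov property of $G$ if $A\perp B\mid S$ whenever $A,B,S\subseteq V$ are pairwise disjoint and $S$ separates $A$ from $B$ in $(G[A\cup B\cup S])^a$. Two chain graphs on $V$ are AMP Markov equivalent if, for every choice of the spaces $X_v$, the same distributions satisfy their AMP Markov properties. The AMP essential graph of the AMP Markov equivalence class $\mathcal G$ of a chain graph $G_0$ is the graph $\mathcal G^*$ with the same skeleton as $G_0$ in which $a\to b$ occurs iff $a\to b$ occurs in some $H\in\mathcal G$ and $a\leftarrow b$ occurs in no $H'\in\mathcal G$, and $a-b$ occurs iff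 either $a-b$ occurs in every $H\in\mathcal G$, or $a\to b$ occurs in some $H\in\mathcal G$ and $a\leftarrow b$ occurs in some $H'\in\mathcal G$. **Conditions.** For $A\subseteq V$ nonempty, $\mathrm{nb}_G(A)$ and $\mathrm{pa}_G(A)$ are the sets of $v\notin A$ that are a neighbour, respectively a parent, of at least one $a\in A$; $\mathrm{cnb}_G(A)$ and $\mathrm{cpa}_G(A)$ are the sets of $v\notin A$ that are a neighbour, respectively a parent, of every $a\in A$; $\mathrm{ncnb}_G(A)=\mathrm{nb}_G(A)\setminus\mathrm{cnb}_G(A)$. For a chain component $\xi$ put $\bar\xi=\xi\cup\mathrm{pa}_G(\xi)$. Let $\Xi_s(G)$ be the set of nontrivial chain components $\xi$ such that $G_{\bar\xi}$ contains a chordless undirected cycle with all vertices in $\xi$ or a flag $a\to b-c$ with $b,c\in\xi$. A line of $G$ is strong if both its end points lie in some $\xi\in\Xi_s(G)$. Property S of $G_{\bar\xi}$: for every nonempty complete $\alpha\subsetneq\xi$ such that $\kappa=\mathrm{cnb}_{G_\xi}(\alpha)\ne\emptyset$ and every connected component $\kappa_q$ of $G_\kappa$, either $\mathrm{nb}_{G_\xi}(\kappa_q)\setminus\alpha\neq\emptyset$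 or $\mathrm{pa}_{G_{\bar\xi}}(\alpha)\setminus\mathrm{cpa}_{G_{\bar\xi}}(\kappa_q)\ne\emptyset$. Property S$'$ of $G_{\bar\xi}$: for every nonempty connected $\kappa\subsetneq\xi$ such that $\alpha=\mathrm{cnb}_{G_\xi}(\kappa)$ is nonempty and complete, either $\mathrm{ncnb}_{G_\xi}(\kappa)\ne\emptyset$ or $\mathrm{pa}_{G_{\bar\xi}}(\alpha)\setminus\mathrm{cpa}_{G_{\bar\xi}}(\kappa)\neq\emptyset$. An arrow $a\to b$ is well protected in $G$ if there is a vertex $c$ (and, in (iv), a vertex $d\neq c$) such that one of the following holds: (i) $c\to a$ and $c,b$ are nonadjacent; (ii) $c\ne a$, $c\to b$ and $a,c$ are nonadjacent; (iii) $a\to c\to b$; (iv) $a-c$, $a-d$, $c\to b$, $d\to b$ and $c,d$ are nonadjacent; (v) $a-c$ is a strong line and $c\to b$; (vi) $a-c$ is a strong line and $c,b$ are nonadjacent; (vii) $b-c$ is a strong line and $a,c$ are nonadjacent; (viii) $b-c$ is a strong line and $a\to c$. **Theorem.** A graph $G=(V,E)$ is an AMP essential graph, i.e. $G=\mathcal G^*$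 for some AMP Markov equivalence class $\mathcal G$, if and only if - (G1) $G$ is a chain graph; - (G2) for each $\xi\in\Xi_s(G)$, $G_{\bar\xi}$ satisfies property S; - (G3) each arrow of $G$ is well protected in $G$. The same equivalence holds with S$'$ in place of S in (G2). -/

import Mathlib

open MeasureTheory ProbabilityTheory

universe u

/-- A graph `(V, E)` with directed and undirected edges and no loops, `E ⊆ V × V`.  The pair `a, b`
carries the line `a - b` if both `(a, b)` and `(b, a)` are in `E`, and the arrow `a → b` if only
`(a, b)` is in `E`; so any two vertices are joined by at most one edge. -/
@[ext]
structure MixedGraph (V : Type u) where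
  /-- `Edge a b`: `a → b` or `a - b`. -/
  Edge : V → V → Prop
  irrefl : ∀ a, ¬ Edge a a

namespace MixedGraph

variable {V : Type u}

/-! ### Graphical terminology -/

/-- `a → b`. -/
def Arrow (G : MixedGraph V) (a b : V) : Prop := G.Edge a b ∧ ¬ G.Edge b a

/-- `a - b`. -/
def Line (G : MixedGraph V) (a b : V) : Prop := G.Edge a b ∧ G.Edge b a

/-- `a` and `b` are joined by an arrow (in either direction) or a line. -/
def Adj (G : MixedGraph V) (a b : V) : Prop := G.Edge a b ∨ G.Edge b a

/-- The skeleton: the underlying undirected graph. -/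
def skeleton (G : MixedGraph V) : SimpleGraph V where
  Adj := G.Adj
  symm := ⟨fun _ _ h => Or.symm h⟩
  loopless := ⟨fun a h => G.irrefl a (h.elim id id)⟩

/-- The undirected graph obtained by removing all arrows. -/
def lineGraph (G : MixedGraph V) : SimpleGraph V where
  Adj := G.Line
  symm := ⟨fun _ _ h => And.symm h⟩
  loopless := ⟨fun a h => G.irrefl a h.1⟩

/-- The induced subgraph `G_W`.  The vertex type is kept; vertices outside `W` become isolated. -/
def restrict (G : MixedGraph V) (W : Set V) : MixedGraph V where
  Edge a b := G.Edge a b ∧ a ∈ W ∧ b ∈ W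
  irrefl a h := G.irrefl a h.1

/-- `(v 0, …, v k)` is a `k`-cycle: `k ≥ 3`, `v k = v 0`, the vertices `v 0, …, v (k-1)` are
distinct, and each `v i`, `v (i+1)` is joined by `v i → v (i+1)` or `v i - v (i+1)`. -/
def IsCycle (G : MixedGraph V) (k : ℕ) (v : ℕ → V) : Prop :=
  3 ≤ k ∧ v k = v 0 ∧ Set.InjOn v (Set.Iio k) ∧ ∀ i < k, G.Edge (v i) (v (i + 1))

/-- A cycle with at least one arrow. -/
def IsSemidirectedCycle (G : MixedGraph V) (k : ℕ) (v : ℕ → V) : Prop :=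
  G.IsCycle k v ∧ ∃ i < k, G.Arrow (v i) (v (i + 1))

/-- A cycle of length at least `4` all of whose edges are lines and in which no two vertices that
are nonconsecutive modulo `k` are adjacent. -/
def IsChordlessUndirectedCycle (G : MixedGraph V) (k : ℕ) (v : ℕ → V) : Prop :=
  G.IsCycle k v ∧ 4 ≤ k ∧ (∀ i < k, G.Line (v i) (v (i + 1))) ∧
    ∀ i j, i < j → j < k → j ≠ i + 1 → ¬ (i = 0 ∧ j + 1 = k) → ¬ G.Adj (v i) (v j)

/-- Chain graph (adicyclic graph): no semi-directed cycles. -/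
def IsChainGraph (G : MixedGraph V) : Prop :=
  ∀ k v, ¬ G.IsSemidirectedCycle k v

/-- The flag `a → b - c` (an induced subgraph). -/
def IsFlag (G : MixedGraph V) (a b c : V) : Prop :=
  G.Arrow a b ∧ G.Line b c ∧ ¬ G.Adj a c

/-- The immorality `a → b ← c` (an induced subgraph). -/
def IsImmorality (G : MixedGraph V) (a b c : V) : Prop :=
  a ≠ c ∧ G.Arrow a b ∧ G.Arrow c b ∧ ¬ G.Adj a c

/-- The triplex `({a, c}, b)`: one of `a → b - c`, `a - b ← c`, `a → b ← c` is an induced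
subgraph. -/
def IsTriplex (G : MixedGraph V) (a b c : V) : Prop :=
  G.IsFlag a b c ∨ G.IsFlag c b a ∨ G.IsImmorality a b c

/-- The 2-biflag `[a, b; c, d]`: `a → c - d ← b` with `a, d` nonadjacent and `b, c` nonadjacent
(`a` and `b` may or may not be adjacent). -/
def IsBiflag (G : MixedGraph V) (a b c d : V) : Prop :=
  G.Arrow a c ∧ G.Line c d ∧ G.Arrow b d ∧ ¬ G.Adj a d ∧ ¬ G.Adj b c

/-! ### The AMP Markov property -/

/-- The smallest ancestral set (closed under parents) that contains `A`. -/
def An (G : MixedGraph V) (A : Set V) : Set V :=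
  {v | ∃ a ∈ A, Relation.ReflTransGen G.Arrow v a}

/-- The smallest coherent set (closed under neighbours) that contains `A`. -/
def Co (G : MixedGraph V) (A : Set V) : Set V :=
  {v | ∃ a ∈ A, Relation.ReflTransGen G.Line v a}

/-- The extended subgraph `G[A]`: the edges of `G` inside `An A` together with the lines of `G`
inside `Co (An A)`. -/
def extended (G : MixedGraph V) (A : Set V) : MixedGraph V where
  Edge a b := (G.Edge a b ∧ a ∈ G.An A ∧ b ∈ G.An A) ∨
    (G.Line a b ∧ a ∈ G.Co (G.An A) ∧ b ∈ G.Co (G.An A))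
  irrefl a h := h.elim (fun h => G.irrefl a h.1) (fun h => G.irrefl a h.1.1)

/-- The augmented graph `Gᵃ`: the undirected graph obtained by joining `a, b` for each triplex
`({a, b}, c)` and each 2-biflag `[a, b; c, d]`, and replacing all arrows by lines. -/
def augmented (G : MixedGraph V) : SimpleGraph V :=
  SimpleGraph.fromRel fun a b =>
    G.Adj a b ∨ (∃ c, G.IsTriplex a c b) ∨ ∃ c d, G.IsBiflag a b c d

/-- `S` separates `A` and `B` in the undirected graph `H`. -/
def Separates (H : SimpleGraph V) (A B S : Set V) : Prop :=
  ∀ a ∈ A, ∀ b ∈ B, ∀ p : H.Walk a b, ∃ s ∈ S, s ∈ p.support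

/-- The σ-algebra on the product space generated by the coordinates in `A`. -/
@[reducible]
def coordSigma (X : V → Type) [∀ v, MeasurableSpace (X v)] (A : Set V) :
    MeasurableSpace (∀ v, X v) :=
  MeasurableSpace.comap A.domRestrict MeasurableSpace.pi

theorem coordSigma_le (X : V → Type) [∀ v, MeasurableSpace (X v)] (A : Set V) :
    coordSigma X A ≤ MeasurableSpace.pi :=
  (measurable_pi_lambda _ fun _ => measurable_pi_apply _).comap_le

/-- `𝒫(G)` on the product space `∏ X v`: the probability distributions `P` that satisfy the
(global) AMP Markov property of `G`, that is, `A ⊥ B | S` under `P` for all pairwise disjoint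
`A, B, S` such that `S` separates `A` and `B` in `(G[A ∪ B ∪ S])ᵃ`. -/
def ampModel [Finite V] (G : MixedGraph V) (X : V → Type) [∀ v, MeasurableSpace (X v)]
    [∀ v, StandardBorelSpace (X v)] : Set (ProbabilityMeasure (∀ v, X v)) :=
  {P | ∀ A B S : Set V, Disjoint A B → Disjoint A S → Disjoint B S →
    Separates (G.extended (A ∪ B ∪ S)).augmented A B S →
      CondIndep (coordSigma X S) (coordSigma X A) (coordSigma X B) (coordSigma_le X S)
        (P : Measure (∀ v, X v))}

/-- AMP Markov equivalence: `𝒫(G) = 𝒫(H)`, for every choice of the state spaces of the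
variables. -/
def MarkovEquiv [Finite V] (G H : MixedGraph V) : Prop :=
  ∀ (X : V → Type) [∀ v, MeasurableSpace (X v)] [∀ v, StandardBorelSpace (X v)],
    G.ampModel X = H.ampModel X

/-- The AMP Markov equivalence class of `G₀`: all chain graphs that are AMP Markov equivalent
to `G₀`. -/
def ampClass [Finite V] (G₀ : MixedGraph V) : Set (MixedGraph V) :=
  {G | G.IsChainGraph ∧ MarkovEquiv G G₀}

/-- `G` is the AMP essential graph determined by the AMP Markov equivalence class of `G₀`. -/
structure IsEssentialGraphOf [Finite V] (G G₀ : MixedGraph V) : Prop where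
  skeleton_eq : G.skeleton = G₀.skeleton
  arrow_iff : ∀ a b, G.Arrow a b ↔
    (∃ H ∈ ampClass G₀, H.Arrow a b) ∧ ¬ ∃ H ∈ ampClass G₀, H.Arrow b a
  line_iff : ∀ a b, G.Line a b ↔
    (∀ H ∈ ampClass G₀, H.Line a b) ∨
      ((∃ H ∈ ampClass G₀, H.Arrow a b) ∧ ∃ H ∈ ampClass G₀, H.Arrow b a)

/-- `G` is the AMP essential graph of some AMP Markov equivalence class. -/
def IsAMPEssentialGraph [Finite V] (G : MixedGraph V) : Prop :=
  ∃ G₀ : MixedGraph V, G₀.IsChainGraph ∧ G.IsEssentialGraphOf G₀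

/-! ### The conditions of the characterization -/

/-- Neighbours of the set `A`. -/
def nb (G : MixedGraph V) (A : Set V) : Set V := {v | v ∉ A ∧ ∃ a ∈ A, G.Line v a}

/-- Covering neighbours of `A`. -/
def cnb (G : MixedGraph V) (A : Set V) : Set V := {v | v ∉ A ∧ ∀ a ∈ A, G.Line v a}

/-- Noncovering neighbours of `A`. -/
def ncnb (G : MixedGraph V) (A : Set V) : Set V :=
  {v | v ∉ A ∧ (∃ a ∈ A, G.Line v a) ∧ ∃ a ∈ A, ¬ G.Line v a}

/-- Parents of the set `A`. -/
def pa (G : MixedGraph V) (A : Set V) : Set V := {v | v ∉ A ∧ ∃ a ∈ A, G.Arrow v a}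

/-- Covering parents of `A`. -/
def cpa (G : MixedGraph V) (A : Set V) : Set V := {v | v ∉ A ∧ ∀ a ∈ A, G.Arrow v a}

/-- The closure `ξ ∪ pa(ξ)`. -/
def cl (G : MixedGraph V) (ξ : Set V) : Set V := ξ ∪ G.pa ξ

/-- `K` is a connected component of the induced subgraph `G_W`. -/
def IsComponentOf (G : MixedGraph V) (W K : Set V) : Prop :=
  ∃ c : (G.skeleton.induce W).ConnectedComponent, K = Subtype.val '' c.supp

/-- The chain components: the connected components of the graph that remains when all arrows are
removed. -/
def chainComponents (G : MixedGraph V) : Set (Set V) :=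
  {ξ | ∃ c : G.lineGraph.ConnectedComponent, ξ = c.supp}

/-- `Ξ_s(G)`: the nontrivial chain components `ξ` such that the induced subgraph on the closure of
`ξ` contains a chordless undirected cycle in `ξ` or a flag `a → b - c` whose line lies in `ξ`. -/
def strongComponents (G : MixedGraph V) : Set (Set V) :=
  {ξ | ξ ∈ G.chainComponents ∧ ξ.Nontrivial ∧
    ((∃ k v, (G.restrict (G.cl ξ)).IsChordlessUndirectedCycle k v ∧ ∀ i ≤ k, v i ∈ ξ) ∨
      ∃ a b c, (G.restrict (G.cl ξ)).IsFlag a b c ∧ b ∈ ξ ∧ c ∈ ξ)}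

/-- The line `a - b` is strong in `G`. -/
def StrongLine (G : MixedGraph V) (a b : V) : Prop :=
  G.Line a b ∧ ∃ ξ ∈ G.strongComponents, a ∈ ξ ∧ b ∈ ξ

/-- Property `S` of the induced subgraph on the closure of `ξ`. -/
def PropertyS (G : MixedGraph V) (ξ : Set V) : Prop :=
  ∀ α : Set V, α ⊂ ξ → α.Nonempty → (G.restrict ξ).skeleton.IsClique α →
    ((G.restrict ξ).cnb α).Nonempty →
      ∀ K, G.IsComponentOf ((G.restrict ξ).cnb α) K →
        ((G.restrict ξ).nb K \ α).Nonempty ∨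
        ((G.restrict (G.cl ξ)).pa α \ (G.restrict (G.cl ξ)).cpa K).Nonempty

/-- Property `S'` of the induced subgraph on the closure of `ξ`. -/
def PropertyS' (G : MixedGraph V) (ξ : Set V) : Prop :=
  ∀ κ : Set V, κ ⊂ ξ → κ.Nonempty → (G.skeleton.induce κ).Connected →
    ((G.restrict ξ).cnb κ).Nonempty →
    (G.restrict ξ).skeleton.IsClique ((G.restrict ξ).cnb κ) →
      ((G.restrict ξ).ncnb κ).Nonempty ∨
      ((G.restrict (G.cl ξ)).pa ((G.restrict ξ).cnb κ) \
        (G.restrict (G.cl ξ)).cpa κ).Nonempty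

/-- The arrow `a → b` of `G` is well protected: it occurs in one of the following eight
configurations as an induced subgraph.
(i) `c → a → b`, `c, b` nonadjacent; (ii) `a → b ← c`, `a, c` nonadjacent;
(iii) `a → c → b`; (iv) `a - c → b`, `a - d → b`, `c, d` distinct and nonadjacent;
(v) `a - c → b`, `a - c` strong; (vi) `c - a → b`, `c - a` strong, `c, b` nonadjacent;
(vii) `a → b - c`, `b - c` strong, `a, c` nonadjacent; (viii) `a → c - b`, `c - b` strong. -/
def WellProtected (G : MixedGraph V) (a b : V) : Prop :=
  G.Arrow a b ∧
  ((∃ c, G.Arrow c a ∧ ¬ G.Adj c b) ∨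
   (∃ c, G.IsImmorality a b c) ∨
   (∃ c, G.Arrow a c ∧ G.Arrow c b) ∨
   (∃ c d, G.Line a c ∧ G.Line a d ∧ G.IsImmorality c b d) ∨
   (∃ c, G.StrongLine a c ∧ G.Arrow c b) ∨
   (∃ c, G.StrongLine c a ∧ ¬ G.Adj c b) ∨
   (∃ c, G.StrongLine b c ∧ ¬ G.Adj a c) ∨
   (∃ c, G.StrongLine b c ∧ G.Arrow a c))

end MixedGraph

/-! Separation in the augmented extended graph is the absence of active walks, and distributions
built from one or two fair coins show that Markov equivalent chain graphs have the same skeleton and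
the same triplexes. Splitting a chain component, by directing the lines between a part `κ` of it and
the rest into `κ`, preserves the Markov property if the two sides have suitable parents; properties
S and S' both say that no part can be split off. If an arrow `a → b` is not well protected, the
components of `a` and `b` can be merged instead, which undoes a splitting. Splitting as long as
possible and then merging as long as possible yields a member of the class with properties
(G1)-(G3).

Such a graph is the essential graph of its class. The lines of its strong components are lines of
every equivalent chain graph. No arrow is reversed in an equivalent chain graph, since a reversed
arrow that is extremal with respect to the height contradicts each way of being well protected. The
components that are not strong are chordal and flag-free, and eliminating simplicial vertices lets
each of their lines be directed either way. -/

/-! ### Paths of relations and graphs without holes -/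

section Paths

open Relation

section RelationPaths

variable {α : Type*} {r : α → α → Prop} {a b c : α} {m n : ℕ}

/-- `b` is reached from `a` by exactly `n` steps of the relation `r`. The steps are recorded by a
sequence indexed by `ℕ`, whose terms beyond the `n`-th are irrelevant. -/
def ReachesIn (r : α → α → Prop) (n : ℕ) (a b : α) : Prop :=
  ∃ v : ℕ → α, v 0 = a ∧ v n = b ∧ ∀ i < n, r (v i) (v (i + 1))

/-- `v 0, …, v n` is an induced path of the relation `r`: consecutive terms are related, the terms
are distinct, and no term is related to a later one other than its successor. -/
structure IsInducedPath (r : α → α → Prop) (n : ℕ) (v : ℕ → α) : Prop where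
  rel : ∀ i < n, r (v i) (v (i + 1))
  ne : ∀ i j, i < j → j ≤ n → v i ≠ v j
  not_rel : ∀ i j, i + 1 < j → j ≤ n → ¬ r (v i) (v j)

theorem ReachesIn.single (h : r a b) : ReachesIn r 1 a b :=
  ⟨fun i => if i = 0 then a else b, by simp, by simp, by simpa using h⟩

theorem ReachesIn.trans (hab : ReachesIn r m a b) (hbc : ReachesIn r n b c) :
    ReachesIn r (m + n) a c := by
  obtain ⟨v, rfl, rfl, hv⟩ := hab
  obtain ⟨w, hw0, rfl, hw⟩ := hbc
  refine ⟨fun i => if i ≤ m then v i else w (i - m), by simp, ?_, fun i hi => ?_⟩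
  · rcases n.eq_zero_or_pos with rfl | hn
    · simp [hw0]
    · simp [hn.ne']
  · rcases lt_trichotomy i m with him | rfl | him
    · simpa [him.le, Nat.succ_le_of_lt him] using hv i him
    · simpa [hw0] using hw 0 (by omega)
    · have hsucc : i + 1 - m = i - m + 1 := by omega
      simpa [him.not_ge, (him.trans i.lt_succ_self).not_ge, hsucc] using hw (i - m) (by omega)

theorem reachesIn_of_seq {v : ℕ → α} (hv : ∀ i < n, r (v i) (v (i + 1))) {i j : ℕ} (hij : i ≤ j)
    (hj : j ≤ n) : ReachesIn r (j - i) (v i) (v j) :=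
  ⟨fun m => v (i + m), rfl, by simp [hij], fun m hm => hv (i + m) (by omega)⟩

theorem ReachesIn.reflTransGen (h : ReachesIn r n a b) : ReflTransGen r a b := by
  obtain ⟨v, rfl, rfl, hv⟩ := h
  induction n with
  | zero => exact .refl
  | succ n ih => exact (ih fun i hi => hv i (by omega)).tail (hv n n.lt_succ_self)

theorem exists_reachesIn_of_reflTransGen (h : ReflTransGen r a b) : ∃ n, ReachesIn r n a b := by
  induction h with
  | refl => exact ⟨0, fun _ => a, rfl, rfl, by simp⟩
  | tail _ hbc ih => exact ⟨_, ih.choose_spec.trans (.single hbc)⟩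

theorem exists_isInducedPath (h : ReflTransGen r a b) :
    ∃ (n : ℕ) (v : ℕ → α), v 0 = a ∧ v n = b ∧ IsInducedPath r n v := by
  classical
  have hex := exists_reachesIn_of_reflTransGen h
  obtain ⟨v, ha, hb, hv⟩ := Nat.find_spec hex
  have hmin : ∀ m, ReachesIn r m a b → Nat.find hex ≤ m := fun m => Nat.find_min' hex
  generalize Nat.find hex = n at *
  have initial {i} (hi : i ≤ n) : ReachesIn r i a (v i) := ha ▸ reachesIn_of_seq hv i.zero_le hi
  have final {j} (hj : j ≤ n) : ReachesIn r (n - j) (v j) b := hb ▸ reachesIn_of_seq hv hj le_rfl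
  refine ⟨n, v, ha, hb, hv, fun i j hij hj he => ?_, fun i j hij hj hr => ?_⟩
  · have := hmin _ ((initial (by omega)).trans (he ▸ final hj))
    omega
  · have := hmin _ (((initial (by omega)).trans (.single hr)).trans (final hj))
    omega

end RelationPaths

theorem reflTransGen_of_collapse {α : Type*} {r s : α → α → Prop} [Std.Symm r] [Std.Symm s]
    {κ : Set α} {a b c : α} (h : ReflTransGen r a b)
    (houtside : ∀ u v, r u v → u ∉ κ → v ∉ κ → ReflTransGen s u v)
    (hcross : ∀ u v, r u v → u ∉ κ → v ∈ κ → ReflTransGen s u c)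
    (ha : a ∈ κ → ReflTransGen s a c) (hb : b ∈ κ → ReflTransGen s b c) : ReflTransGen s a b := by
  classical
  have toImage {x} (hx : x ∈ κ → ReflTransGen s x c) :
      ReflTransGen s x (if x ∈ κ then c else x) := by
    split_ifs with hxκ
    · exact hx hxκ
    · exact .refl
  have hwalk : ReflTransGen s (if a ∈ κ then c else a) (if b ∈ κ then c else b) := by
    refine ReflTransGen.lift' (fun v => if v ∈ κ then c else v) (fun u v huv => ?_) _ _ h
    by_cases hu : u ∈ κ <;> by_cases hv : v ∈ κ <;>
      simp only [Function.onFun, hu, hv, if_true, if_false]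
    · exact .refl
    · exact symm_of (ReflTransGen s) (hcross v u (symm_of r huv) hv hu)
    · exact hcross u v huv hu hv
    · exact houtside u v huv hu hv
  exact ((toImage ha).trans hwalk).trans (symm_of (ReflTransGen s) (toImage hb))

section InducedSubgraphs

variable {V : Type u} {L : SimpleGraph V} {W K : Set V} {x y : V}

theorem reflTransGen_of_reachable_induce {x y : W} (h : (L.induce W).Reachable x y) :
    ReflTransGen (fun u v => L.Adj u v ∧ v ∈ W) x.1 y.1 :=
  ReflTransGen.lift Subtype.val (fun _ v huv => ⟨huv, v.2⟩) _ _
    ((SimpleGraph.reachable_iff_reflTransGen x y).mp h)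

theorem reachable_induce_of_reflTransGen (hx : x ∈ W)
    (h : ReflTransGen (fun u v => L.Adj u v ∧ v ∈ W) x y) :
    ∃ hy : y ∈ W, (L.induce W).Reachable ⟨x, hx⟩ ⟨y, hy⟩ := by
  induction h with
  | refl => exact ⟨hx, .refl _⟩
  | @tail u w _ huw ih =>
    obtain ⟨hu, ih⟩ := ih
    have hadj : (L.induce W).Adj ⟨u, hu⟩ ⟨w, huw.2⟩ := huw.1
    exact ⟨huw.2, ih.trans hadj.reachable⟩

theorem eq_supp_induce_iff :
    (∃ c : (L.induce W).ConnectedComponent, K = Subtype.val '' c.supp) ↔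
      K ⊆ W ∧ (L.induce K).Connected ∧ ∀ x ∈ K, ∀ y ∈ W, L.Adj x y → y ∈ K := by
  constructor
  · rintro ⟨c, rfl⟩
    have closed {x y : W} (hx : x ∈ c.supp) (hxy : L.Adj x y) : y ∈ c.supp :=
      c.mem_supp_of_adj_mem_supp hx hxy
    refine ⟨by rintro _ ⟨x, -, rfl⟩; exact x.2, ?_, ?_⟩
    · have : Nonempty (Subtype.val '' c.supp) := (c.nonempty_supp.image _).to_subtype
      refine ⟨?_⟩
      rintro ⟨_, x, hx, rfl⟩ ⟨_, y, hy, rfl⟩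
      have hxy : (L.induce W).Reachable x y :=
        SimpleGraph.ConnectedComponent.exact (Eq.trans hx (Eq.symm hy))
      refine (reachable_induce_of_reflTransGen (Set.mem_image_of_mem _ hx) ?_).2
      rw [SimpleGraph.reachable_iff_reflTransGen] at hxy
      suffices y ∈ c.supp ∧ ReflTransGen
          (fun u v => L.Adj u v ∧ v ∈ Subtype.val '' c.supp) x.1 y.1 from this.2
      clear hy
      induction hxy with
      | refl => exact ⟨hx, .refl⟩
      | tail _ huw ih =>
        have hw := closed ih.1 huw
        exact ⟨hw, ih.2.tail ⟨huw, Set.mem_image_of_mem _ hw⟩⟩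
    · rintro _ ⟨x, hx, rfl⟩ y hy hxy
      exact ⟨⟨y, hy⟩, closed hx hxy, rfl⟩
  · rintro ⟨hKW, hconn, hclosed⟩
    obtain ⟨x, hx⟩ := hconn.nonempty
    refine ⟨(L.induce W).connectedComponentMk ⟨x, hKW hx⟩, Set.ext fun y => ⟨fun hy => ?_, ?_⟩⟩
    · have hyx := reflTransGen_of_reachable_induce (hconn ⟨y, hy⟩ ⟨x, hx⟩)
      have hyx' : ReflTransGen (fun u v => L.Adj u v ∧ v ∈ W) y x :=
        ReflTransGen.mono (fun _ _ h => ⟨h.1, hKW h.2⟩) _ _ hyx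
      exact ⟨⟨y, hKW hy⟩, SimpleGraph.ConnectedComponent.sound
        (reachable_induce_of_reflTransGen (hKW hy) hyx').2, rfl⟩
    · rintro ⟨y, hy, rfl⟩
      have hxy := reflTransGen_of_reachable_induce (SimpleGraph.ConnectedComponent.exact hy).symm
      generalize y.1 = z at hxy
      induction hxy with
      | refl => exact hx
      | tail _ huw ih => exact hclosed _ ih _ huw.2 huw.1

end InducedSubgraphs

/-- `W` contains a chordless cycle of length at least four of the undirected graph `L`. -/
def HasHole {V : Type u} (L : SimpleGraph V) (W : Set V) : Prop :=
  ∃ (k : ℕ) (v : ℕ → V), 4 ≤ k ∧ v k = v 0 ∧ Set.InjOn v (Set.Iio k) ∧ (∀ i < k, v i ∈ W) ∧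
    (∀ i < k, L.Adj (v i) (v (i + 1))) ∧
    ∀ i j, i < j → j < k → j ≠ i + 1 → ¬ (i = 0 ∧ j + 1 = k) → ¬ L.Adj (v i) (v j)

theorem HasHole.exists_not_adj {V : Type u} {L : SimpleGraph V} {W : Set V} (h : HasHole L W) :
    ∃ x ∈ W, ∃ y ∈ W, x ≠ y ∧ ¬ L.Adj x y := by
  obtain ⟨k, v, hk, -, hinj, hmem, -, hchord⟩ := h
  refine ⟨v 0, hmem 0 (by omega), v 2, hmem 2 (by omega), fun h => ?_,
    hchord 0 2 (by omega) (by omega) (by omega) (by omega)⟩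
  exact absurd (hinj (show 0 < k by omega) (show 2 < k by omega) h) (by norm_num)

section Chordal

variable {V : Type u} {L L' : SimpleGraph V} {W W' A : Set V} {a b s v x y : V}

theorem IsInducedPath.of_within {α : Type*} {r : α → α → Prop} {U : Set α} {n : ℕ} {v : ℕ → α}
    (h : IsInducedPath (fun u w => r u w ∧ w ∈ U) n v) (h0 : v 0 ∈ U) :
    (∀ i ≤ n, v i ∈ U) ∧ IsInducedPath r n v := by
  have hmem : ∀ i ≤ n, v i ∈ U := by
    rintro (_ | i) hi
    · exact h0
    · exact (h.rel i hi).2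
  exact ⟨hmem, fun i hi => (h.rel i hi).1, h.ne,
    fun i j hij hj hr => h.not_rel i j hij hj ⟨hr, hmem j hj⟩⟩

theorem HasHole.congr (h : HasHole L W) (hW : W ⊆ W')
    (hL : ∀ x ∈ W, ∀ y ∈ W, L.Adj x y ↔ L'.Adj x y) : HasHole L' W' := by
  obtain ⟨k, v, hk, h0, hinj, hmem, hadj, hchord⟩ := h
  have hmem' : ∀ i ≤ k, v i ∈ W := fun i hi =>
    hi.lt_or_eq.elim (hmem i) fun h => h ▸ h0 ▸ hmem 0 (by omega)
  exact ⟨k, v, hk, h0, hinj, fun i hi => hW (hmem i hi),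
    fun i hi => (hL _ (hmem' i hi.le) _ (hmem' (i + 1) hi)).mp (hadj i hi),
    fun i j hij hj h1 h2 h3 => hchord i j hij hj h1 h2
      ((hL _ (hmem i (hij.trans hj)) _ (hmem j hj)).mpr h3)⟩

theorem HasHole.mono (h : HasHole L W) (hW : W ⊆ W') : HasHole L W' :=
  h.congr hW fun _ _ _ _ => Iff.rfl

theorem hasHole_of_isInducedPath {n : ℕ} {v : ℕ → V} (hn : 2 ≤ n) (hv : IsInducedPath L.Adj n v)
    (hvW : ∀ i ≤ n, v i ∈ W) (hbW : b ∈ W) (hvb : ∀ i ≤ n, v i ≠ b) (hfirst : L.Adj (v 0) b)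
    (hlast : L.Adj (v n) b) (hmid : ∀ i, 0 < i → i < n → ¬ L.Adj (v i) b) : HasHole L W := by
  refine ⟨n + 2, fun i => if i ≤ n then v i else if i = n + 1 then b else v 0, by omega, by simp,
    fun i hi j hj hij => ?_, fun i hi => ?_, fun i hi => ?_, fun i j hij hj hj' hij' => ?_⟩
  · have hi : i < n + 2 := hi
    have hj : j < n + 2 := hj
    have eq_of_le {i j} (hi : i ≤ n) (hj : j ≤ n) (hij : v i = v j) : i = j := by
      by_contra hne
      rcases Nat.lt_or_gt_of_ne hne with h | h
      · exact hv.ne i j h hj hij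
      · exact hv.ne j i h hi hij.symm
    dsimp only at hij
    split_ifs at hij with h1 h2 h3 h4 h5
    · exact eq_of_le h1 h2 hij
    · exact absurd hij (hvb i h1)
    · omega
    · exact absurd hij.symm (hvb j h5)
    all_goals omega
  · dsimp only
    split_ifs with h1 h2
    · exact hvW i h1
    · exact hbW
    · omega
  · dsimp only
    rcases lt_trichotomy i n with h | rfl | h
    · rw [if_pos h.le, if_pos (show i + 1 ≤ n from h)]
      exact hv.rel i h
    · rw [if_pos le_rfl, if_neg (by omega), if_pos rfl]
      exact hlast
    · rw [if_neg (by omega), if_pos (by omega), if_neg (by omega), if_neg (by omega)]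
      exact hfirst.symm
  · dsimp only
    rw [if_pos (show i ≤ n by omega)]
    by_cases hjn : j ≤ n
    · rw [if_pos hjn]
      exact hv.not_rel i j (by omega) hjn
    · rw [if_neg hjn, if_pos (by omega)]
      exact hmid i (by omega) (by omega)

/-- `s` is a simplicial vertex of the subgraph of `L` induced by `W`: its neighbours in `W` are
pairwise adjacent. -/
structure IsSimplicialIn (L : SimpleGraph V) (W : Set V) (s : V) : Prop where
  mem : s ∈ W
  isClique : L.IsClique (W ∩ L.neighborSet s)

theorem HasHole.exists_subset_not_isSimplicialIn (h : HasHole L W) :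
    ∃ U ⊆ W, U.Nonempty ∧ ∀ s, ¬ IsSimplicialIn L U s := by
  obtain ⟨k, v, hk, h0, hinj, hmem, hadj, hchord⟩ := h
  refine ⟨v '' Set.Iio k, ?_, ⟨v 0, 0, show 0 < k by omega, rfl⟩, ?_⟩
  · rintro _ ⟨i, hi, rfl⟩
    exact hmem i hi
  · rintro _ ⟨⟨i, hi, rfl⟩, hclique⟩
    replace hi : i < k := hi
    have not_both : ∀ i₁ i₂, i₁ < i₂ → i₂ < k → i₂ ≠ i₁ + 1 → ¬ (i₁ = 0 ∧ i₂ + 1 = k) →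
        L.Adj (v i) (v i₁) → ¬ L.Adj (v i) (v i₂) := fun i₁ i₂ h1 h2 h3 h4 h5 h6 =>
      hchord i₁ i₂ h1 h2 h3 h4 (hclique ⟨⟨i₁, h1.trans h2, rfl⟩, h5⟩ ⟨⟨i₂, h2, rfl⟩, h6⟩
        fun h => absurd (hinj (h1.trans h2) h2 h) h1.ne)
    rcases i with _ | i
    · have hlast := hadj (k - 1) (by omega)
      rw [Nat.sub_add_cancel (by omega), h0] at hlast
      exact not_both 1 (k - 1) (by omega) (by omega) (by omega) (by omega) (hadj 0 hi) hlast.symm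
    · have hprev : L.Adj (v (i + 1)) (v i) := (hadj i (by omega)).symm
      by_cases hik : i + 2 = k
      · have hnext : L.Adj (v (i + 1)) (v 0) := h0 ▸ hik ▸ hadj (i + 1) hi
        exact not_both 0 i (by omega) (by omega) (by omega) (by omega) hnext hprev
      · exact not_both i (i + 2) (by omega) (by omega) (by omega) (by omega) hprev (hadj (i + 1) hi)

/-- The vertices of `W` that neither belong to `A` nor have a neighbour in `A`. -/
def remote (L : SimpleGraph V) (W A : Set V) : Set V := {b ∈ W | b ∉ A ∧ ∀ a ∈ A, ¬ L.Adj a b}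

/-- The vertices of `W` outside `A` with a neighbour in `A`. -/
def attached (L : SimpleGraph V) (W A : Set V) : Set V := {s ∈ W | s ∉ A ∧ ∃ a ∈ A, L.Adj a s}

theorem connected_induce_insert (hA : (L.induce A).Connected) (ha : a ∈ A) (has : L.Adj a s) :
    (L.induce (insert s A)).Connected := by
  rw [← Set.union_singleton]
  exact SimpleGraph.connected_induce_union hA.preconnected .of_subsingleton ha rfl has

-- Two nonadjacent vertices `s` and `t` would be joined by an induced path through `A`, which closes
-- up to a hole through `b`.
theorem isClique_attached (hW : ¬ HasHole L W) (hAW : A ⊆ W) (hA : (L.induce A).Connected)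
    (hb : b ∈ remote L W A) (hjoin : ∀ s ∈ attached L W A, L.Adj s b) :
    L.IsClique (attached L W A) := by
  rintro s hs t ht hst
  by_contra hadj
  have hsb := hjoin s hs
  have htb := hjoin t ht
  obtain ⟨⟨hsW, -, a, ha, has⟩, htW, -, a', ha', hat⟩ := hs, ht
  have hconn : (L.induce (insert t (insert s A))).Connected :=
    connected_induce_insert (connected_induce_insert hA ha has) (Or.inr ha') hat
  have hsU : s ∈ insert t (insert s A) := Or.inr (Or.inl rfl)
  obtain ⟨n, v, h0, hn, hpath⟩ : ∃ (n : ℕ) (v : ℕ → V), v 0 = s ∧ v n = t ∧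
      IsInducedPath (fun u w => L.Adj u w ∧ w ∈ insert t (insert s A)) n v :=
    exists_isInducedPath (reflTransGen_of_reachable_induce (hconn ⟨s, hsU⟩ ⟨t, Or.inl rfl⟩))
  obtain ⟨hmem, hpath⟩ := hpath.of_within (h0.symm ▸ hsU)
  have hn2 : 2 ≤ n := by
    rcases n with _ | _ | n
    · exact absurd (h0.symm.trans hn) hst
    · exact absurd (h0 ▸ hn ▸ hpath.rel 0 one_pos) hadj
    · omega
  have hmid : ∀ i, 0 < i → i < n → v i ∈ A := by
    intro i hpos hi
    rcases hmem i hi.le with h | h | h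
    · exact absurd (h.trans hn.symm) (hpath.ne i n hi le_rfl)
    · exact absurd (h0.trans h.symm) (hpath.ne 0 i hpos hi.le)
    · exact h
  refine hW (hasHole_of_isInducedPath hn2 hpath (fun i hi => ?_) hb.1 (fun i hi => ?_)
    (h0.symm ▸ hsb) (hn.symm ▸ htb) fun i hpos hi => hb.2.2 _ (hmid i hpos hi))
  · rcases hmem i hi with h | h | h
    exacts [h ▸ htW, h ▸ hsW, hAW h]
  · rintro rfl
    rcases hmem i hi with h | h | h
    exacts [htb.ne h.symm, hsb.ne h.symm, hb.2.1 h]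

-- Take `A` maximal among the connected sets that contain `v` and leave some vertex remote.
theorem exists_connected_attached_join_remote [Finite V] (hv : v ∈ W)
    (hne : (remote L W {v}).Nonempty) :
    ∃ A ⊆ W, v ∈ A ∧ (L.induce A).Connected ∧ (remote L W A).Nonempty ∧
      ∀ s ∈ attached L W A, ∀ b ∈ remote L W A, L.Adj s b := by
  let F : Set (Set V) := {A | A ⊆ W ∧ v ∈ A ∧ (L.induce A).Connected ∧ (remote L W A).Nonempty}
  have hF : {v} ∈ F := ⟨Set.singleton_subset_iff.mpr hv, rfl, .of_subsingleton, hne⟩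
  obtain ⟨A, ⟨hAW, hvA, hconn, hA⟩, hmax⟩ := (Set.toFinite F).exists_maximal ⟨_, hF⟩
  refine ⟨A, hAW, hvA, hconn, hA, ?_⟩
  rintro s ⟨hsW, hsA, a, ha, has⟩ b ⟨hbW, hbA, hb⟩
  by_contra hadj
  have hinsert : insert s A ∈ F := by
    refine ⟨Set.insert_subset hsW hAW, Or.inr hvA, connected_induce_insert hconn ha has, b, hbW,
      ?_, ?_⟩
    · rintro (rfl | h)
      exacts [hb a ha has, hbA h]
    · rintro a' (rfl | ha')
      exacts [hadj, hb a' ha']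
  exact hsA (hmax hinsert (Set.subset_insert s A) (Or.inl rfl))

theorem IsSimplicialIn.of_remote (hs : IsSimplicialIn L (remote L W A) s)
    (hclique : L.IsClique (attached L W A))
    (hjoin : ∀ t ∈ attached L W A, ∀ b ∈ remote L W A, L.Adj t b) : IsSimplicialIn L W s := by
  obtain ⟨⟨hsW, -, hsA⟩, hs⟩ := hs
  have remote_or_attached {x} (hx : x ∈ W) (hsx : L.Adj s x) :
      x ∈ remote L W A ∨ x ∈ attached L W A := by
    have hxA : x ∉ A := fun h => hsA x h hsx.symm
    by_cases h : ∃ a ∈ A, L.Adj a x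
    · exact Or.inr ⟨hx, hxA, h⟩
    · push Not at h
      exact Or.inl ⟨hx, hxA, h⟩
  refine ⟨hsW, fun x ⟨hx, hsx⟩ y ⟨hy, hsy⟩ hxy => ?_⟩
  rcases remote_or_attached hx hsx with hx | hx <;> rcases remote_or_attached hy hsy with hy | hy
  · exact hs ⟨hx, hsx⟩ ⟨hy, hsy⟩ hxy
  · exact (hjoin y hy x hx).symm
  · exact hjoin x hx y hy
  · exact hclique hx hy hxy

theorem isSimplicialIn_of_remote_eq_empty (hs : s ∈ W)
    (h : ∀ u ∈ W, remote L W {u} = ∅) : IsSimplicialIn L W s := by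
  refine ⟨hs, fun x hx y hy hxy => ?_⟩
  by_contra hadj
  have hmem : y ∈ remote L W {x} := ⟨hy.1, hxy.symm, fun _ ha => ha ▸ hadj⟩
  exact Set.notMem_empty y (h x hx.1 ▸ hmem)

-- Dirac's theorem on chordal graphs.
theorem exists_isSimplicialIn_mem_remote [Finite V] (hW : ¬ HasHole L W) (hv : v ∈ W)
    (hne : (remote L W {v}).Nonempty) : ∃ s ∈ remote L W {v}, IsSimplicialIn L W s := by
  induction hn : W.ncard using Nat.strong_induction_on generalizing W v with
  | _ n ih =>
  obtain ⟨A, hAW, hvA, hA, ⟨b, hb⟩, hjoin⟩ := exists_connected_attached_join_remote hv hne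
  have hclique : L.IsClique (attached L W A) :=
    isClique_attached hW hAW hA hb fun s hs => hjoin s hs b hb
  have hsub : remote L W A ⊂ W := ⟨fun _ h => h.1, fun h => (h hv).2.1 hvA⟩
  obtain ⟨s, hs⟩ : ∃ s, IsSimplicialIn L (remote L W A) s := by
    by_cases h : ∃ u ∈ remote L W A, (remote L (remote L W A) {u}).Nonempty
    · obtain ⟨u, hu, hne⟩ := h
      obtain ⟨s, -, hs⟩ := ih _ (hn ▸ Set.ncard_lt_ncard hsub) (fun h => hW (h.mono hsub.1)) hu
        hne rfl
      exact ⟨s, hs⟩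
    · push Not at h
      exact ⟨b, isSimplicialIn_of_remote_eq_empty hb h⟩
  refine ⟨s, ⟨hs.mem.1, ?_, ?_⟩, hs.of_remote hclique hjoin⟩
  · rintro rfl
    exact hs.mem.2.1 hvA
  · rintro _ rfl
    exact hs.mem.2.2 _ hvA

theorem exists_isSimplicialIn [Finite V] (hW : ¬ HasHole L W) (hne : W.Nonempty) :
    ∃ s, IsSimplicialIn L W s := by
  by_cases h : ∃ u ∈ W, (remote L W {u}).Nonempty
  · obtain ⟨u, hu, hne⟩ := h
    obtain ⟨s, -, hs⟩ := exists_isSimplicialIn_mem_remote hW hu hne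
    exact ⟨s, hs⟩
  · push Not at h
    exact ⟨hne.some, isSimplicialIn_of_remote_eq_empty hne.some_mem h⟩

theorem exists_isSimplicialIn_ne [Finite V] (hW : ¬ HasHole L W) (hx : x ∈ W) (hy : y ∈ W)
    (hxy : L.Adj x y) (hz : (W \ {x, y}).Nonempty) :
    ∃ s, IsSimplicialIn L W s ∧ s ≠ x ∧ s ≠ y := by
  by_cases hxne : (remote L W {x}).Nonempty
  · obtain ⟨s, ⟨-, hsx, hadj⟩, hs⟩ := exists_isSimplicialIn_mem_remote hW hx hxne
    exact ⟨s, hs, hsx, fun h => hadj x rfl (h ▸ hxy)⟩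
  by_cases hyne : (remote L W {y}).Nonempty
  · obtain ⟨s, ⟨-, hsy, hadj⟩, hs⟩ := exists_isSimplicialIn_mem_remote hW hy hyne
    exact ⟨s, hs, fun h => hadj y rfl (h ▸ hxy.symm), hsy⟩
  have adj_all {u w} (hu : ¬ (remote L W {u}).Nonempty) (hw : w ∈ W) (huw : u ≠ w) :
      L.Adj u w := by
    by_contra hadj
    exact hu ⟨w, hw, huw.symm, fun _ ha => ha ▸ hadj⟩
  obtain ⟨s, ⟨hsW, hsxy⟩, hs⟩ := exists_isSimplicialIn (fun h => hW (h.mono Set.sdiff_subset)) hz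
  rw [Set.mem_insert_iff, Set.mem_singleton_iff, not_or] at hsxy
  have hclique : L.IsClique (insert x (insert y (W \ {x, y} ∩ L.neighborSet s))) := by
    rw [SimpleGraph.isClique_insert, SimpleGraph.isClique_insert]
    refine ⟨⟨hs, fun w hw => adj_all hyne hw.1.1⟩, ?_⟩
    rintro w (rfl | hw)
    exacts [adj_all hxne hy, adj_all hxne hw.1.1]
  refine ⟨s, ⟨hsW, hclique.subset fun w ⟨hw, hsw⟩ => ?_⟩, hsxy⟩
  by_cases hwx : w = x
  · exact Or.inl hwx
  by_cases hwy : w = y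
  · exact Or.inr (Or.inl hwy)
  exact Or.inr (Or.inr ⟨⟨hw, fun h => h.elim hwx hwy⟩, hsw⟩)

end Chordal

end Paths

/-! ### Conditional independence -/

section Measure

variable {Ω : Type*} {m m₁ m₂ mΩ : MeasurableSpace Ω} {μ : Measure Ω}

theorem indepFun_map_iff {Ω' β γ : Type*} [MeasurableSpace Ω'] [MeasurableSpace β]
    [MeasurableSpace γ] {X : Ω → Ω'} {f : Ω' → β} {g : Ω' → γ} (hX : Measurable X)
    (hf : Measurable f) (hg : Measurable g) :
    IndepFun f g (μ.map X) ↔ IndepFun (f ∘ X) (g ∘ X) μ := by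
  simp only [indepFun_iff_measure_inter_preimage_eq_mul]
  refine forall₄_congr fun s t hs ht => ?_
  rw [Measure.map_apply hX ((hf hs).inter (hg ht)), Measure.map_apply hX (hf hs),
    Measure.map_apply hX (hg ht)]
  rfl

variable [IsProbabilityMeasure μ]

theorem indep_of_indep_self (hm : m ≤ mΩ) (h : Indep m m μ) : Indep m₁ m μ := by
  refine (Indep_iff _ _ _).mpr fun t₁ t₂ _ ht₂ => ?_
  rcases measure_eq_zero_or_one_of_indepSet_self (h.indepSet_of_measurableSet ht₂ ht₂) with h0 | h1
  · rw [h0, mul_zero, measure_inter_null_of_null_right _ h0]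
  · rw [h1, mul_one, Set.inter_comm,
      Measure.measure_inter_eq_of_ae ((mem_ae_iff_prob_eq_one (hm t₂ ht₂)).mpr h1)]

theorem condExp_indicator_eq_of_indep (hm : m ≤ mΩ) (hm₁ : m₁ ≤ mΩ) (h : Indep m₁ m μ) {t : Set Ω}
    (ht : MeasurableSet[m₁] t) : μ⟦t | m⟧ =ᵐ[μ] fun _ => μ.real t := by
  have ht' : StronglyMeasurable[m₁] (t.indicator fun _ : Ω => (1 : ℝ)) :=
    (@stronglyMeasurable_const _ _ m₁ _ (1 : ℝ)).indicator ht
  have := condExp_indep_eq hm₁ hm ht' h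
  rwa [integral_indicator_const (1 : ℝ) (hm₁ t ht), smul_eq_mul, mul_one] at this

theorem condExp_indicator_inter_of_ae_eq_const (hm : m ≤ mΩ) (t₁ : Set Ω) {t₂ : Set Ω} {c : ℝ}
    (hc : t₂.indicator (fun _ => (1 : ℝ)) =ᵐ[μ] fun _ => c) :
    μ⟦t₁ ∩ t₂ | m⟧ =ᵐ[μ] μ⟦t₁ | m⟧ * μ⟦t₂ | m⟧ := by
  have h₂ : μ⟦t₂ | m⟧ =ᵐ[μ] fun _ => c := by
    simpa only [condExp_const hm] using condExp_congr_ae (m := m) hc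
  have h_inter : ((t₁ ∩ t₂).indicator fun _ => (1 : ℝ)) =ᵐ[μ]
      c • t₁.indicator fun _ => (1 : ℝ) := by
    filter_upwards [hc] with x hx
    rw [Pi.smul_apply, ← hx]
    by_cases h₁ : x ∈ t₁ <;> by_cases h₂ : x ∈ t₂ <;> simp [h₁, h₂]
  filter_upwards [h₂, condExp_congr_ae (m := m) h_inter,
    condExp_smul (μ := μ) c (t₁.indicator fun _ => (1 : ℝ)) m] with x h₂ h_inter h_smul
  rw [h_inter, h_smul, Pi.mul_apply, h₂, Pi.smul_apply, smul_eq_mul, mul_comm]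

variable [StandardBorelSpace Ω]

theorem condIndep_of_indep_self (hm : m ≤ mΩ) (hm₁ : m₁ ≤ mΩ) (hm₂ : m₂ ≤ mΩ) (h : Indep m m μ)
    (h₁₂ : Indep m₁ m₂ μ) : CondIndep m m₁ m₂ hm μ := by
  refine (condIndep_iff m m₁ m₂ hm hm₁ hm₂ μ).mpr fun t₁ t₂ ht₁ ht₂ => ?_
  have condExp_eq {t : Set Ω} (ht : MeasurableSet[mΩ] t) : μ⟦t | m⟧ =ᵐ[μ] fun _ => μ.real t :=
    condExp_indicator_eq_of_indep hm le_rfl (indep_of_indep_self hm h) ht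
  filter_upwards [condExp_eq (hm₁ t₁ ht₁), condExp_eq (hm₂ t₂ ht₂),
    condExp_eq ((hm₁ t₁ ht₁).inter (hm₂ t₂ ht₂))] with x h₁ h₂ h_inter
  rw [Pi.mul_apply, h₁, h₂, h_inter, measureReal_def, (Indep_iff m₁ m₂ μ).mp h₁₂ t₁ t₂ ht₁ ht₂,
    ENNReal.toReal_mul]
  rfl

theorem condIndep_of_indep_self_right (hm : m ≤ mΩ) (hm₁ : m₁ ≤ mΩ) (hm₂ : m₂ ≤ mΩ)
    (h : Indep m₂ m₂ μ) : CondIndep m m₁ m₂ hm μ := by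
  refine (condIndep_iff m m₁ m₂ hm hm₁ hm₂ μ).mpr fun t₁ t₂ _ ht₂ => ?_
  rcases measure_eq_zero_or_one_of_indepSet_self (h.indepSet_of_measurableSet ht₂ ht₂) with h0 | h1
  · refine condExp_indicator_inter_of_ae_eq_const hm t₁ (c := 0) ?_
    filter_upwards [measure_eq_zero_iff_ae_notMem.mp h0] with x hx
    exact Set.indicator_of_notMem hx _
  · refine condExp_indicator_inter_of_ae_eq_const hm t₁ (c := 1) ?_
    filter_upwards [(mem_ae_iff_prob_eq_one (hm₂ t₂ ht₂)).mpr h1] with x hx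
    exact Set.indicator_of_mem hx _

theorem measureReal_inter_of_condIndep (hm : m ≤ mΩ) (hm₁ : m₁ ≤ mΩ) (hm₂ : m₂ ≤ mΩ)
    (h : CondIndep m m₁ m₂ hm μ) (h₁ : Indep m₁ m μ) (h₂ : Indep m₂ m μ) {t₁ t₂ E : Set Ω}
    (ht₁ : MeasurableSet[m₁] t₁) (ht₂ : MeasurableSet[m₂] t₂) (hE : MeasurableSet[m] E) :
    μ.real (t₁ ∩ t₂ ∩ E) = μ.real t₁ * μ.real t₂ * μ.real E := by
  have h_const : (μ⟦t₁ ∩ t₂ | m⟧) =ᵐ[μ] fun _ => μ.real t₁ * μ.real t₂ := by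
    filter_upwards [(condIndep_iff m m₁ m₂ hm hm₁ hm₂ μ).mp h t₁ t₂ ht₁ ht₂,
      condExp_indicator_eq_of_indep hm hm₁ h₁ ht₁,
      condExp_indicator_eq_of_indep hm hm₂ h₂ ht₂] with x h_inter h₁ h₂
    rw [h_inter, Pi.mul_apply, h₁, h₂]
  have ht : MeasurableSet (t₁ ∩ t₂) := (hm₁ t₁ ht₁).inter (hm₂ t₂ ht₂)
  have h_int := setIntegral_condExp hm ((integrable_const (1 : ℝ)).indicator ht) hE (μ := μ)
  rw [setIntegral_congr_ae (hm E hE) (h_const.mono fun x hx _ => hx), setIntegral_const,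
    integral_indicator_const (1 : ℝ) ht, smul_eq_mul, smul_eq_mul, mul_one,
    measureReal_restrict_apply ht] at h_int
  rw [← h_int, mul_comm]

end Measure

namespace MixedGraph

open Relation

variable {V : Type u}

/-! ### Chain graphs and reachability -/

section ChainGraph

variable {G H : MixedGraph V} {a b c : V}

/-- `b` can be reached from `a` along arrows and lines. -/
def Reach (G : MixedGraph V) (a b : V) : Prop := ReflTransGen G.Edge a b

theorem Reach.refl (a : V) : G.Reach a a := ReflTransGen.refl

theorem Reach.trans (hab : G.Reach a b) (hbc : G.Reach b c) : G.Reach a c :=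
  ReflTransGen.trans hab hbc

theorem Arrow.reach (h : G.Arrow a b) : G.Reach a b := ReflTransGen.single h.1

theorem Line.reach (h : G.Line a b) : G.Reach a b := ReflTransGen.single h.1

theorem Line.symm (h : G.Line a b) : G.Line b a := And.symm h

instance : Std.Symm G.Line := ⟨fun _ _ => Line.symm⟩

theorem Arrow.adj (h : G.Arrow a b) : G.Adj a b := Or.inl h.1

theorem Line.adj (h : G.Line a b) : G.Adj a b := Or.inl h.1

theorem Adj.symm (h : G.Adj a b) : G.Adj b a := Or.symm h

theorem Adj.ne (h : G.Adj a b) : a ≠ b := by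
  rintro rfl
  exact h.elim (G.irrefl a) (G.irrefl a)

theorem Arrow.ne (h : G.Arrow a b) : a ≠ b := h.adj.ne

theorem Line.ne (h : G.Line a b) : a ≠ b := h.adj.ne

theorem adj_iff : G.Adj a b ↔ G.Line a b ∨ G.Arrow a b ∨ G.Arrow b a := by
  unfold Adj Line Arrow; tauto

theorem edge_iff : G.Edge a b ↔ G.Line a b ∨ G.Arrow a b := by
  unfold Line Arrow; tauto

theorem ext_arrow_line (hA : ∀ a b, G.Arrow a b ↔ H.Arrow a b)
    (hL : ∀ a b, G.Line a b ↔ H.Line a b) : G = H := by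
  ext a b
  rw [edge_iff, edge_iff, hA, hL]

theorem reach_of_reflTransGen_arrow (h : ReflTransGen G.Arrow a b) : G.Reach a b :=
  ReflTransGen.mono (fun _ _ h => h.1) _ _ h

theorem reach_of_reflTransGen_line (h : ReflTransGen G.Line a b) : G.Reach a b :=
  ReflTransGen.mono (fun _ _ h => h.1) _ _ h

theorem IsChainGraph.not_reach (hG : G.IsChainGraph) (hab : G.Arrow a b) : ¬ G.Reach b a := by
  intro hba
  obtain ⟨n, v, h0, hn, hv⟩ := exists_isInducedPath hba
  have hn2 : 2 ≤ n := by
    rcases n with _ | _ | n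
    · exact absurd (hn.symm.trans h0) hab.ne
    · exact absurd (by simpa [h0, hn] using hv.rel 0 one_pos) hab.2
    · omega
  -- The path from `b` to `a` is closed up by the arrow `a → b`.
  let w : ℕ → V := fun i => if i ≤ n then v i else b
  have hw {i} (hi : i ≤ n) : w i = v i := if_pos hi
  have hwn : w (n + 1) = b := if_neg (by omega)
  refine hG (n + 1) w ⟨⟨by omega, by rw [hwn, hw n.zero_le, h0], ?_, ?_⟩, n, by omega, ?_⟩
  · intro i hi j hj hij
    have hi : i ≤ n := Nat.lt_succ_iff.mp hi
    have hj : j ≤ n := Nat.lt_succ_iff.mp hj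
    rw [hw hi, hw hj] at hij
    rcases lt_trichotomy i j with h | h | h
    · exact absurd hij (hv.ne i j h hj)
    · exact h
    · exact absurd hij.symm (hv.ne j i h hi)
  · intro i hi
    rcases Nat.lt_succ_iff_lt_or_eq.mp hi with h | rfl
    · simpa only [hw h.le, hw (Nat.succ_le_of_lt h)] using hv.rel i h
    · simpa only [hw le_rfl, hwn, hn] using hab.1
  · simpa only [hw le_rfl, hwn, hn] using hab

theorem isChainGraph_of_not_reach (h : ∀ a b, G.Arrow a b → ¬ G.Reach b a) : G.IsChainGraph := by
  rintro k v ⟨⟨-, h0, -, hv⟩, i, hi, hA⟩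
  have toEnd : G.Reach (v (i + 1)) (v 0) := h0 ▸ (reachesIn_of_seq hv hi le_rfl).reflTransGen
  have fromStart : G.Reach (v 0) (v i) := (reachesIn_of_seq hv i.zero_le hi.le).reflTransGen
  exact h _ _ hA (toEnd.trans fromStart)

theorem IsChainGraph.line_of_adj (hG : G.IsChainGraph) (h : G.Adj a b) (hab : G.Reach a b)
    (hba : G.Reach b a) : G.Line a b := by
  rcases adj_iff.mp h with h | h | h
  · exact h
  · exact absurd hba (hG.not_reach h)
  · exact absurd hab (hG.not_reach h)

theorem arrow_of_adj (h : G.Adj a b) (hba : ¬ G.Reach b a) : G.Arrow a b := by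
  rcases adj_iff.mp h with h | h | h
  · exact absurd h.symm.reach hba
  · exact h
  · exact absurd h.reach hba

theorem IsChainGraph.reflTransGen_line (hG : G.IsChainGraph) (hab : G.Reach a b)
    (hba : G.Reach b a) : ReflTransGen G.Line a b := by
  induction hab with
  | refl => exact .refl
  | @tail b c hab hbc ih =>
    have hline : G.Line b c := hG.line_of_adj (Or.inl hbc) (.single hbc) (hba.trans hab)
    exact (ih (hline.reach.trans hba)).tail hline

theorem IsChainGraph.exists_height [Finite V] (hG : G.IsChainGraph) :
    ∃ r : V → ℕ, (∀ a b, G.Arrow a b → r a < r b) ∧ ∀ a b, G.Line a b → r a = r b := by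
  have mono {a b} (h : G.Reach a b) : {y | G.Reach y a} ⊆ {y | G.Reach y b} :=
    fun y hy => Reach.trans hy h
  refine ⟨fun a => {y | G.Reach y a}.ncard, fun a b h => ?_, fun a b h => ?_⟩
  · exact Set.ncard_lt_ncard ⟨mono h.reach, fun hs => hG.not_reach h (hs (Reach.refl b))⟩
  · exact (Set.ncard_le_ncard (mono h.reach)).antisymm (Set.ncard_le_ncard (mono h.symm.reach))

end ChainGraph

section Triplex

variable {G : MixedGraph V} {a b c : V}

theorem IsImmorality.symm (h : G.IsImmorality a b c) : G.IsImmorality c b a :=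
  ⟨h.1.symm, h.2.2.1, h.2.1, fun hca => h.2.2.2 hca.symm⟩

theorem IsTriplex.symm (h : G.IsTriplex a b c) : G.IsTriplex c b a := by
  rcases h with h | h | h
  · exact Or.inr (Or.inl h)
  · exact Or.inl h
  · exact Or.inr (Or.inr h.symm)

theorem IsTriplex.not_adj (h : G.IsTriplex a b c) : ¬ G.Adj a c := by
  rcases h with h | h | h
  · exact h.2.2
  · exact fun hac => h.2.2 hac.symm
  · exact h.2.2.2

theorem IsTriplex.ne (h : G.IsTriplex a b c) : a ≠ c := by
  rintro rfl
  rcases h with h | h | h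
  · exact h.1.2 h.2.1.1
  · exact h.1.2 h.2.1.1
  · exact h.1 rfl

theorem IsTriplex.adj_left (h : G.IsTriplex a b c) : G.Adj a b := by
  rcases h with h | h | h
  · exact h.1.adj
  · exact h.2.1.adj.symm
  · exact h.2.1.adj

theorem IsTriplex.adj_right (h : G.IsTriplex a b c) : G.Adj b c := h.symm.adj_left.symm

theorem IsTriplex.not_arrow_left (h : G.IsTriplex a b c) : ¬ G.Arrow b a := by
  rintro ⟨-, hab⟩
  rcases h with h | h | h
  · exact hab h.1.1
  · exact hab h.2.1.2
  · exact hab h.2.1.1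

theorem IsTriplex.not_arrow_right (h : G.IsTriplex a b c) : ¬ G.Arrow b c :=
  h.symm.not_arrow_left

theorem IsTriplex.not_line_right (h : G.IsTriplex a b c) (hab : G.Line a b) : ¬ G.Line b c := by
  intro hbc
  rcases h with h | h | h
  · exact h.1.2 hab.2
  · exact h.1.2 hbc.1
  · exact h.2.1.2 hab.2

theorem isTriplex_of_arrow (hne : a ≠ c) (hab : G.Arrow a b) (hac : ¬ G.Adj a c)
    (hbc : G.Adj b c) (hbc' : ¬ G.Arrow b c) : G.IsTriplex a b c := by
  rcases adj_iff.mp hbc with h | h | h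
  · exact Or.inl ⟨hab, h, hac⟩
  · exact absurd h hbc'
  · exact Or.inr (Or.inr ⟨hne, hab, h, hac⟩)

end Triplex

/-! ### Separation in augmented graphs and active walks -/

section Augmented

variable {G : MixedGraph V} {a b x y u w : V} {A B N S : Set V}

theorem augmented_adj_of_adj (h : G.Adj a b) : G.augmented.Adj a b :=
  ⟨h.ne, Or.inl (Or.inl h)⟩

theorem IsTriplex.augmented_adj (h : G.IsTriplex a u b) : G.augmented.Adj a b :=
  ⟨h.ne, Or.inl (Or.inr (Or.inl ⟨u, h⟩))⟩

theorem augmented_adj_of_arrow_of_arrow (hab : a ≠ b) (hau : G.Arrow a u) (hbu : G.Arrow b u) :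
    G.augmented.Adj a b := by
  by_cases hadj : G.Adj a b
  · exact augmented_adj_of_adj hadj
  · exact IsTriplex.augmented_adj (Or.inr (Or.inr ⟨hab, hau, hbu, hadj⟩))

theorem augmented_adj_of_arrow_of_line (hau : G.Arrow a u) (hub : G.Line u b) :
    G.augmented.Adj a b := by
  by_cases hadj : G.Adj a b
  · exact augmented_adj_of_adj hadj
  · exact IsTriplex.augmented_adj (Or.inl ⟨hau, hub, hadj⟩)

theorem IsChainGraph.augmented_adj_of_arrow_line_arrow (hG : G.IsChainGraph) (hab : a ≠ b)
    (hau : G.Arrow a u) (huw : G.Line u w) (hbw : G.Arrow b w) : G.augmented.Adj a b := by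
  by_cases haw : G.Adj a w
  · rcases adj_iff.mp haw with haw | haw | hwa
    · exact (augmented_adj_of_arrow_of_line hbw haw.symm).symm
    · exact augmented_adj_of_arrow_of_arrow hab haw hbw
    · exact absurd (huw.reach.trans hwa.reach) (hG.not_reach hau)
  by_cases hbu : G.Adj b u
  · rcases adj_iff.mp hbu with hbu | hbu | hub
    · exact augmented_adj_of_arrow_of_line hau hbu.symm
    · exact augmented_adj_of_arrow_of_arrow hab hau hbu
    · exact absurd (huw.symm.reach.trans hub.reach) (hG.not_reach hbw)
  exact ⟨hab, Or.inl (Or.inr (Or.inr ⟨u, w, hau, huw, hbw, haw, hbu⟩))⟩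

/-- `x` equals `u` or is a parent of `u`. The augmented graph joins any two vertices that touch the
same vertex or the two ends of a line, which is how it keeps track of active walks. -/
def Touches (G : MixedGraph V) (x u : V) : Prop := x = u ∨ G.Arrow x u

theorem augmented_adj_of_touches (hxy : x ≠ y) (hx : G.Touches x u) (hy : G.Touches y u) :
    G.augmented.Adj x y := by
  rcases hx with rfl | hx <;> rcases hy with rfl | hy
  · exact absurd rfl hxy
  · exact (augmented_adj_of_adj hy.adj).symm
  · exact augmented_adj_of_adj hx.adj
  · exact augmented_adj_of_arrow_of_arrow hxy hx hy

theorem IsChainGraph.augmented_adj_of_touches_line (hG : G.IsChainGraph) (hxy : x ≠ y)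
    (hx : G.Touches x u) (huw : G.Line u w) (hy : G.Touches y w) : G.augmented.Adj x y := by
  rcases hx with rfl | hx <;> rcases hy with rfl | hy
  · exact augmented_adj_of_adj huw.adj
  · exact (augmented_adj_of_arrow_of_line hy huw.symm).symm
  · exact augmented_adj_of_arrow_of_line hx huw
  · exact hG.augmented_adj_of_arrow_line_arrow hxy hx huw hy

/-- `v` does not lie in `S`, or it has a parent that does not lie in `S`: an active walk given `S`
may visit `v`. -/
def Unblocked (G : MixedGraph V) (S : Set V) (v : V) : Prop := v ∉ S ∨ ∃ p, p ∉ S ∧ G.Arrow p v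

/-- The steps of active walks given `S`: lines between unblocked vertices, and arrows, in either
direction, that leave a vertex outside `S`. Only arrows into the ancestral set `N` may be used. -/
def ActiveStep (G : MixedGraph V) (N S : Set V) (u v : V) : Prop :=
  G.Unblocked S u ∧ G.Unblocked S v ∧
    (G.Line u v ∨ (G.Arrow u v ∧ u ∉ S ∧ v ∈ N) ∨ (G.Arrow v u ∧ v ∉ S ∧ u ∈ N))

/-- There is an active walk from `a` to `b` given `S` in the ancestral set `N`. -/
def ActiveWalk (G : MixedGraph V) (N S : Set V) (a b : V) : Prop :=
  ReflTransGen (G.ActiveStep N S) a b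

theorem ActiveStep.symm (h : G.ActiveStep N S a b) : G.ActiveStep N S b a :=
  ⟨h.2.1, h.1, h.2.2.imp Line.symm Or.symm⟩

instance : Std.Symm (G.ActiveStep N S) := ⟨fun _ _ => ActiveStep.symm⟩

theorem ActiveStep.walk (h : G.ActiveStep N S a b) : G.ActiveWalk N S a b := ReflTransGen.single h

theorem ActiveWalk.symm (h : G.ActiveWalk N S a b) : G.ActiveWalk N S b a :=
  symm_of (ReflTransGen _) h

theorem ActiveWalk.trans (hau : G.ActiveWalk N S a u) (hub : G.ActiveWalk N S u b) :
    G.ActiveWalk N S a b :=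
  ReflTransGen.trans hau hub

theorem activeStep_of_arrow (hab : G.Arrow a b) (ha : a ∉ S) (hb : b ∈ N) :
    G.ActiveStep N S a b :=
  ⟨Or.inl ha, Or.inr ⟨a, ha, hab⟩, Or.inr (Or.inl ⟨hab, ha, hb⟩)⟩

theorem activeWalk_of_adj (h : G.Adj a b) (ha : a ∉ S) (hb : b ∉ S) :
    G.ActiveWalk Set.univ S a b := by
  rcases adj_iff.mp h with h | h | h
  · exact ActiveStep.walk ⟨Or.inl ha, Or.inl hb, Or.inl h⟩
  · exact (activeStep_of_arrow h ha (Set.mem_univ _)).walk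
  · exact (activeStep_of_arrow h hb (Set.mem_univ _)).symm.walk

theorem IsFlag.activeWalk (h : G.IsFlag a u b) (ha : a ∉ S) (hb : b ∉ S) :
    G.ActiveWalk Set.univ S a b :=
  (activeStep_of_arrow h.1 ha (Set.mem_univ _)).walk.trans
    (ActiveStep.walk ⟨Or.inr ⟨a, ha, h.1⟩, Or.inl hb, Or.inl h.2.1⟩)

theorem IsTriplex.activeWalk (h : G.IsTriplex a u b) (ha : a ∉ S) (hb : b ∉ S) :
    G.ActiveWalk Set.univ S a b := by
  rcases h with h | h | h
  · exact h.activeWalk ha hb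
  · exact (h.activeWalk hb ha).symm
  · exact (activeStep_of_arrow h.2.1 ha (Set.mem_univ _)).walk.trans
      (activeStep_of_arrow h.2.2.1 hb (Set.mem_univ _)).symm.walk

theorem IsBiflag.activeWalk (h : G.IsBiflag a b u w) (ha : a ∉ S) (hb : b ∉ S) :
    G.ActiveWalk Set.univ S a b :=
  (activeStep_of_arrow h.1 ha (Set.mem_univ _)).walk.trans <|
    (ActiveStep.walk ⟨Or.inr ⟨a, ha, h.1⟩, Or.inr ⟨b, hb, h.2.2.1⟩, Or.inl h.2.1⟩).trans
      (activeStep_of_arrow h.2.2.1 hb (Set.mem_univ _)).symm.walk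

theorem activeWalk_of_augmented_adj (h : G.augmented.Adj a b) (ha : a ∉ S) (hb : b ∉ S) :
    G.ActiveWalk Set.univ S a b := by
  have oriented {x y} (hx : x ∉ S) (hy : y ∉ S) :
      (G.Adj x y ∨ (∃ c, G.IsTriplex x c y) ∨ ∃ c d, G.IsBiflag x y c d) →
        G.ActiveWalk Set.univ S x y := by
    rintro (h | ⟨c, h⟩ | ⟨c, d, h⟩)
    · exact activeWalk_of_adj h hx hy
    · exact h.activeWalk hx hy
    · exact h.activeWalk hx hy
  exact h.2.elim (oriented ha hb) fun h => (oriented hb ha h).symm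

/-- The steps of walks of `K` that avoid `S`. -/
def AvoidingStep (K : SimpleGraph V) (S : Set V) (x y : V) : Prop := K.Adj x y ∧ x ∉ S ∧ y ∉ S

theorem separates_iff_not_reflTransGen {K : SimpleGraph V} (hAS : Disjoint A S) :
    Separates K A B S ↔ ∀ a ∈ A, ∀ b ∈ B, ¬ ReflTransGen (AvoidingStep K S) a b := by
  refine forall₄_congr fun a ha b hb => ⟨fun h hab => ?_, fun h p => ?_⟩
  · suffices ∃ p : K.Walk a b, ∀ s ∈ S, s ∉ p.support by
      obtain ⟨p, hp⟩ := this
      obtain ⟨s, hs, hsp⟩ := h p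
      exact hp s hs hsp
    clear h hb
    induction hab with
    | refl => exact ⟨.nil, fun s hs h => Set.disjoint_left.mp hAS ha (List.mem_singleton.mp h ▸ hs)⟩
    | tail _ hbc ih =>
      obtain ⟨p, hp⟩ := ih
      refine ⟨p.concat hbc.1, fun s hs h => ?_⟩
      rw [SimpleGraph.Walk.support_concat, List.mem_append] at h
      exact h.elim (hp s hs) fun h => hbc.2.2 (List.mem_singleton.mp h ▸ hs)
  · by_contra! hp
    apply h
    clear h ha hb
    induction p with
    | nil => exact .refl
    | cons hadj p ih =>
      have hp' : ∀ s ∈ S, s ∉ p.support := fun s hs h => hp s hs (List.mem_cons_of_mem _ h)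
      exact .head ⟨hadj, fun hs => hp _ hs List.mem_cons_self,
        fun hs => hp' _ hs p.start_mem_support⟩ (ih hp')

theorem IsChainGraph.reflTransGen_avoidingStep_of_touches (hG : G.IsChainGraph) (ha : a ∉ S)
    (h : G.ActiveWalk N S a u) (hx : x ∉ S) (hxu : G.Touches x u) :
    ReflTransGen (AvoidingStep G.augmented S) a x := by
  induction h generalizing x with
  | refl =>
    rcases eq_or_ne a x with rfl | hax
    · exact .refl
    · exact .single ⟨augmented_adj_of_touches hax (Or.inl rfl) hxu, ha, hx⟩
  | @tail u w _ huw ih =>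
    have extend {y} (hy : y ∉ S) (hyu : G.Touches y u) (hyx : y ≠ x → G.augmented.Adj y x) :
        ReflTransGen (AvoidingStep G.augmented S) a x := by
      rcases eq_or_ne y x with rfl | hne
      · exact ih hy hyu
      · exact (ih hy hyu).tail ⟨hyx hne, hy, hx⟩
    rcases huw with ⟨huo, -, hl | ⟨huw, hu, -⟩ | ⟨hwu, hw, -⟩⟩
    · obtain ⟨y, hy, hyu⟩ : ∃ y, y ∉ S ∧ G.Touches y u :=
        huo.elim (fun hu => ⟨u, hu, Or.inl rfl⟩) fun ⟨p, hp, hpu⟩ => ⟨p, hp, Or.inr hpu⟩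
      exact extend hy hyu fun hne => hG.augmented_adj_of_touches_line hne hyu hl hxu
    · exact extend hu (Or.inl rfl) fun hne => augmented_adj_of_touches hne (Or.inr huw) hxu
    · exact extend hw (Or.inr hwu) fun hne => augmented_adj_of_touches hne (Or.inl rfl) hxu

theorem IsChainGraph.separates_augmented_iff (hG : G.IsChainGraph) (hAS : Disjoint A S)
    (hBS : Disjoint B S) :
    Separates G.augmented A B S ↔ ∀ a ∈ A, ∀ b ∈ B, ¬ G.ActiveWalk Set.univ S a b := by
  rw [separates_iff_not_reflTransGen hAS]
  refine forall₄_congr fun a ha b hb => not_congr ⟨fun h => ?_, fun h => ?_⟩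
  · exact ReflTransGen.lift' id (fun x y h => activeWalk_of_augmented_adj h.1 h.2.1 h.2.2) _ _ h
  · exact hG.reflTransGen_avoidingStep_of_touches (Set.disjoint_left.mp hAS ha) h
      (Set.disjoint_left.mp hBS hb) (Or.inl rfl)

end Augmented

section Extended

variable {G : MixedGraph V} {a b v w x y : V} {A B D S : Set V}

theorem subset_An : D ⊆ G.An D := fun v hv => ⟨v, hv, .refl⟩

theorem subset_Co : D ⊆ G.Co D := fun v hv => ⟨v, hv, .refl⟩

theorem mem_An_of_arrow (h : G.Arrow v w) (hw : w ∈ G.An D) : v ∈ G.An D :=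
  hw.imp fun _ ⟨hd, hwd⟩ => ⟨hd, .head h hwd⟩

theorem mem_Co_of_line (h : G.Line v w) (hw : w ∈ G.Co D) : v ∈ G.Co D :=
  hw.imp fun _ ⟨hd, hwd⟩ => ⟨hd, .head h hwd⟩

theorem extended_arrow : (G.extended D).Arrow x y ↔ G.Arrow x y ∧ y ∈ G.An D := by
  constructor
  · rintro ⟨h | h, h'⟩
    · exact ⟨⟨h.1, fun e => h' (Or.inl ⟨e, h.2.2, h.2.1⟩)⟩, h.2.2⟩
    · exact absurd (Or.inr ⟨h.1.symm, h.2.2, h.2.1⟩) h'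
  · rintro ⟨h, hy⟩
    exact ⟨Or.inl ⟨h.1, mem_An_of_arrow h hy, hy⟩, fun h' => h.2 (h'.elim And.left (·.1.1))⟩

theorem extended_line : (G.extended D).Line x y ↔ G.Line x y ∧ y ∈ G.Co (G.An D) := by
  constructor
  · rintro ⟨h | h, h' | h'⟩
    · exact ⟨⟨h.1, h'.1⟩, subset_Co h.2.2⟩
    · exact ⟨h'.1.symm, h'.2.1⟩
    · exact ⟨h.1, h.2.2⟩
    · exact ⟨h.1, h.2.2⟩
  · rintro ⟨h, hy⟩
    exact ⟨Or.inr ⟨h, mem_Co_of_line h hy, hy⟩, Or.inr ⟨h.symm, hy, mem_Co_of_line h hy⟩⟩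

theorem IsChainGraph.extended (hG : G.IsChainGraph) (D : Set V) : (G.extended D).IsChainGraph :=
  isChainGraph_of_not_reach fun _ _ hab hba =>
    hG.not_reach (extended_arrow.mp hab).1 <|
      ReflTransGen.mono (fun _ _ h => h.elim And.left (·.1.1)) _ _ hba

theorem unblocked_extended_iff (hSD : S ⊆ D) : (G.extended D).Unblocked S v ↔ G.Unblocked S v := by
  by_cases hv : v ∈ S
  · simp only [Unblocked, extended_arrow, subset_An (hSD hv), and_true]
  · exact iff_of_true (Or.inl hv) (Or.inl hv)

theorem activeStep_extended_iff (hSD : S ⊆ D) (hw : w ∈ G.Co (G.An D)) :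
    (G.extended D).ActiveStep Set.univ S v w ↔ G.ActiveStep (G.An D) S v w := by
  simp only [ActiveStep, unblocked_extended_iff hSD, extended_arrow, extended_line, hw,
    Set.mem_univ]
  tauto

theorem ActiveStep.mem_Co (h : G.ActiveStep (G.An D) S v w) (hv : v ∈ G.Co (G.An D)) :
    w ∈ G.Co (G.An D) := by
  rcases h.2.2 with hl | ⟨-, -, hw⟩ | ⟨hwv, -, hv⟩
  · exact mem_Co_of_line hl.symm hv
  · exact subset_Co hw
  · exact subset_Co (mem_An_of_arrow hwv hv)

theorem activeWalk_extended_iff (hSD : S ⊆ D) (ha : a ∈ D) :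
    (G.extended D).ActiveWalk Set.univ S a b ↔ G.ActiveWalk (G.An D) S a b := by
  constructor
  · refine fun h => ReflTransGen.mono (fun x y h => ?_) _ _ h
    have hsub {z z'} (h : (G.extended D).ActiveStep Set.univ S z z') : z' ∈ G.Co (G.An D) := by
      rcases h.2.2 with hl | ⟨hA, -⟩ | ⟨hA, -⟩
      · exact (extended_line.mp hl).2
      · exact subset_Co (extended_arrow.mp hA).2
      · exact subset_Co (mem_An_of_arrow (extended_arrow.mp hA).1 (extended_arrow.mp hA).2)
    exact (activeStep_extended_iff hSD (hsub h)).mp h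
  · intro h
    suffices b ∈ G.Co (G.An D) ∧ (G.extended D).ActiveWalk Set.univ S a b from this.2
    induction h with
    | refl => exact ⟨subset_Co (subset_An ha), .refl⟩
    | tail _ hvw ih =>
      have hw := hvw.mem_Co ih.1
      exact ⟨hw, ih.2.tail ((activeStep_extended_iff hSD hw).mpr hvw)⟩

theorem IsChainGraph.separates_extended_iff (hG : G.IsChainGraph) (hAD : A ⊆ D) (hSD : S ⊆ D)
    (hAS : Disjoint A S) (hBS : Disjoint B S) :
    Separates (G.extended D).augmented A B S ↔
      ∀ a ∈ A, ∀ b ∈ B, ¬ G.ActiveWalk (G.An D) S a b := by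
  rw [(hG.extended D).separates_augmented_iff hAS hBS]
  exact forall₄_congr fun a ha b _ => not_congr (activeWalk_extended_iff hSD (hAD ha))

end Extended

/-! ### Separating sets for nonadjacent vertices -/

section SeparatingSet

variable {G : MixedGraph V} {a b c v : V} {S ξ : Set V}

/-- The chain component of `x`: the vertices that are joined to `x` by a path of lines. -/
def component (G : MixedGraph V) (x : V) : Set V := {y | ReflTransGen G.Line x y}

theorem mem_component_self : a ∈ G.component a := ReflTransGen.refl

theorem reach_of_mem_component (h : b ∈ G.component a) : G.Reach a b := reach_of_reflTransGen_line h

theorem reach_of_mem_component' (h : b ∈ G.component a) : G.Reach b a :=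
  reach_of_reflTransGen_line (symm_of (ReflTransGen _) h)

theorem mem_pa_singleton : v ∈ G.pa {c} ↔ G.Arrow v c :=
  ⟨fun ⟨_, _, hs, h⟩ => hs ▸ h, fun h => ⟨h.ne, c, rfl, h⟩⟩

theorem mem_cl : v ∈ G.cl ξ ↔ v ∈ ξ ∨ ∃ t ∈ ξ, G.Arrow v t := by
  by_cases hv : v ∈ ξ
  · exact iff_of_true (Or.inl hv) (Or.inl hv)
  · exact or_congr Iff.rfl (and_iff_right hv)

/-- `S` avoids `a` and `c` and intersects every active walk from `a` to `c`; by
`IsSeparator.separates` this is separation in the augmented graph. -/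
def IsSeparator (G : MixedGraph V) (a c : V) (S : Set V) : Prop :=
  a ∉ S ∧ c ∉ S ∧ ¬ G.ActiveWalk (G.An ({a} ∪ {c} ∪ S)) S a c

theorem IsSeparator.symm (h : G.IsSeparator a c S) : G.IsSeparator c a S :=
  ⟨h.2.1, h.1, fun hca => h.2.2 (Set.union_comm {c} {a} ▸ hca.symm)⟩

theorem IsSeparator.separates (hG : G.IsChainGraph) (h : G.IsSeparator a c S) :
    Separates (G.extended ({a} ∪ {c} ∪ S)).augmented {a} {c} S := by
  refine (hG.separates_extended_iff (fun _ h => Or.inl (Or.inl h)) (fun _ h => Or.inr h)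
    (Set.disjoint_singleton_left.mpr h.1) (Set.disjoint_singleton_left.mpr h.2.1)).mpr ?_
  rintro _ rfl _ rfl
  exact h.2.2

theorem IsChainGraph.eq_of_mem_An_of_reach (hG : G.IsChainGraph) (hca : ¬ G.Reach c a)
    (hv : v ∈ G.An ({a} ∪ {c} ∪ G.pa {c})) (hcv : G.Reach c v) : v = c := by
  obtain ⟨d, (rfl | rfl) | hd, hvd⟩ := hv
  · exact absurd (hcv.trans (reach_of_reflTransGen_arrow hvd)) hca
  · rcases ReflTransGen.cases_head hvd with h | ⟨w, hvw, hwd⟩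
    · exact h
    · exact absurd ((reach_of_reflTransGen_arrow hwd).trans hcv) (hG.not_reach hvw)
  · exact absurd (hcv.trans (reach_of_reflTransGen_arrow hvd))
      (hG.not_reach (mem_pa_singleton.mp hd))

-- An active walk from `c` given the parents of `c` cannot leave the chain component of `c`.
theorem IsChainGraph.isSeparator_pa (hG : G.IsChainGraph) (hadj : ¬ G.Adj a c)
    (hca : ¬ G.Reach c a) : G.IsSeparator a c (G.pa {c}) := by
  refine ⟨fun h => hadj (mem_pa_singleton.mp h).adj, fun h => h.1 rfl, fun hac => ?_⟩
  suffices ∀ v, G.ActiveWalk (G.An ({a} ∪ {c} ∪ G.pa {c})) (G.pa {c}) c v →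
      v ∈ G.component c from
    hca (reach_of_mem_component (this a hac.symm))
  intro v hv
  induction hv with
  | refl => exact mem_component_self
  | @tail u w _ huw ih =>
    have hcu : G.Reach c u := reach_of_mem_component ih
    rcases huw.2.2 with hl | ⟨huw, -, hw⟩ | ⟨hwu, hw, hu⟩
    · exact ih.tail hl
    · rw [hG.eq_of_mem_An_of_reach hca hw (hcu.trans huw.reach)]
      exact mem_component_self
    · rw [hG.eq_of_mem_An_of_reach hca hu hcu] at hwu
      exact absurd (mem_pa_singleton.mpr hwu) hw

theorem arrow_of_not_isTriplex (hac : a ≠ c) (hadj : ¬ G.Adj a c) (hca : ¬ G.Reach c a)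
    (hab : G.Adj a b) (hbc : G.Adj b c) (ht : ¬ G.IsTriplex a b c) : G.Arrow b c := by
  rcases adj_iff.mp hbc with h | h | h
  · exact absurd (Or.inl ⟨arrow_of_adj hab fun hba => hca (h.symm.reach.trans hba), h, hadj⟩) ht
  · exact h
  · exact absurd (isTriplex_of_arrow hac.symm h (fun h => hadj h.symm) hab.symm
      fun h' => hca (h.reach.trans h'.reach)).symm ht

theorem reach_of_mem_An_cl_component (hc : c ∈ G.component a)
    (hv : v ∈ G.An ({a} ∪ {c} ∪ G.cl (G.component a) \ {a, c})) : G.Reach v a := by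
  obtain ⟨d, hd, hvd⟩ := hv
  refine (reach_of_reflTransGen_arrow hvd).trans ?_
  rcases hd with (rfl | rfl) | ⟨hd, -⟩
  · exact Reach.refl _
  · exact reach_of_mem_component' hc
  · rcases mem_cl.mp hd with hd | ⟨t, ht, hdt⟩
    · exact reach_of_mem_component' hd
    · exact hdt.reach.trans (reach_of_mem_component' ht)

-- Already the first step of an active walk from `a` is blocked.
theorem IsChainGraph.isSeparator_cl_component (hG : G.IsChainGraph) (hac : a ≠ c)
    (hadj : ¬ G.Adj a c) (hc : c ∈ G.component a) :
    G.IsSeparator a c (G.cl (G.component a) \ {a, c}) := by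
  set S := G.cl (G.component a) \ {a, c} with hS
  have mem_S_of_arrow {p t} (ht : t ∈ G.component a) (hpt : G.Arrow p t) : p ∈ S := by
    refine ⟨mem_cl.mpr (Or.inr ⟨t, ht, hpt⟩), ?_⟩
    rintro (rfl | rfl)
    · exact hG.not_reach hpt (reach_of_mem_component' ht)
    · exact hG.not_reach hpt ((reach_of_mem_component' ht).trans (reach_of_mem_component hc))
  refine ⟨fun h => h.2 (Or.inl rfl), fun h => h.2 (Or.inr rfl), fun hwalk => ?_⟩
  rcases ReflTransGen.cases_head hwalk with h | ⟨w, ⟨-, hw, hl | ⟨haw, -, hwN⟩ | ⟨hwa, hwS, -⟩⟩, -⟩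
  · exact hac h
  · have hwa : w ∈ G.component a := .single hl
    rcases hw with hw | ⟨p, hp, hpw⟩
    · refine hw ⟨mem_cl.mpr (Or.inl hwa), ?_⟩
      rintro (rfl | rfl)
      · exact hl.ne rfl
      · exact hadj hl.adj
    · exact hp (mem_S_of_arrow hwa hpw)
  · exact hG.not_reach haw (reach_of_mem_An_cl_component hc hwN)
  · exact hwS (mem_S_of_arrow mem_component_self hwa)

theorem IsChainGraph.mem_cl_component_of_not_isTriplex (hG : G.IsChainGraph) (hac : a ≠ c)
    (hadj : ¬ G.Adj a c) (hc : c ∈ G.component a) (hab : G.Adj a b) (hbc : G.Adj b c)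
    (ht : ¬ G.IsTriplex a b c) : b ∈ G.cl (G.component a) := by
  rcases adj_iff.mp hab with h | h | h
  · exact mem_cl.mpr (Or.inl (.single h))
  · exact absurd (isTriplex_of_arrow hac h hadj hbc fun h' =>
      hG.not_reach h (h'.reach.trans (reach_of_mem_component' hc))) ht
  · exact mem_cl.mpr (Or.inr ⟨a, mem_component_self, h⟩)

theorem IsChainGraph.exists_isSeparator (hG : G.IsChainGraph) (hac : a ≠ c) (hadj : ¬ G.Adj a c) :
    ∃ S, G.IsSeparator a c S ∧ ∀ b, G.Adj a b → G.Adj b c → ¬ G.IsTriplex a b c → b ∈ S := by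
  by_cases hca : G.Reach c a
  · by_cases hca' : G.Reach a c
    · have hc : c ∈ G.component a := hG.reflTransGen_line hca' hca
      refine ⟨_, hG.isSeparator_cl_component hac hadj hc, fun b hab hbc ht => ?_⟩
      refine ⟨hG.mem_cl_component_of_not_isTriplex hac hadj hc hab hbc ht, ?_⟩
      rintro (rfl | rfl)
      · exact hab.ne rfl
      · exact hbc.ne rfl
    · have hadj' : ¬ G.Adj c a := fun h => hadj h.symm
      exact ⟨_, (hG.isSeparator_pa hadj' hca').symm, fun b hab hbc ht => mem_pa_singleton.mpr <|
        arrow_of_not_isTriplex hac.symm hadj' hca' hbc.symm hab.symm fun h => ht h.symm⟩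
  · exact ⟨_, hG.isSeparator_pa hadj hca, fun b hab hbc ht => mem_pa_singleton.mpr <|
      arrow_of_not_isTriplex hac hadj hca hab hbc ht⟩

end SeparatingSet

/-! ### Markov equivalent chain graphs have the same skeleton and the same triplexes -/

section Coins

/-- The distribution of two independent fair coins. -/
noncomputable def coins : Measure (Bool × Bool) := (PMF.uniformOfFintype (Bool × Bool)).toMeasure

instance : IsProbabilityMeasure coins := by unfold coins; infer_instance

theorem coins_apply (s : Finset (Bool × Bool)) : coins s = (s.card : ENNReal) / 4 := by
  rw [coins, PMF.toMeasure_uniformOfFintype_apply _ (Set.toFinite _).measurableSet]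
  simp

theorem indepFun_coins {φ ψ : Bool × Bool → Bool}
    (h : ∀ s t : Finset Bool, 4 * (Finset.univ.filter fun p => φ p ∈ s ∧ ψ p ∈ t).card =
      (Finset.univ.filter fun p => φ p ∈ s).card * (Finset.univ.filter fun p => ψ p ∈ t).card) :
    IndepFun φ ψ coins := by
  classical
  rw [indepFun_iff_measure_inter_preimage_eq_mul]
  intro s t _ _
  have hφψ : φ ⁻¹' s ∩ ψ ⁻¹' t =
      ↑(Finset.univ.filter fun p => φ p ∈ s.toFinset ∧ ψ p ∈ t.toFinset) := by ext; simp
  have hφ : φ ⁻¹' s = ↑(Finset.univ.filter fun p => φ p ∈ s.toFinset) := by ext; simp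
  have hψ : ψ ⁻¹' t = ↑(Finset.univ.filter fun p => ψ p ∈ t.toFinset) := by ext; simp
  have hcard := congrArg (Nat.cast (R := ENNReal)) (h s.toFinset t.toFinset)
  push_cast at hcard
  rw [hφψ, hφ, hψ, coins_apply, coins_apply, coins_apply, ENNReal.div_eq_inv_mul,
    ENNReal.div_eq_inv_mul, ENNReal.div_eq_inv_mul, mul_mul_mul_comm, ← hcard, ← mul_assoc,
    mul_assoc (4⁻¹ : ENNReal), ENNReal.inv_mul_cancel (by norm_num) (by norm_num), mul_one]

theorem indepFun_fst_snd : IndepFun Prod.fst Prod.snd coins := indepFun_coins (by decide)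

theorem indepFun_fst_xor : IndepFun Prod.fst (fun p => xor p.1 p.2) coins :=
  indepFun_coins (by decide)

theorem indepFun_snd_xor : IndepFun Prod.snd (fun p => xor p.1 p.2) coins :=
  indepFun_coins (by decide)

/-- The joint distribution of a family `X` of binary random variables that are functions of two
fair coins. -/
noncomputable def coinModel (X : V → Bool × Bool → Bool) : ProbabilityMeasure (V → Bool) :=
  ⟨coins.map fun p v => X v p,
    Measure.isProbabilityMeasure_map (measurable_of_finite _).aemeasurable⟩

/-- On the set `C` of vertices, the variables in the family `X` are functions of `φ`. -/
def FactorsOn {β : Type*} (X : V → Bool × Bool → Bool) (C : Set V) (φ : Bool × Bool → β) : Prop :=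
  ∀ v ∈ C, (X v).FactorsThrough φ

variable {X : V → Bool × Bool → Bool} {A B C S : Set V}

theorem FactorsOn.exists_comp {β : Type*} {φ : Bool × Bool → β} (h : FactorsOn X C φ) :
    ∃ e, C.domRestrict ∘ (fun p v => X v p) = e ∘ φ :=
  (Function.factorsThrough_iff _).mp fun _ _ hpq => funext fun v => h v v.2 hpq

theorem indep_coordSigma {β γ : Type*} [MeasurableSpace β] [DiscreteMeasurableSpace β]
    [MeasurableSpace γ] [DiscreteMeasurableSpace γ] {φ : Bool × Bool → β} {ψ : Bool × Bool → γ}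
    (h : IndepFun φ ψ coins) (hA : FactorsOn X A φ) (hB : FactorsOn X B ψ) :
    Indep (coordSigma (fun _ : V => Bool) A) (coordSigma (fun _ : V => Bool) B)
      (coinModel X : Measure (V → Bool)) := by
  obtain ⟨e, he⟩ := hA.exists_comp
  obtain ⟨e', he'⟩ := hB.exists_comp
  refine (IndepFun_iff_Indep _ _ _).mp <| (indepFun_map_iff (measurable_of_finite _)
    (by fun_prop) (by fun_prop)).mpr ?_
  rw [he, he']
  exact h.comp .of_discrete .of_discrete

theorem indep_coordSigma_self (hC : FactorsOn X C fun _ => ()) :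
    Indep (coordSigma (fun _ : V => Bool) C) (coordSigma (fun _ : V => Bool) C)
      (coinModel X : Measure (V → Bool)) :=
  indep_coordSigma (indepFun_const_right _ ()) hC hC

theorem measurableSet_coord {v : V} (hv : v ∈ C) (e : Bool) :
    MeasurableSet[coordSigma (fun _ : V => Bool) C] {x | x v = e} :=
  ⟨(fun y : ∀ _ : C, Bool => y ⟨v, hv⟩) ⁻¹' {e},
    (measurable_pi_apply (⟨v, hv⟩ : C)) (measurableSet_singleton e), rfl⟩

theorem coinModel_real {t : Set (V → Bool)} (ht : MeasurableSet t) (s : Finset (Bool × Bool))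
    (hs : ∀ p, (fun v => X v p) ∈ t ↔ p ∈ s) :
    (coinModel X : Measure (V → Bool)).real t = (s.card : ℝ) / 4 := by
  have hpre : (fun p v => X v p) ⁻¹' t = s := Set.ext hs
  change (coins.map (fun p v => X v p) t).toReal = _
  rw [Measure.map_apply (measurable_of_finite _) ht, hpre, coins_apply]
  simp

variable [Finite V]

theorem condIndep_coinModel_of_const_right (hB : FactorsOn X B fun _ => ()) :
    CondIndep (coordSigma (fun _ : V => Bool) S) (coordSigma _ A) (coordSigma _ B)
      (coordSigma_le _ S) (coinModel X : Measure (V → Bool)) :=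
  condIndep_of_indep_self_right (coordSigma_le _ S) (coordSigma_le _ A) (coordSigma_le _ B)
    (indep_coordSigma_self hB)

theorem condIndep_coinModel_of_const_left (hA : FactorsOn X A fun _ => ()) :
    CondIndep (coordSigma (fun _ : V => Bool) S) (coordSigma _ A) (coordSigma _ B)
      (coordSigma_le _ S) (coinModel X : Measure (V → Bool)) :=
  (condIndep_coinModel_of_const_right hA).symm

theorem not_condIndep_coinModel_of_const (hS : FactorsOn X S fun _ => ()) {a b : V}
    (ha : X a = Prod.fst) (hb : X b = Prod.fst) :
    ¬ CondIndep (coordSigma (fun _ : V => Bool) S) (coordSigma _ {a}) (coordSigma _ {b})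
      (coordSigma_le _ S) (coinModel X : Measure (V → Bool)) := by
  intro h
  have hA := measurableSet_coord (Set.mem_singleton a) true
  have hB := measurableSet_coord (Set.mem_singleton b) true
  have indep_S {C : Set V} := indep_of_indep_self (m₁ := coordSigma (fun _ : V => Bool) C)
    (coordSigma_le _ S) (indep_coordSigma_self hS)
  have key := measureReal_inter_of_condIndep (coordSigma_le _ S) (coordSigma_le _ _)
    (coordSigma_le _ _) h indep_S indep_S hA hB MeasurableSet.univ
  have hA' := coordSigma_le _ _ _ hA
  have hB' := coordSigma_le _ _ _ hB
  rw [Set.inter_univ, coinModel_real (hA'.inter hB') {(true, true), (true, false)},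
    coinModel_real hA' {(true, true), (true, false)},
    coinModel_real hB' {(true, true), (true, false)}, probReal_univ] at key
  · norm_num at key
  all_goals
    simp only [Set.mem_inter_iff, Set.mem_ofPred_eq, ha, hb]
    decide

theorem not_condIndep_coinModel_of_xor (hS : FactorsOn X S fun p => xor p.1 p.2) {a b c : V}
    (ha : X a = Prod.fst) (hc : X c = Prod.snd) (hb : X b = fun p => xor p.1 p.2) (hbS : b ∈ S) :
    ¬ CondIndep (coordSigma (fun _ : V => Bool) S) (coordSigma _ {a}) (coordSigma _ {c})
      (coordSigma_le _ S) (coinModel X : Measure (V → Bool)) := by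
  intro h
  have hA := measurableSet_coord (Set.mem_singleton a) true
  have hC := measurableSet_coord (Set.mem_singleton c) true
  have hE := measurableSet_coord hbS false
  have factorsOn_singleton {v : V} {φ} (hv : X v = φ) : FactorsOn X {v} φ := by
    rintro _ rfl p q hpq
    rw [hv, hpq]
  have key := measureReal_inter_of_condIndep (coordSigma_le _ S) (coordSigma_le _ _)
    (coordSigma_le _ _) h (indep_coordSigma indepFun_fst_xor (factorsOn_singleton ha) hS)
    (indep_coordSigma indepFun_snd_xor (factorsOn_singleton hc) hS) hA hC hE
  have hA' := coordSigma_le _ _ _ hA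
  have hC' := coordSigma_le _ _ _ hC
  have hE' := coordSigma_le _ _ _ hE
  rw [coinModel_real ((hA'.inter hC').inter hE') {(true, true)},
    coinModel_real hA' {(true, true), (true, false)},
    coinModel_real hC' {(true, true), (false, true)},
    coinModel_real hE' {(true, true), (false, false)}] at key
  · norm_num at key
  all_goals
    simp only [Set.mem_inter_iff, Set.mem_ofPred_eq, ha, hb, hc]
    decide

end Coins

section Characterization

variable {G H : MixedGraph V} {a b c x y : V} {A B C D S : Set V}

theorem Separates.not_adj {K : SimpleGraph V} (h : Separates K A B S) (hAS : Disjoint A S)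
    (hBS : Disjoint B S) (hx : x ∈ A) (hy : y ∈ B) : ¬ K.Adj x y := by
  intro hadj
  obtain ⟨s, hs, hs'⟩ := h x hx y hy (.cons hadj .nil)
  simp only [SimpleGraph.Walk.support_cons, SimpleGraph.Walk.support_nil, List.mem_cons,
    List.not_mem_nil, or_false] at hs'
  rcases hs' with rfl | rfl
  · exact Set.disjoint_left.mp hAS hx hs
  · exact Set.disjoint_left.mp hBS hy hs

theorem extended_adj (hx : x ∈ D) (hy : y ∈ D) : (G.extended D).Adj x y ↔ G.Adj x y := by
  refine or_congr ?_ ?_ <;>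
    exact ⟨fun h => h.elim And.left (·.1.1), fun h => Or.inl ⟨h, subset_An ‹_›, subset_An ‹_›⟩⟩

theorem IsTriplex.extended (h : G.IsTriplex a b c) (ha : a ∈ D) (hb : b ∈ D) (hc : c ∈ D) :
    (G.extended D).IsTriplex a b c := by
  simpa only [IsTriplex, IsFlag, IsImmorality, extended_arrow, extended_line, extended_adj ha hc,
    extended_adj hc ha, subset_An hb, subset_Co (subset_An ha), subset_Co (subset_An hc),
    and_true] using h

theorem not_adj_of_separates (h : Separates (G.extended (A ∪ B ∪ S)).augmented A B S)
    (hAS : Disjoint A S) (hBS : Disjoint B S) (hx : x ∈ A) (hy : y ∈ B) : ¬ G.Adj x y := by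
  have hxD : x ∈ A ∪ B ∪ S := Or.inl (Or.inl hx)
  have hyD : y ∈ A ∪ B ∪ S := Or.inl (Or.inr hy)
  exact fun hadj =>
    h.not_adj hAS hBS hx hy (augmented_adj_of_adj ((extended_adj hxD hyD).mpr hadj))

open Classical in
/-- The binary variables at `a` and `b` are one fair coin, and the other variables are constant. -/
noncomputable def sharedCoin (a b v : V) : Bool × Bool → Bool :=
  if v = a ∨ v = b then Prod.fst else fun _ => false

theorem factorsOn_sharedCoin (ha : a ∉ C) (hb : b ∉ C) :
    FactorsOn (sharedCoin a b) C fun _ => () := by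
  rintro v hv p q -
  rw [sharedCoin, if_neg (by rintro (rfl | rfl) <;> contradiction)]

theorem coinModel_sharedCoin_mem_ampModel [Finite V] (hab : G.Adj a b) :
    coinModel (sharedCoin a b) ∈ G.ampModel fun _ => Bool := by
  intro A B S hAB hAS hBS hsep
  have hadj {x y} (hx : x ∈ A) (hy : y ∈ B) : ¬ G.Adj x y := not_adj_of_separates hsep hAS hBS hx hy
  have hdisj {x} (hx : x ∈ A) : x ∉ B := Set.disjoint_left.mp hAB hx
  by_cases ha : a ∈ A
  · exact condIndep_coinModel_of_const_right (factorsOn_sharedCoin (hdisj ha) (hadj ha · hab))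
  by_cases hb : b ∈ A
  · exact condIndep_coinModel_of_const_right (factorsOn_sharedCoin (hadj hb · hab.symm) (hdisj hb))
  · exact condIndep_coinModel_of_const_left (factorsOn_sharedCoin ha hb)

theorem MarkovEquiv.symm [Finite V] (h : MarkovEquiv G H) : MarkovEquiv H G :=
  fun X _ _ => (h X).symm

theorem IsSeparator.condIndep [Finite V] (hG : G.IsChainGraph) (hac : a ≠ c)
    (h : G.IsSeparator a c S) {P : ProbabilityMeasure (V → Bool)}
    (hP : P ∈ G.ampModel fun _ => Bool) :
    CondIndep (coordSigma (fun _ : V => Bool) S) (coordSigma _ {a}) (coordSigma _ {c})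
      (coordSigma_le _ S) (P : Measure (V → Bool)) :=
  hP {a} {c} S (Set.disjoint_singleton.mpr hac) (Set.disjoint_singleton_left.mpr h.1)
    (Set.disjoint_singleton_left.mpr h.2.1) (h.separates hG)

theorem MarkovEquiv.adj [Finite V] (hH : H.IsChainGraph) (h : MarkovEquiv G H) (hab : G.Adj a b) :
    H.Adj a b := by
  by_contra hab'
  obtain ⟨S, hS, -⟩ := hH.exists_isSeparator hab.ne hab'
  have hmem := coinModel_sharedCoin_mem_ampModel hab
  rw [h fun _ => Bool] at hmem
  exact not_condIndep_coinModel_of_const (factorsOn_sharedCoin hS.1 hS.2.1) (if_pos (Or.inl rfl))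
    (if_pos (Or.inr rfl)) (hS.condIndep hH hab.ne hmem)

open Classical in
/-- The binary variables at `a` and `c` are two independent fair coins, the variable at `b` is their
sum modulo two, and the other variables are constant. -/
noncomputable def xorCoins (a b c v : V) : Bool × Bool → Bool :=
  if v = a then Prod.fst else if v = c then Prod.snd else if v = b then fun p => xor p.1 p.2
  else fun _ => false

theorem factorsOn_xorCoins_const (ha : a ∉ C) (hb : b ∉ C) (hc : c ∉ C) :
    FactorsOn (xorCoins a b c) C fun _ => () := by
  rintro v hv p q -
  rw [xorCoins, if_neg (by grind), if_neg (by grind), if_neg (by grind)]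

theorem factorsOn_xorCoins_fst (hb : b ∉ C) (hc : c ∉ C) :
    FactorsOn (xorCoins a b c) C Prod.fst := by
  intro v hv p q hpq
  by_cases hva : v = a
  · rwa [xorCoins, if_pos hva]
  · rw [xorCoins, if_neg hva, if_neg (by grind), if_neg (by grind)]

theorem factorsOn_xorCoins_snd (ha : a ∉ C) (hb : b ∉ C) :
    FactorsOn (xorCoins a b c) C Prod.snd := by
  intro v hv p q hpq
  by_cases hvc : v = c
  · rwa [xorCoins, if_neg (by grind), if_pos hvc]
  · rw [xorCoins, if_neg (by grind), if_neg hvc, if_neg (by grind)]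

theorem factorsOn_xorCoins_xor (ha : a ∉ C) (hc : c ∉ C) :
    FactorsOn (xorCoins a b c) C fun p => xor p.1 p.2 := by
  intro v hv p q hpq
  by_cases hvb : v = b
  · rwa [xorCoins, if_neg (by grind), if_neg (by grind), if_pos hvb]
  · rw [xorCoins, if_neg (by grind), if_neg (by grind), if_neg hvb]

theorem coinModel_xorCoins_mem_ampModel [Finite V] (ht : G.IsTriplex a b c) :
    coinModel (xorCoins a b c) ∈ G.ampModel fun _ => Bool := by
  intro A B S hAB hAS hBS hsep
  have hadj {x y} (hx : x ∈ A) (hy : y ∈ B) : ¬ G.Adj x y := not_adj_of_separates hsep hAS hBS hx hy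
  have htriplex {x y} (hx : x ∈ A) (hy : y ∈ B) (h : G.IsTriplex x b y) : b ∉ S := fun hb =>
    hsep.not_adj hAS hBS hx hy
      (h.extended (Or.inl (Or.inl hx)) (Or.inr hb) (Or.inl (Or.inr hy))).augmented_adj
  have hdisj {x} (hx : x ∈ A) : x ∉ B := Set.disjoint_left.mp hAB hx
  have hdisjA {x} (hx : x ∈ A) : x ∉ S := Set.disjoint_left.mp hAS hx
  have hdisjB {x} (hx : x ∈ B) : x ∉ S := Set.disjoint_left.mp hBS hx
  by_cases hbA : b ∈ A
  · exact condIndep_coinModel_of_const_right <| factorsOn_xorCoins_const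
      (hadj hbA · ht.adj_left.symm) (hdisj hbA) (hadj hbA · ht.adj_right)
  by_cases hbB : b ∈ B
  · exact condIndep_coinModel_of_const_left <| factorsOn_xorCoins_const
      (hadj · hbB ht.adj_left) hbA (hadj · hbB ht.adj_right.symm)
  have condIndep_of_S (hS : FactorsOn (xorCoins a b c) S fun _ => ()) := condIndep_of_indep_self
    (coordSigma_le _ S) (coordSigma_le _ A) (coordSigma_le _ B) (indep_coordSigma_self hS)
  by_cases haA : a ∈ A
  · by_cases hcB : c ∈ B
    · refine condIndep_of_S (factorsOn_xorCoins_const (hdisjA haA) (htriplex haA hcB ht)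
        (hdisjB hcB)) (indep_coordSigma indepFun_fst_snd ?_ ?_)
      · exact factorsOn_xorCoins_fst hbA (hdisj · hcB)
      · exact factorsOn_xorCoins_snd (hdisj haA) hbB
    · exact condIndep_coinModel_of_const_right (factorsOn_xorCoins_const (hdisj haA) hbB hcB)
  by_cases hcA : c ∈ A
  · by_cases haB : a ∈ B
    · refine condIndep_of_S (factorsOn_xorCoins_const (hdisjB haB) (htriplex hcA haB ht.symm)
        (hdisjA hcA)) (indep_coordSigma indepFun_fst_snd.symm ?_ ?_)
      · exact factorsOn_xorCoins_snd haA hbA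
      · exact factorsOn_xorCoins_fst hbB (hdisj hcA)
    · exact condIndep_coinModel_of_const_right (factorsOn_xorCoins_const haB hbB (hdisj hcA))
  exact condIndep_coinModel_of_const_left (factorsOn_xorCoins_const haA hbA hcA)

theorem MarkovEquiv.isTriplex [Finite V] (hG : G.IsChainGraph) (hH : H.IsChainGraph)
    (h : MarkovEquiv G H) (ht : G.IsTriplex a b c) : H.IsTriplex a b c := by
  by_contra ht'
  have hac : a ≠ c := ht.ne
  have hab : a ≠ b := ht.adj_left.ne
  have hbc : b ≠ c := ht.adj_right.ne
  obtain ⟨S, hS, hbS⟩ := hH.exists_isSeparator hac fun hac => ht.not_adj (h.symm.adj hG hac)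
  have hmem := coinModel_xorCoins_mem_ampModel ht
  rw [h fun _ => Bool] at hmem
  exact not_condIndep_coinModel_of_xor (factorsOn_xorCoins_xor hS.1 hS.2.1) (b := b)
    (by simp [xorCoins]) (by simp [xorCoins, hac.symm]) (by simp [xorCoins, hab.symm, hbc])
    (hbS b (h.adj hH ht.adj_left) (h.adj hH ht.adj_right) ht') (hS.condIndep hH hac hmem)

end Characterization

/-! ### Splitting a chain component -/

section Split

variable {G H : MixedGraph V} {κ D S : Set V} {a b k x y u v : V}

/-- The graph obtained by directing every line between `κ` and its complement into `κ`. -/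
def split (G : MixedGraph V) (κ : Set V) : MixedGraph V where
  Edge x y := G.Edge x y ∧ ¬ (x ∈ κ ∧ y ∉ κ ∧ G.Edge y x)
  irrefl a h := G.irrefl a h.1

/-- The conditions under which directing the lines between `κ` and its complement into `κ` creates
and destroys no triplex. -/
structure IsSplittable (G : MixedGraph V) (κ : Set V) : Prop where
  connected : ∀ x ∈ κ, ∀ y ∈ κ, ReflTransGen (fun u v => G.Line u v ∧ v ∈ κ) x y
  covers : ∀ a k k', a ∉ κ → k ∈ κ → k' ∈ κ → G.Line a k → G.Line a k'
  complete : ∀ a b k, a ∉ κ → b ∉ κ → k ∈ κ → G.Line a k → G.Line b k → a ≠ b → G.Line a b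
  parents : ∀ p a k, a ∉ κ → k ∈ κ → G.Line a k → G.Arrow p a → G.Arrow p k

theorem split_line : (G.split κ).Line x y ↔ G.Line x y ∧ (x ∈ κ ↔ y ∈ κ) := by
  simp only [Line, split]; tauto

theorem split_arrow :
    (G.split κ).Arrow x y ↔ G.Arrow x y ∨ (G.Line x y ∧ x ∉ κ ∧ y ∈ κ) := by
  simp only [Line, Arrow, split]; tauto

theorem Arrow.split (h : G.Arrow x y) : (G.split κ).Arrow x y := split_arrow.mpr (Or.inl h)

theorem IsChainGraph.split (hG : G.IsChainGraph) (κ : Set V) : (G.split κ).IsChainGraph := by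
  have reach_of_split {u v} (h : (G.split κ).Reach u v) : G.Reach u v :=
    ReflTransGen.mono (fun _ _ h => h.1) _ _ h
  refine isChainGraph_of_not_reach fun x y hxy hyx => ?_
  rcases split_arrow.mp hxy with h | ⟨h, hx, hy⟩
  · exact hG.not_reach h (reach_of_split hyx)
  · -- A walk of the split graph that stays in the component of `x` cannot leave `κ`.
    suffices stays : ∀ u, (G.split κ).Reach y u → G.Reach u x → u ∈ κ from
      hx (stays x hyx (Reach.refl x))
    intro u hu
    induction hu with
    | refl => exact fun _ => hy
    | @tail u w hyu huw ih =>
      intro hwx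
      have hGuw : G.Reach u w := .single huw.1
      have hGwu : G.Reach w u := hwx.trans (h.reach.trans (reach_of_split hyu))
      have hline := hG.line_of_adj (Or.inl huw.1) hGuw hGwu
      by_contra hw
      exact huw.2 ⟨ih (hGuw.trans hwx), hw, hline.2⟩

theorem An_subset_An_split : G.An D ⊆ (G.split κ).An D := by
  rintro v ⟨d, hd, h⟩
  exact ⟨d, hd, ReflTransGen.mono (fun _ _ h => h.split) _ _ h⟩

theorem IsSplittable.mem_An_split (hs : G.IsSplittable κ) (hv : v ∈ (G.split κ).An D) :
    v ∈ G.An D ∨ (v ∉ κ ∧ ∃ k ∈ κ, k ∈ G.An D ∧ G.Line v k) := by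
  obtain ⟨d, hd, h⟩ := hv
  induction h using ReflTransGen.head_induction_on with
  | refl => exact Or.inl (subset_An hd)
  | @head v w hvw _ ih =>
    rcases ih with hwD | ⟨hw, k, hk, hkD, hwk⟩
    · rcases split_arrow.mp hvw with h | ⟨h, hv, hw⟩
      · exact Or.inl (mem_An_of_arrow h hwD)
      · exact Or.inr ⟨hv, w, hw, hwD, h⟩
    · rcases split_arrow.mp hvw with h | ⟨-, -, h⟩
      · exact Or.inl (mem_An_of_arrow (hs.parents v w k hw hk hwk h) hkD)
      · exact absurd h hw

theorem Unblocked.split (h : G.Unblocked S v) : (G.split κ).Unblocked S v :=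
  h.imp id fun ⟨p, hp, h⟩ => ⟨p, hp, h.split⟩

theorem Unblocked.of_split (h : (G.split κ).Unblocked S v) (hv : v ∉ κ) : G.Unblocked S v :=
  h.imp id fun ⟨p, hp, h⟩ => ⟨p, hp, (split_arrow.mp h).resolve_right fun h => hv h.2.2⟩

theorem ActiveStep.split (h : G.ActiveStep (G.An D) S u v) (hκ : G.Line u v → (u ∈ κ ↔ v ∈ κ)) :
    (G.split κ).ActiveStep ((G.split κ).An D) S u v :=
  ⟨h.1.split, h.2.1.split, h.2.2.imp (fun hl => split_line.mpr ⟨hl, hκ hl⟩)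
    (Or.imp (fun h => ⟨h.1.split, h.2.1, An_subset_An_split h.2.2⟩)
      (fun h => ⟨h.1.split, h.2.1, An_subset_An_split h.2.2⟩))⟩

theorem ActiveWalk.split (h : G.ActiveWalk (G.An D) S a b)
    (hcross : ∀ u v, G.Unblocked S u → u ∉ κ → v ∈ κ → G.Line u v →
      (G.split κ).ActiveWalk ((G.split κ).An D) S u v) :
    (G.split κ).ActiveWalk ((G.split κ).An D) S a b := by
  refine ReflTransGen.lift' id (fun u v huv => ?_) _ _ h
  by_cases hκ : G.Line u v → (u ∈ κ ↔ v ∈ κ)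
  · exact (huv.split hκ).walk
  · obtain ⟨hl, hne⟩ := Classical.not_imp.mp hκ
    by_cases hu : u ∈ κ
    · exact (hcross v u huv.2.1 (fun hv => hne (iff_of_true hu hv)) hu hl.symm).symm
    · exact hcross u v huv.1 hu (by_contra fun hv => hne (iff_of_false hu hv)) hl

theorem IsSplittable.activeWalk_split_of_arrow (hs : G.IsSplittable κ) (hx : x ∉ S)
    (hxκ : ∀ k ∈ κ, (G.split κ).Arrow x k) (hk : k ∈ κ) (hkD : k ∈ G.An D) (hv : v ∈ κ) :
    (G.split κ).ActiveWalk ((G.split κ).An D) S x v := by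
  have unblocked {w} (hw : w ∈ κ) : (G.split κ).Unblocked S w := Or.inr ⟨x, hx, hxκ w hw⟩
  suffices within : ∀ w, ReflTransGen (fun u v => G.Line u v ∧ v ∈ κ) k w →
      w ∈ κ ∧ (G.split κ).ActiveWalk ((G.split κ).An D) S k w from
    .head (activeStep_of_arrow (hxκ k hk) hx (An_subset_An_split hkD))
      (within v (hs.connected k hk v hv)).2
  intro w hw
  induction hw with
  | refl => exact ⟨hk, .refl⟩
  | tail _ huw ih =>
    exact ⟨huw.2, ih.2.tail ⟨unblocked ih.1, unblocked huw.2,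
      Or.inl (split_line.mpr ⟨huw.1, iff_of_true ih.1 huw.2⟩)⟩⟩

theorem IsSplittable.activeWalk_split_of_line (hs : G.IsSplittable κ) (hSD : S ⊆ D) (hk : k ∈ κ)
    (hkD : k ∈ G.An D) (hub : G.Unblocked S u) (hu : u ∉ κ) (hv : v ∈ κ) (huv : G.Line u v) :
    (G.split κ).ActiveWalk ((G.split κ).An D) S u v := by
  have hcover : ∀ w ∈ κ, G.Line u w := fun w hw => hs.covers u v w hu hv hw huv
  by_cases huS : u ∈ S
  · -- An active walk visits `u` through a parent of `u`, which is then a parent of all of `κ`.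
    obtain ⟨p, hp, hpu⟩ := hub.resolve_left (not_not_intro huS)
    refine .head (activeStep_of_arrow hpu.split hp (subset_An (hSD huS))).symm ?_
    exact hs.activeWalk_split_of_arrow hp
      (fun w hw => (hs.parents p u w hu hw (hcover w hw) hpu).split) hk hkD hv
  · exact hs.activeWalk_split_of_arrow huS
      (fun w hw => split_arrow.mpr (Or.inr ⟨hcover w hw, hu, hw⟩)) hk hkD hv

theorem IsSplittable.activeWalk_split_of_disjoint (hs : G.IsSplittable κ)
    (hκ : Disjoint κ (G.An D)) (ha : a ∈ D) (hb : b ∈ D) (hxb : G.Unblocked S x) (hx : x ∉ κ)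
    (hk : k ∈ κ) (hxk : G.Line x k) (h : G.ActiveWalk (G.An D) S a b) :
    (G.split κ).ActiveWalk ((G.split κ).An D) S a b := by
  have outside {v} (hv : v ∈ G.An D) : v ∉ κ := Set.disjoint_right.mp hκ hv
  refine reflTransGen_of_collapse (c := x) h (fun u v huv hu hv => ?_) (fun u v huv hu hv => ?_)
    (fun haκ => absurd haκ (outside (subset_An ha)))
    (fun hbκ => absurd hbκ (outside (subset_An hb)))
  · exact (huv.split fun _ => iff_of_false hu hv).walk
  · obtain ⟨hub, -, hl | ⟨-, -, hvD⟩ | ⟨hvu, -, huD⟩⟩ := huv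
    · rcases eq_or_ne u x with rfl | hux
      · exact .refl
      · have hlx := hs.complete u x v hu hx hv hl (hs.covers x k v hx hk hv hxk) hux
        exact ActiveStep.walk
          ⟨hub.split, hxb.split, Or.inl (split_line.mpr ⟨hlx, iff_of_false hu hx⟩)⟩
    · exact absurd hv (outside hvD)
    · exact absurd hv (outside (mem_An_of_arrow hvu huD))

theorem IsSplittable.activeWalk_split (hs : G.IsSplittable κ) (hSD : S ⊆ D) (ha : a ∈ D)
    (hb : b ∈ D) (h : G.ActiveWalk (G.An D) S a b) :
    (G.split κ).ActiveWalk ((G.split κ).An D) S a b := by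
  by_cases hκ : Disjoint κ (G.An D)
  · by_cases hout : ∃ x, x ∉ κ ∧ G.Unblocked S x ∧ ∃ k ∈ κ, G.Line x k
    · obtain ⟨x, hx, hxb, k, hk, hxk⟩ := hout
      exact hs.activeWalk_split_of_disjoint hκ ha hb hxb hx hk hxk h
    · exact h.split fun u v hub hu hv huv => absurd ⟨u, hu, hub, v, hv, huv⟩ hout
  · obtain ⟨k, hk, hkD⟩ := Set.not_disjoint_iff.mp hκ
    exact h.split fun u v => hs.activeWalk_split_of_line hSD hk hkD

theorem IsSplittable.activeWalk_to_of_line (hs : G.IsSplittable κ) (hx : x ∉ κ)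
    (hcover : ∀ k ∈ κ, G.Line x k) (hxS : x ∉ S) (hub : G.Unblocked S u) (hu : u ∉ κ) (hk : k ∈ κ)
    (huk : G.Line u k) : G.ActiveWalk D S u x := by
  rcases eq_or_ne u x with rfl | hux
  · exact .refl
  · exact ActiveStep.walk
      ⟨hub, Or.inl hxS, Or.inl (hs.complete u x k hu hx hk huk (hcover k hk) hux)⟩

theorem IsSplittable.activeWalk_of_split_of_arrow (hs : G.IsSplittable κ) (hx : x ∉ κ)
    (hcover : ∀ k ∈ κ, G.Line x k) (hxS : x ∉ S) (huv : G.Arrow u v) (hu : u ∉ S)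
    (hv : v ∈ (G.split κ).An D) : G.ActiveWalk (G.An D) S u v := by
  rcases hs.mem_An_split hv with hvD | ⟨hvκ, k, hk, hkD, hvk⟩
  · exact (activeStep_of_arrow huv hu hvD).walk
  · -- The arrow is replaced by the detour `u → k - x - v`.
    have huk : G.Arrow u k := hs.parents u v k hvκ hk hvk huv
    have hkx : G.ActiveStep (G.An D) S k x :=
      ⟨Or.inr ⟨u, hu, huk⟩, Or.inl hxS, Or.inl (hcover k hk).symm⟩
    have hvx : G.ActiveWalk (G.An D) S v x :=
      hs.activeWalk_to_of_line hx hcover hxS (Or.inr ⟨u, hu, huv⟩) hvκ hk hvk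
    exact .head (activeStep_of_arrow huk hu hkD) (.head hkx hvx.symm)

theorem IsSplittable.activeWalk_of_split_of_cover (hs : G.IsSplittable κ) (hx : x ∉ κ)
    (hcover : ∀ k ∈ κ, G.Line x k) (hxS : x ∉ S) (ha : a ∉ S) (hb : b ∉ S)
    (h : (G.split κ).ActiveWalk ((G.split κ).An D) S a b) : G.ActiveWalk (G.An D) S a b := by
  have toCover {k} (hk : k ∈ κ) (hkb : G.Unblocked S k) : G.ActiveWalk (G.An D) S k x :=
    ActiveStep.walk ⟨hkb, Or.inl hxS, Or.inl (hcover k hk).symm⟩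
  have ofArrow {u v} (huv : (G.split κ).Arrow u v) (hv : v ∉ κ) : G.Arrow u v :=
    (split_arrow.mp huv).resolve_right fun h => hv h.2.2
  refine reflTransGen_of_collapse (c := x) h (fun u v huv hu hv => ?_) (fun u v huv hu hv => ?_)
    (fun haκ => toCover haκ (Or.inl ha)) (fun hbκ => toCover hbκ (Or.inl hb))
  · obtain ⟨hub, hvb, hl | ⟨ha, hS, hD⟩ | ⟨ha, hS, hD⟩⟩ := huv
    · exact ActiveStep.walk ⟨hub.of_split hu, hvb.of_split hv, Or.inl (split_line.mp hl).1⟩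
    · exact hs.activeWalk_of_split_of_arrow hx hcover hxS (ofArrow ha hv) hS hD
    · exact (hs.activeWalk_of_split_of_arrow hx hcover hxS (ofArrow ha hu) hS hD).symm
  · obtain ⟨hub, -, hl | ⟨ha, hS, hD⟩ | ⟨ha, hS, hD⟩⟩ := huv
    · exact absurd ((split_line.mp hl).2.mpr hv) hu
    · rcases split_arrow.mp ha with ha | ⟨hl, -⟩
      · exact (hs.activeWalk_of_split_of_arrow hx hcover hxS ha hS hD).trans
          (toCover hv (Or.inr ⟨u, hS, ha⟩))
      · exact hs.activeWalk_to_of_line hx hcover hxS (hub.of_split hu) hu hv hl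
    · exact (hs.activeWalk_of_split_of_arrow hx hcover hxS (ofArrow ha hu) hS hD).symm.trans
        (toCover hv (Or.inl hS))

theorem IsSplittable.activeWalk_of_split (hs : G.IsSplittable κ) (hSD : S ⊆ D) (ha : a ∉ S)
    (hb : b ∉ S) (h : (G.split κ).ActiveWalk ((G.split κ).An D) S a b) :
    G.ActiveWalk (G.An D) S a b := by
  by_cases hcase : ∃ x, x ∉ κ ∧ x ∉ S ∧ ∃ k ∈ κ, k ∈ G.An D ∧ G.Line x k
  · obtain ⟨x, hx, hxS, k, hk, -, hxk⟩ := hcase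
    exact hs.activeWalk_of_split_of_cover hx (fun k' hk' => hs.covers x k k' hx hk hk' hxk) hxS
      ha hb h
  · -- Otherwise active walks use no arrow that is new in the split graph.
    have ofArrow {u v} (huv : (G.split κ).Arrow u v) (hu : u ∉ S) (hv : v ∈ (G.split κ).An D) :
        G.Arrow u v ∧ u ∉ S ∧ v ∈ G.An D := by
      have hvD : v ∈ G.An D := by
        rcases hs.mem_An_split hv with hvD | ⟨hvκ, k, hk, hkD, hvk⟩
        · exact hvD
        · by_contra hvD
          exact hcase ⟨v, hvκ, fun hvS => hvD (subset_An (hSD hvS)), k, hk, hkD, hvk⟩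
      exact ⟨(split_arrow.mp huv).resolve_right fun ⟨hl, huκ, hvκ⟩ =>
        hcase ⟨u, huκ, hu, v, hvκ, hvD, hl⟩, hu, hvD⟩
    have ofUnblocked {v} (hv : (G.split κ).Unblocked S v) : G.Unblocked S v := by
      by_cases hvS : v ∈ S
      · obtain ⟨p, hp, hpv⟩ := hv.resolve_left (not_not_intro hvS)
        exact Or.inr ⟨p, hp, (ofArrow hpv hp (subset_An (hSD hvS))).1⟩
      · exact Or.inl hvS
    refine ReflTransGen.mono (fun u v huv => ?_) _ _ h
    exact ⟨ofUnblocked huv.1, ofUnblocked huv.2.1, huv.2.2.imp (fun hl => (split_line.mp hl).1)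
      (Or.imp (fun h => ofArrow h.1 h.2.1 h.2.2) (fun h => ofArrow h.1 h.2.1 h.2.2))⟩

theorem MarkovEquiv.refl [Finite V] (G : MixedGraph V) : MarkovEquiv G G := fun _ _ _ => rfl

theorem MarkovEquiv.trans [Finite V] {K : MixedGraph V} (h : MarkovEquiv G H)
    (h' : MarkovEquiv H K) : MarkovEquiv G K :=
  fun X _ _ => (h X).trans (h' X)

theorem IsSplittable.markovEquiv [Finite V] (hs : G.IsSplittable κ) (hG : G.IsChainGraph) :
    MarkovEquiv G (G.split κ) := by
  have separates_iff {A B S : Set V} (hAS : Disjoint A S) (hBS : Disjoint B S) :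
      Separates (G.extended (A ∪ B ∪ S)).augmented A B S ↔
        Separates ((G.split κ).extended (A ∪ B ∪ S)).augmented A B S := by
    have hA : A ⊆ A ∪ B ∪ S := fun _ h => Or.inl (Or.inl h)
    have hB : B ⊆ A ∪ B ∪ S := fun _ h => Or.inl (Or.inr h)
    have hS : S ⊆ A ∪ B ∪ S := Set.subset_union_right
    rw [hG.separates_extended_iff hA hS hAS hBS,
      (hG.split κ).separates_extended_iff hA hS hAS hBS]
    exact forall₄_congr fun a ha b hb => not_congr ⟨hs.activeWalk_split hS (hA ha) (hB hb),
      hs.activeWalk_of_split hS (Set.disjoint_left.mp hAS ha) (Set.disjoint_left.mp hBS hb)⟩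
  intro X _ _
  ext P
  exact forall_congr' fun A => forall_congr' fun B => forall_congr' fun S =>
    forall_congr' fun _ => forall_congr' fun hAS => forall_congr' fun hBS =>
    imp_congr (separates_iff hAS hBS) Iff.rfl

end Split

/-! ### Chain components and the properties S and S' -/

section Components

variable {G : MixedGraph V} {ξ κ A K W : Set V} {a b p x y : V}

theorem mem_chainComponents_iff : ξ ∈ G.chainComponents ↔ ∃ x, ξ = G.component x := by
  have mem_supp_mk {x y} : y ∈ (G.lineGraph.connectedComponentMk x).supp ↔ y ∈ G.component x := by
    rw [SimpleGraph.ConnectedComponent.mem_supp_iff, SimpleGraph.ConnectedComponent.eq,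
      SimpleGraph.reachable_comm, SimpleGraph.reachable_iff_reflTransGen]
    exact Iff.rfl
  constructor
  · rintro ⟨c, rfl⟩
    obtain ⟨x, rfl⟩ := c.exists_rep
    exact ⟨x, Set.ext fun _ => mem_supp_mk⟩
  · rintro ⟨x, rfl⟩
    exact ⟨G.lineGraph.connectedComponentMk x, Set.ext fun _ => mem_supp_mk.symm⟩

theorem component_mem_chainComponents : G.component x ∈ G.chainComponents :=
  mem_chainComponents_iff.mpr ⟨x, rfl⟩

theorem mem_of_reflTransGen_line (hξ : ξ ∈ G.chainComponents) (hx : x ∈ ξ)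
    (h : ReflTransGen G.Line x y) : y ∈ ξ := by
  obtain ⟨z, rfl⟩ := mem_chainComponents_iff.mp hξ
  exact ReflTransGen.trans hx h

theorem mem_of_line (hξ : ξ ∈ G.chainComponents) (hx : x ∈ ξ) (h : G.Line x y) : y ∈ ξ :=
  mem_of_reflTransGen_line hξ hx (.single h)

theorem reflTransGen_line_of_mem (hξ : ξ ∈ G.chainComponents) (hx : x ∈ ξ) (hy : y ∈ ξ) :
    ReflTransGen G.Line x y := by
  obtain ⟨z, rfl⟩ := mem_chainComponents_iff.mp hξ
  exact (symm_of (ReflTransGen G.Line) hx).trans hy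

theorem reach_of_mem (hξ : ξ ∈ G.chainComponents) (hx : x ∈ ξ) (hy : y ∈ ξ) : G.Reach x y :=
  reach_of_reflTransGen_line (reflTransGen_line_of_mem hξ hx hy)

theorem IsChainGraph.line_of_mem (hG : G.IsChainGraph) (hξ : ξ ∈ G.chainComponents) (hx : x ∈ ξ)
    (hy : y ∈ ξ) (h : G.Adj x y) : G.Line x y :=
  hG.line_of_adj h (reach_of_mem hξ hx hy) (reach_of_mem hξ hy hx)

theorem IsChainGraph.notMem_of_arrow (hG : G.IsChainGraph) (hξ : ξ ∈ G.chainComponents)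
    (hx : x ∈ ξ) (h : G.Arrow p x) : p ∉ ξ := fun hp =>
  hG.not_reach h (reach_of_mem hξ hx hp)

theorem IsChainGraph.arrow_of_mem (hG : G.IsChainGraph) (hξ : ξ ∈ G.chainComponents)
    (hx : x ∈ ξ) (hy : y ∈ ξ) (h : G.Arrow p x) (hpy : G.Adj p y) : G.Arrow p y :=
  arrow_of_adj hpy fun hyp => hG.not_reach h ((reach_of_mem hξ hx hy).trans hyp)

theorem restrict_line : (G.restrict W).Line x y ↔ G.Line x y ∧ x ∈ W ∧ y ∈ W := by
  simp only [Line, restrict]; tauto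

theorem restrict_arrow : (G.restrict W).Arrow x y ↔ G.Arrow x y ∧ x ∈ W ∧ y ∈ W := by
  simp only [Arrow, restrict]; tauto

theorem restrict_adj : (G.restrict W).Adj x y ↔ G.Adj x y ∧ x ∈ W ∧ y ∈ W := by
  simp only [Adj, restrict]; tauto

theorem nb_subset (hξ : ξ ∈ G.chainComponents) (hA : A ⊆ ξ) : G.nb A ⊆ ξ :=
  fun _ ⟨_, _, ha, h⟩ => mem_of_line hξ (hA ha) h.symm

theorem cnb_subset_nb (hne : A.Nonempty) : G.cnb A ⊆ G.nb A :=
  fun _ hv => ⟨hv.1, hne.some, hne.some_mem, hv.2 _ hne.some_mem⟩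

theorem restrict_line_of_mem (hξ : ξ ∈ G.chainComponents) (hx : x ∈ ξ) :
    (G.restrict ξ).Line y x ↔ G.Line y x :=
  ⟨fun h => (restrict_line.mp h).1,
    fun h => restrict_line.mpr ⟨h, mem_of_line hξ hx h.symm, hx⟩⟩

theorem nb_restrict (hξ : ξ ∈ G.chainComponents) (hA : A ⊆ ξ) : (G.restrict ξ).nb A = G.nb A :=
  Set.ext fun _ => and_congr_right fun _ => exists_congr fun _ => and_congr_right fun ha =>
    restrict_line_of_mem hξ (hA ha)

theorem cnb_restrict (hξ : ξ ∈ G.chainComponents) (hA : A ⊆ ξ) : (G.restrict ξ).cnb A = G.cnb A :=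
  Set.ext fun _ => and_congr_right fun _ => forall₂_congr fun _ ha =>
    restrict_line_of_mem hξ (hA ha)

theorem ncnb_restrict (hξ : ξ ∈ G.chainComponents) (hA : A ⊆ ξ) :
    (G.restrict ξ).ncnb A = G.ncnb A :=
  Set.ext fun _ => and_congr_right fun _ => and_congr
    (exists_congr fun _ => and_congr_right fun ha => restrict_line_of_mem hξ (hA ha))
    (exists_congr fun _ => and_congr_right fun ha => not_congr (restrict_line_of_mem hξ (hA ha)))

theorem restrict_cl_arrow_of_mem (hx : x ∈ ξ) : (G.restrict (G.cl ξ)).Arrow p x ↔ G.Arrow p x :=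
  ⟨fun h => (restrict_arrow.mp h).1,
    fun h => restrict_arrow.mpr ⟨h, mem_cl.mpr (Or.inr ⟨x, hx, h⟩), Or.inl hx⟩⟩

theorem pa_restrict_cl (hA : A ⊆ ξ) : (G.restrict (G.cl ξ)).pa A = G.pa A :=
  Set.ext fun _ => and_congr_right fun _ => exists_congr fun _ => and_congr_right fun ha =>
    restrict_cl_arrow_of_mem (hA ha)

theorem cpa_restrict_cl (hA : A ⊆ ξ) : (G.restrict (G.cl ξ)).cpa A = G.cpa A :=
  Set.ext fun _ => and_congr_right fun _ => forall₂_congr fun _ ha =>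
    restrict_cl_arrow_of_mem (hA ha)

theorem isClique_restrict_iff (hA : A ⊆ ξ) :
    (G.restrict ξ).skeleton.IsClique A ↔ G.skeleton.IsClique A :=
  forall₄_congr fun _ ha _ hb => imp_congr_right fun _ =>
    restrict_adj.trans (and_iff_left ⟨hA ha, hA hb⟩)

/-- No nonempty proper subset of `ξ` can be split off. -/
def Unsplittable (G : MixedGraph V) (ξ : Set V) : Prop :=
  ∀ κ, κ ⊂ ξ → κ.Nonempty → ¬ G.IsSplittable κ

theorem nb_nonempty (hξ : ξ ∈ G.chainComponents) (hκ : κ ⊂ ξ) (hne : κ.Nonempty) :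
    (G.nb κ).Nonempty := by
  obtain ⟨k, hk⟩ := hne
  obtain ⟨z, hz, hzκ⟩ := Set.exists_of_ssubset hκ
  by_contra hnb
  suffices ∀ w, ReflTransGen G.Line k w → w ∈ κ from
    hzκ (this z (reflTransGen_line_of_mem hξ (hκ.1 hk) hz))
  intro w hw
  induction hw with
  | refl => exact hk
  | @tail u w _ huw ih =>
    by_contra hwκ
    exact hnb ⟨w, hwκ, u, ih, huw.symm⟩

theorem connected_induce_iff (hG : G.IsChainGraph) (hξ : ξ ∈ G.chainComponents) (hκ : κ ⊆ ξ)
    (hne : κ.Nonempty) : (G.skeleton.induce κ).Connected ↔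
      ∀ x ∈ κ, ∀ y ∈ κ, ReflTransGen (fun u v => G.Line u v ∧ v ∈ κ) x y := by
  constructor
  · intro hconn x hx y hy
    have hxy : ReflTransGen (fun u v => G.skeleton.Adj u v ∧ v ∈ κ) x y :=
      reflTransGen_of_reachable_induce (hconn ⟨x, hx⟩ ⟨y, hy⟩)
    suffices y ∈ κ ∧ ReflTransGen (fun u v => G.Line u v ∧ v ∈ κ) x y from this.2
    clear hy
    induction hxy with
    | refl => exact ⟨hx, .refl⟩
    | tail _ huv ih =>
      exact ⟨huv.2, ih.2.tail ⟨hG.line_of_mem hξ (hκ ih.1) (hκ huv.2) huv.1, huv.2⟩⟩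
  · intro h
    have : Nonempty κ := hne.to_subtype
    refine ⟨fun x y => (reachable_induce_of_reflTransGen x.2 ?_).2⟩
    exact ReflTransGen.mono (fun _ _ huv => ⟨huv.1.adj, huv.2⟩) _ _ (h x x.2 y y.2)

theorem isSplittable_iff (hG : G.IsChainGraph) (hξ : ξ ∈ G.chainComponents) (hκ : κ ⊆ ξ)
    (hne : κ.Nonempty) : G.IsSplittable κ ↔ (G.skeleton.induce κ).Connected ∧
      G.nb κ ⊆ G.cnb κ ∧ G.skeleton.IsClique (G.nb κ) ∧ G.pa (G.nb κ) ⊆ G.cpa κ := by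
  rw [connected_induce_iff hG hξ hκ hne]
  constructor
  · intro hs
    have hcnb : G.nb κ ⊆ G.cnb κ := fun a ⟨ha, k, hk, hak⟩ =>
      ⟨ha, fun k' hk' => hs.covers a k k' ha hk hk' hak⟩
    refine ⟨hs.connected, hcnb, fun a ha b hb hab => ?_, fun p ⟨_, a, ha, hpa⟩ => ?_⟩
    · obtain ⟨k, hk⟩ := hne
      exact (hs.complete a b k ha.1 hb.1 hk ((hcnb ha).2 k hk) ((hcnb hb).2 k hk) hab).adj
    · have hpκ : ∀ k ∈ κ, G.Arrow p k := fun k hk =>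
        hs.parents p a k ha.1 hk ((hcnb ha).2 k hk) hpa
      exact ⟨fun hp => (hpκ p hp).ne rfl, hpκ⟩
  · rintro ⟨hconn, hcnb, hclique, hpa⟩
    refine ⟨hconn, fun a k k' ha hk hk' hak => ?_, fun a b k ha hb hk hak hbk hab => ?_,
      fun p a k ha hk hak hpa' => ?_⟩
    · exact (hcnb ⟨ha, k, hk, hak⟩).2 k' hk'
    · have haκ : a ∈ G.nb κ := ⟨ha, k, hk, hak⟩
      have hbκ : b ∈ G.nb κ := ⟨hb, k, hk, hbk⟩
      exact hG.line_of_mem hξ (nb_subset hξ hκ haκ) (nb_subset hξ hκ hbκ) (hclique haκ hbκ hab)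
    · have haκ : a ∈ G.nb κ := ⟨ha, k, hk, hak⟩
      have hp : p ∉ G.nb κ := fun hp =>
        hG.notMem_of_arrow hξ (nb_subset hξ hκ haκ) hpa' (nb_subset hξ hκ hp)
      exact (hpa ⟨hp, a, haκ, hpa'⟩).2 k hk

theorem not_nonempty_ncnb_iff : ¬ (G.ncnb A).Nonempty ↔ G.nb A ⊆ G.cnb A := by
  refine ⟨fun h v ⟨hv, hline⟩ => ⟨hv, fun a ha => ?_⟩, fun h ⟨v, hv, hline, a, ha, hva⟩ =>
    hva ((h ⟨hv, hline⟩).2 a ha)⟩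
  by_contra hva
  exact h ⟨v, hv, hline, a, ha, hva⟩

theorem propertyS'_iff (hG : G.IsChainGraph) (hξ : ξ ∈ G.chainComponents) :
    G.PropertyS' ξ ↔ G.Unsplittable ξ := by
  refine forall₃_congr fun κ hκ hne => ?_
  have hcnbξ : G.cnb κ ⊆ ξ := (cnb_subset_nb hne).trans (nb_subset hξ hκ.1)
  rw [cnb_restrict hξ hκ.1, ncnb_restrict hξ hκ.1, pa_restrict_cl hcnbξ, cpa_restrict_cl hκ.1,
    isClique_restrict_iff hcnbξ, isSplittable_iff hG hξ hκ.1 hne, ← not_nonempty_ncnb_iff]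
  by_cases hncnb : (G.ncnb κ).Nonempty
  · simp only [hncnb, true_or, implies_true, not_true_eq_false, false_and, and_false,
      not_false_eq_true]
  · have hcnb : G.cnb κ = G.nb κ :=
      (cnb_subset_nb hne).antisymm (not_nonempty_ncnb_iff.mp hncnb)
    simp only [hcnb, hncnb, nb_nonempty hξ hκ hne, false_or, true_imp_iff, Set.sdiff_nonempty,
      not_false_eq_true, true_and, not_and]

theorem nb_eq_of_isComponentOf_cnb (hne : K.Nonempty) (hK : K ⊆ G.cnb A) (hnb : G.nb K ⊆ A) :
    G.nb K = A := by
  refine hnb.antisymm fun a ha => ⟨fun haK => (hK haK).1 ha, hne.some, hne.some_mem, ?_⟩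
  exact ((hK hne.some_mem).2 a ha).symm

theorem propertyS_iff (hG : G.IsChainGraph) (hξ : ξ ∈ G.chainComponents) :
    G.PropertyS ξ ↔ G.Unsplittable ξ := by
  constructor
  · intro hS κ hκ hne hs
    obtain ⟨hconn, hcnb, hclique, hpa⟩ := (isSplittable_iff hG hξ hκ.1 hne).mp hs
    have hnbξ : G.nb κ ⊆ ξ := nb_subset hξ hκ.1
    have hnbne : (G.nb κ).Nonempty := nb_nonempty hξ hκ hne
    have hκnb : κ ⊆ G.cnb (G.nb κ) := fun k hk =>
      ⟨fun h => h.1 hk, fun a ha => ((hcnb ha).2 k hk).symm⟩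
    have hcomp : G.IsComponentOf (G.cnb (G.nb κ)) κ := eq_supp_induce_iff.mpr
      ⟨hκnb, hconn, fun x hx y hy hxy => by_contra fun hyκ => hy.1 ⟨hyκ, x, hx, hG.line_of_mem hξ
        (nb_subset hξ hnbξ (cnb_subset_nb hnbne hy)) (hκ.1 hx) (Adj.symm hxy)⟩⟩
    have hnbss : G.nb κ ⊂ ξ := ⟨hnbξ, fun h => (h (hκ.1 hne.some_mem)).1 hne.some_mem⟩
    have := hS (G.nb κ) hnbss hnbne ((isClique_restrict_iff hnbξ).mpr hclique)
    rw [cnb_restrict hξ hnbξ, pa_restrict_cl hnbξ] at this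
    rcases this (hne.mono hκnb) κ hcomp with h | h
    · rw [nb_restrict hξ hκ.1, sdiff_self] at h
      exact Set.not_nonempty_empty h
    · rw [cpa_restrict_cl hκ.1] at h
      exact Set.sdiff_nonempty.mp h hpa
  · intro hU α hα hαne hclique hne K hK
    rw [cnb_restrict hξ hα.1] at hK
    obtain ⟨hKα, hconn, -⟩ := eq_supp_induce_iff.mp hK
    have hKne : K.Nonempty := Set.nonempty_coe_sort.mp hconn.nonempty
    have hKξ : K ⊆ ξ := hKα.trans ((cnb_subset_nb hαne).trans (nb_subset hξ hα.1))
    rw [nb_restrict hξ hKξ, pa_restrict_cl hα.1, cpa_restrict_cl hKξ, Set.sdiff_nonempty,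
      Set.sdiff_nonempty, ← not_and_or]
    rintro ⟨hnb, hpa⟩
    obtain rfl := nb_eq_of_isComponentOf_cnb hKne hKα hnb
    refine hU K ⟨hKξ, fun h => ?_⟩ hKne ((isSplittable_iff hG hξ hKξ hKne).mpr
      ⟨hconn, fun a ha => ⟨ha.1, fun k hk => ((hKα hk).2 a ha).symm⟩,
        (isClique_restrict_iff hα.1).mp hclique, hpa⟩)
    exact hαne.some_mem.1 (h (hα.1 hαne.some_mem))

theorem IsChainGraph.exists_isChordlessUndirectedCycle_iff (hG : G.IsChainGraph)
    (hξ : ξ ∈ G.chainComponents) :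
    (∃ k v, (G.restrict (G.cl ξ)).IsChordlessUndirectedCycle k v ∧ ∀ i ≤ k, v i ∈ ξ) ↔
      HasHole G.lineGraph ξ := by
  constructor
  · rintro ⟨k, v, ⟨⟨-, h0, hinj, -⟩, hk, hline, hchord⟩, hmem⟩
    refine ⟨k, v, hk, h0, hinj, fun i hi => hmem i hi.le, fun i hi => (restrict_line.mp
      (hline i hi)).1, fun i j hij hj h1 h2 h3 => hchord i j hij hj h1 h2 (restrict_adj.mpr
      ⟨Line.adj h3, Or.inl (hmem i (hij.trans hj).le), Or.inl (hmem j hj.le)⟩)⟩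
  · rintro ⟨k, v, hk, h0, hinj, hmem, hline, hchord⟩
    have hmem' : ∀ i ≤ k, v i ∈ ξ := fun i hi =>
      hi.lt_or_eq.elim (hmem i) fun h => h ▸ h0 ▸ hmem 0 (by omega)
    have hline' : ∀ i < k, (G.restrict (G.cl ξ)).Line (v i) (v (i + 1)) := fun i hi =>
      restrict_line.mpr ⟨hline i hi, Or.inl (hmem' i hi.le), Or.inl (hmem' (i + 1) hi)⟩
    exact ⟨k, v, ⟨⟨by omega, h0, hinj, fun i hi => (hline' i hi).1⟩, hk, hline',
      fun i j hij hj h1 h2 h3 => hchord i j hij hj h1 h2 (hG.line_of_mem hξ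
        (hmem i (hij.trans hj)) (hmem j hj) (restrict_adj.mp h3).1)⟩, hmem'⟩

theorem exists_isFlag_restrict_iff (hξ : ξ ∈ G.chainComponents) :
    (∃ a b c, (G.restrict (G.cl ξ)).IsFlag a b c ∧ b ∈ ξ ∧ c ∈ ξ) ↔
      ∃ a b c, G.IsFlag a b c ∧ b ∈ ξ := by
  constructor
  · rintro ⟨a, b, c, ⟨hab, hbc, hac⟩, hb, -⟩
    obtain ⟨hab, ha, -⟩ := restrict_arrow.mp hab
    obtain ⟨hbc, -, hc⟩ := restrict_line.mp hbc
    exact ⟨a, b, c, ⟨hab, hbc, fun h => hac (restrict_adj.mpr ⟨h, ha, hc⟩)⟩, hb⟩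
  · rintro ⟨a, b, c, ⟨hab, hbc, hac⟩, hb⟩
    have hc : c ∈ ξ := mem_of_line hξ hb hbc
    exact ⟨a, b, c, ⟨(restrict_cl_arrow_of_mem hb).mpr hab,
      restrict_line.mpr ⟨hbc, Or.inl hb, Or.inl hc⟩, fun h => hac (restrict_adj.mp h).1⟩, hb, hc⟩

theorem mem_strongComponents_iff (hG : G.IsChainGraph) :
    ξ ∈ G.strongComponents ↔ ξ ∈ G.chainComponents ∧
      (HasHole G.lineGraph ξ ∨ ∃ a b c, G.IsFlag a b c ∧ b ∈ ξ) := by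
  refine and_congr_right fun hξ => ?_
  rw [hG.exists_isChordlessUndirectedCycle_iff hξ, exists_isFlag_restrict_iff hξ]
  refine and_iff_right_of_imp ?_
  rintro (⟨k, v, hk, -, -, hmem, hline, -⟩ | ⟨a, b, c, h, hb⟩)
  · exact ⟨v 0, hmem 0 (by omega), v 1, hmem 1 (by omega), (hline 0 (by omega)).ne⟩
  · exact ⟨b, hb, c, mem_of_line hξ hb h.2.1, h.2.1.ne⟩

end Components

/-! ### Rigid lines and arrows -/

section Rigid

variable {G H : MixedGraph V} {ξ κ : Set V} {a b c d p x y t : V} {r : V → ℕ}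

/-- `G` and `H` have the same skeleton and the same triplexes; for chain graphs this is the
graphical counterpart of AMP Markov equivalence. -/
structure SameTriplexes (G H : MixedGraph V) : Prop where
  adj_iff : ∀ {a b}, G.Adj a b ↔ H.Adj a b
  isTriplex_iff : ∀ {a b c}, G.IsTriplex a b c ↔ H.IsTriplex a b c

theorem MarkovEquiv.sameTriplexes [Finite V] (hG : G.IsChainGraph) (hH : H.IsChainGraph)
    (h : MarkovEquiv G H) : SameTriplexes G H :=
  ⟨⟨h.adj hH, h.symm.adj hG⟩, ⟨h.isTriplex hG hH, h.symm.isTriplex hH hG⟩⟩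

theorem reflTransGen_line_within
    (hx : ReflTransGen (fun u v => G.Line u v ∧ v ∈ ξ) t x)
    (hy : ReflTransGen (fun u v => G.Line u v ∧ v ∈ ξ) t y) :
    let κ := {z | ReflTransGen (fun u v => G.Line u v ∧ v ∈ ξ) t z}
    ReflTransGen (fun u v => G.Line u v ∧ u ∈ κ ∧ v ∈ κ) x y := by
  intro κ
  have : Std.Symm fun u v => G.Line u v ∧ u ∈ κ ∧ v ∈ κ := ⟨fun _ _ h => ⟨h.1.symm, h.2.2, h.2.1⟩⟩
  have from_base {z} (hz : z ∈ κ) : ReflTransGen (fun u v => G.Line u v ∧ u ∈ κ ∧ v ∈ κ) t z := by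
    induction hz with
    | refl => exact .refl
    | tail hu huv ih => exact ih.tail ⟨huv.1, hu, hu.tail huv⟩
  exact (symm_of (ReflTransGen _) (from_base hx)).trans (from_base hy)

-- Take the piece, connected by lines of `H`, of a vertex of `ξ` of maximal height.
theorem IsChainGraph.exists_sink_piece [Finite V] (hH : H.IsChainGraph) (hne : ξ.Nonempty) :
    ∃ κ ⊆ ξ, κ.Nonempty ∧
      (∀ x ∈ κ, ∀ y ∈ κ, ReflTransGen (fun u v => H.Line u v ∧ u ∈ κ ∧ v ∈ κ) x y) ∧
      ∀ a k, a ∈ ξ → a ∉ κ → k ∈ κ → H.Adj a k → H.Arrow a k := by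
  obtain ⟨r, hrA, hrL⟩ := hH.exists_height
  obtain ⟨t, ht, hmax⟩ := Set.exists_max_image ξ r (Set.toFinite ξ) hne
  refine ⟨{z | ReflTransGen (fun u v => H.Line u v ∧ v ∈ ξ) t z}, fun z hz => ?_, ⟨t, .refl⟩,
    fun x hx y hy => reflTransGen_line_within hx hy, fun a k haξ ha hk hak => ?_⟩
  · cases hz with
    | refl => exact ht
    | tail _ h => exact h.2
  · have hrk : r k = r t := by
      clear hak
      induction hk with
      | refl => rfl
      | tail _ h ih => rw [← hrL _ _ h.1, ih]
    rcases MixedGraph.adj_iff.mp hak with h | h | h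
    · exact absurd (ReflTransGen.tail hk ⟨h.symm, haξ⟩) ha
    · exact h
    · have := hrA _ _ h
      have := hmax a haξ
      omega

theorem SameTriplexes.isSplittable (hGH : SameTriplexes G H) (hG : G.IsChainGraph)
    (hξ : ξ ∈ G.chainComponents) (hκ : κ ⊆ ξ)
    (hconn : ∀ x ∈ κ, ∀ y ∈ κ, ReflTransGen (fun u v => H.Line u v ∧ u ∈ κ ∧ v ∈ κ) x y)
    (harrow : ∀ a k, a ∈ ξ → a ∉ κ → k ∈ κ → H.Adj a k → H.Arrow a k) : G.IsSplittable κ := by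
  have line_of_adj {u v} (hu : u ∈ ξ) (hv : v ∈ ξ) (h : H.Adj u v) : G.Line u v :=
    hG.line_of_mem hξ hu hv (hGH.adj_iff.mpr h)
  have mem_of_line {a k} (hk : k ∈ κ) (h : G.Line a k) : a ∈ ξ := mem_of_line hξ (hκ hk) h.symm
  have arrow_of_line {a k} (ha : a ∉ κ) (hk : k ∈ κ) (h : G.Line a k) : H.Arrow a k :=
    harrow a k (mem_of_line hk h) ha hk (hGH.adj_iff.mp h.adj)
  refine ⟨fun x hx y hy => ?_, fun a k k' ha hk hk' hak => ?_,
    fun a b k ha hb hk hak hbk hab => ?_, fun p a k ha hk hak hpa => ?_⟩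
  · exact ReflTransGen.mono
      (fun u v h => ⟨line_of_adj (hκ h.2.1) (hκ h.2.2) h.1.adj, h.2.2⟩) _ _ (hconn x hx y hy)
  · have hwalk := hconn k hk k' hk'
    clear hk'
    induction hwalk with
    | refl => exact hak
    | @tail u w _ huw ih =>
      by_contra haw
      have htri : H.IsTriplex a u w := Or.inl ⟨arrow_of_line ha huw.2.1 ih, huw.1,
        fun h => haw (line_of_adj (mem_of_line hk hak) (hκ huw.2.2) h)⟩
      exact (hGH.isTriplex_iff.mpr htri).not_line_right ih
        (line_of_adj (hκ huw.2.1) (hκ huw.2.2) huw.1.adj)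
  · by_contra hcon
    have htri : H.IsTriplex a k b := Or.inr (Or.inr ⟨hab, arrow_of_line ha hk hak,
      arrow_of_line hb hk hbk,
      fun h => hcon (line_of_adj (mem_of_line hk hak) (mem_of_line hk hbk) h)⟩)
    exact (hGH.isTriplex_iff.mpr htri).not_line_right hak hbk.symm
  · refine hG.arrow_of_mem hξ (mem_of_line hk hak) (hκ hk) hpa ?_
    by_contra hadj
    exact (hGH.isTriplex_iff.mp (Or.inl ⟨hpa, hak, hadj⟩)).not_arrow_right (arrow_of_line ha hk hak)

theorem Unsplittable.line [Finite V] (hU : G.Unsplittable ξ) (hG : G.IsChainGraph)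
    (hH : H.IsChainGraph) (hGH : SameTriplexes G H) (hξ : ξ ∈ G.chainComponents) (hx : x ∈ ξ)
    (hxy : G.Line x y) : H.Line x y := by
  obtain ⟨κ, hκξ, hκne, hconn, harrow⟩ := hH.exists_sink_piece ⟨x, hx⟩
  obtain rfl : κ = ξ := by
    by_contra hne
    exact hU κ (hκξ.ssubset_of_ne hne) hκne (hGH.isSplittable hG hξ hκξ hconn harrow)
  have reach_of_mem {u v} (hu : u ∈ κ) (hv : v ∈ κ) : H.Reach u v :=
    reach_of_reflTransGen_line (ReflTransGen.mono (fun _ _ h => h.1) _ _ (hconn u hu v hv))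
  have hy : y ∈ κ := mem_of_line hξ hx hxy
  exact hH.line_of_adj (hGH.adj_iff.mp hxy.adj) (reach_of_mem hx hy) (reach_of_mem hy hx)

/-- The arrow `a → b` of `G` is reversed in `H`. -/
structure IsReversed (G H : MixedGraph V) (a b : V) : Prop where
  arrow : G.Arrow a b
  reversed : H.Arrow b a

theorem IsReversed.not_isImmorality (h : IsReversed G H a b) (hGH : SameTriplexes G H) :
    ¬ G.IsImmorality a b c := fun hi =>
  (hGH.isTriplex_iff.mp (Or.inr (Or.inr hi))).not_arrow_left h.reversed

theorem IsReversed.not_isImmorality_of_line (h : IsReversed G H a b) (hGH : SameTriplexes G H)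
    (hH : H.IsChainGraph) (hac : G.Line a c) (had : G.Line a d) : ¬ G.IsImmorality c b d := by
  intro hi
  have htri : H.IsTriplex c b d := hGH.isTriplex_iff.mp (Or.inr (Or.inr hi))
  have arrow_tail {e} (hae : G.Line a e) (heb : H.Adj e b) (hbe : ¬ H.Arrow b e) : H.Arrow e a := by
    refine arrow_of_adj (hGH.adj_iff.mp hae.adj.symm) fun hreach => hH.not_reach h.reversed
      (hreach.trans ?_)
    rcases MixedGraph.adj_iff.mp heb with h | h | h
    · exact h.reach
    · exact h.reach
    · exact absurd h hbe
  have htri' : H.IsTriplex c a d := Or.inr (Or.inr ⟨hi.1,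
    arrow_tail hac htri.adj_left htri.not_arrow_left,
    arrow_tail had htri.adj_right.symm htri.not_arrow_right, htri.not_adj⟩)
  exact (hGH.isTriplex_iff.mpr htri').not_line_right hac.symm had

theorem IsReversed.of_line_tail (h : IsReversed G H a b) (hGH : SameTriplexes G H)
    (hG : G.IsChainGraph) (hH : H.IsChainGraph) (hGac : G.Line a c) (hHac : H.Line a c) :
    IsReversed G H c b := by
  have hcb : G.Adj c b := by
    by_contra hcb
    have htri : H.IsTriplex b a c := Or.inl ⟨h.reversed, hHac,
      fun h' => hcb (hGH.adj_iff.mpr h').symm⟩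
    exact (hGH.isTriplex_iff.mpr htri).not_arrow_left h.arrow
  exact ⟨arrow_of_adj hcb fun h' => hG.not_reach h.arrow (h'.trans hGac.symm.reach),
    arrow_of_adj (hGH.adj_iff.mp hcb.symm) fun h' => hH.not_reach h.reversed (hHac.reach.trans h')⟩

theorem IsReversed.of_line_head (h : IsReversed G H a b) (hGH : SameTriplexes G H)
    (hG : G.IsChainGraph) (hH : H.IsChainGraph) (hGbc : G.Line b c) (hHbc : H.Line b c) :
    IsReversed G H a c := by
  have hac : G.Adj a c := by
    by_contra hac
    exact (hGH.isTriplex_iff.mp (Or.inl ⟨h.arrow, hGbc, hac⟩)).not_arrow_left h.reversed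
  exact ⟨arrow_of_adj hac fun h' => hG.not_reach h.arrow (hGbc.reach.trans h'),
    arrow_of_adj (hGH.adj_iff.mp hac.symm) fun h' =>
      hH.not_reach h.reversed (h'.trans hHbc.symm.reach)⟩

/-- Among the arrows of `G` that are reversed in `H`, `a → b` has a head of least height, and with
this height of the head, a tail of greatest height. -/
structure IsExtremalReversed (G H : MixedGraph V) (r : V → ℕ) (a b : V) : Prop extends
    IsReversed G H a b where
  head_le : ∀ {c d}, IsReversed G H c d → r b ≤ r d
  tail_le : ∀ {c d}, IsReversed G H c d → r d = r b → r c ≤ r a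

theorem IsReversed.exists_isExtremalReversed [Finite V] (h : IsReversed G H a b) (r : V → ℕ) :
    ∃ c d, IsExtremalReversed G H r c d := by
  let S : Set (V × V) := {q | IsReversed G H q.1 q.2}
  obtain ⟨q, hq, hmin⟩ := Set.exists_min_image S (fun q => r q.2) (Set.toFinite S) ⟨(a, b), h⟩
  obtain ⟨⟨c, d⟩, ⟨hcd, hd⟩, hmax⟩ := Set.exists_max_image {q' ∈ S | r q'.2 = r q.2}
    (fun q => r q.1) (Set.toFinite _) ⟨q, hq, rfl⟩
  exact ⟨c, d, hcd, fun h => hd ▸ hmin (_, _) h, fun h h' => hmax (_, _) ⟨h, h'.trans hd⟩⟩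

namespace IsExtremalReversed

theorem congr_height (h : IsExtremalReversed G H r a b) (h' : IsReversed G H c d) (hac : r c = r a)
    (hbd : r d = r b) : IsExtremalReversed G H r c d :=
  ⟨h', fun h₁ => hbd ▸ h.head_le h₁, fun h₁ h₂ => hac ▸ h.tail_le h₁ (h₂.trans hbd)⟩

theorem adj_of_arrow_tail (h : IsExtremalReversed G H r a b) (hGH : SameTriplexes G H)
    (hG : G.IsChainGraph) (hrA : ∀ u v, G.Arrow u v → r u < r v) (hca : G.Arrow c a) :
    G.Adj c b := by
  by_contra hcb
  have hne : b ≠ c := by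
    rintro rfl
    exact hG.not_reach h.arrow hca.reach
  have hnot : ¬ H.IsTriplex b a c := fun ht =>
    (hGH.isTriplex_iff.mpr ht).not_arrow_left h.arrow
  have hac : H.Arrow a c := by
    by_contra hac
    exact hnot (isTriplex_of_arrow hne h.reversed (fun h' => hcb (hGH.adj_iff.mpr h').symm)
      (hGH.adj_iff.mp hca.adj.symm) hac)
  have := h.head_le ⟨hca, hac⟩
  have := hrA _ _ h.arrow
  omega

theorem not_arrow_arrow (h : IsExtremalReversed G H r a b) (hGH : SameTriplexes G H)
    (hH : H.IsChainGraph) (hrA : ∀ u v, G.Arrow u v → r u < r v) (hac : G.Arrow a c) :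
    ¬ G.Arrow c b := by
  intro hcb
  have hrac := hrA _ _ hac
  have hrcb := hrA _ _ hcb
  by_cases hca : H.Arrow c a
  · have := h.head_le ⟨hac, hca⟩
    omega
  · have hreach : H.Reach a c := by
      rcases MixedGraph.adj_iff.mp (hGH.adj_iff.mp hac.adj) with h | h | h
      · exact h.reach
      · exact h.reach
      · exact absurd h hca
    have hbc : H.Arrow b c := arrow_of_adj (hGH.adj_iff.mp hcb.adj.symm) fun h' =>
      hH.not_reach h.reversed (hreach.trans h')
    have := h.tail_le ⟨hcb, hbc⟩ rfl
    omega

theorem of_mem_tail (h : IsExtremalReversed G H r a b) (hGH : SameTriplexes G H)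
    (hG : G.IsChainGraph) (hH : H.IsChainGraph) (hrL : ∀ u v, G.Line u v → r u = r v)
    (hξ : ξ ∈ G.chainComponents) (hline : ∀ x ∈ ξ, ∀ y, G.Line x y → H.Line x y)
    (ha : a ∈ ξ) (hc : c ∈ ξ) : IsExtremalReversed G H r c b := by
  have hac := reflTransGen_line_of_mem hξ ha hc
  clear hc
  induction hac with
  | refl => exact h
  | @tail u w hau huw ih =>
    exact ih.congr_height (ih.of_line_tail hGH hG hH huw
      (hline u (mem_of_reflTransGen_line hξ ha hau) w huw)) (hrL _ _ huw).symm rfl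

theorem of_mem_head (h : IsExtremalReversed G H r a b) (hGH : SameTriplexes G H)
    (hG : G.IsChainGraph) (hH : H.IsChainGraph) (hrL : ∀ u v, G.Line u v → r u = r v)
    (hξ : ξ ∈ G.chainComponents) (hline : ∀ x ∈ ξ, ∀ y, G.Line x y → H.Line x y)
    (hb : b ∈ ξ) (hc : c ∈ ξ) : IsExtremalReversed G H r a c := by
  have hbc := reflTransGen_line_of_mem hξ hb hc
  clear hc
  induction hbc with
  | refl => exact h
  | @tail u w hbu huw ih =>
    exact ih.congr_height (ih.of_line_head hGH hG hH huw
      (hline u (mem_of_reflTransGen_line hξ hb hbu) w huw)) rfl (hrL _ _ huw).symm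

theorem tail_notMem (h : IsExtremalReversed G H r a b) (hGH : SameTriplexes G H)
    (hG : G.IsChainGraph) (hH : H.IsChainGraph) (hrA : ∀ u v, G.Arrow u v → r u < r v)
    (hrL : ∀ u v, G.Line u v → r u = r v) (hξ : ξ ∈ G.strongComponents)
    (hline : ∀ x ∈ ξ, ∀ y, G.Line x y → H.Line x y) : a ∉ ξ := by
  intro ha
  have reversed_of_mem {c} (hc : c ∈ ξ) : IsExtremalReversed G H r c b :=
    h.of_mem_tail hGH hG hH hrL hξ.1 hline ha hc
  rcases ((mem_strongComponents_iff hG).mp hξ).2 with hole | ⟨p, c, d, ⟨hpc, hcd, hpd⟩, hc⟩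
  · obtain ⟨x, hx, y, hy, hxy, hadj⟩ := hole.exists_not_adj
    exact (reversed_of_mem hx).not_isImmorality hGH ⟨hxy, (reversed_of_mem hx).arrow,
      (reversed_of_mem hy).arrow, fun h => hadj (hG.line_of_mem hξ.1 hx hy h)⟩
  · have hd : d ∈ ξ := mem_of_line hξ.1 hc hcd
    have hpb : G.Arrow p b := arrow_of_adj
      ((reversed_of_mem hc).adj_of_arrow_tail hGH hG hrA hpc) fun h' =>
        hG.not_reach hpc ((reversed_of_mem hc).arrow.reach.trans h')
    have hdp : d ≠ p := by
      rintro rfl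
      exact hpc.2 hcd.1
    exact (reversed_of_mem hd).not_isImmorality hGH
      ⟨hdp, (reversed_of_mem hd).arrow, hpb, fun h => hpd h.symm⟩

theorem not_isFlag (h : IsExtremalReversed G H r a x) (h' : IsExtremalReversed G H r a y)
    (hGH : SameTriplexes G H) (hG : G.IsChainGraph) (hH : H.IsChainGraph)
    (hrA : ∀ u v, G.Arrow u v → r u < r v) (hxy : H.Line x y) : ¬ G.IsFlag p x y := by
  rintro ⟨hpx, hGxy, hpy⟩
  have hap : a ≠ p := by
    rintro rfl
    exact hpy h'.arrow.adj
  have hadj : G.Adj a p := by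
    by_contra hap'
    exact h.not_isImmorality hGH ⟨hap, h.arrow, hpx, hap'⟩
  rcases MixedGraph.adj_iff.mp hadj with hline | harrow | harrow
  · have htri : H.IsTriplex p x y := hGH.isTriplex_iff.mp (Or.inl ⟨hpx, hGxy, hpy⟩)
    have hpx' : H.Arrow p x := by
      rcases MixedGraph.adj_iff.mp htri.adj_left with h₁ | h₁ | h₁
      · exact absurd hxy (htri.not_line_right h₁)
      · exact h₁
      · exact absurd h₁ htri.not_arrow_left
    have hap' : H.Arrow a p := by
      by_contra hap'
      have hyp : y ≠ p := by
        rintro rfl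
        exact hpx.2 hGxy.1
      have htri' : H.IsTriplex y a p := isTriplex_of_arrow hyp h'.reversed
        (fun h => hpy (hGH.adj_iff.mpr h).symm) (hGH.adj_iff.mp hline.adj) hap'
      exact (hGH.isTriplex_iff.mpr htri').not_arrow_left h'.arrow
    exact hH.not_reach h.reversed (hap'.reach.trans hpx'.reach)
  · exact h.not_arrow_arrow hGH hH hrA harrow hpx
  · exact hpy (h'.adj_of_arrow_tail hGH hG hrA harrow)

theorem head_notMem (h : IsExtremalReversed G H r a b) (hGH : SameTriplexes G H)
    (hG : G.IsChainGraph) (hH : H.IsChainGraph) (hrA : ∀ u v, G.Arrow u v → r u < r v)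
    (hrL : ∀ u v, G.Line u v → r u = r v) (hξ : ξ ∈ G.strongComponents)
    (hline : ∀ x ∈ ξ, ∀ y, G.Line x y → H.Line x y) : b ∉ ξ := by
  intro hb
  have reversed_of_mem {c} (hc : c ∈ ξ) : IsExtremalReversed G H r a c :=
    h.of_mem_head hGH hG hH hrL hξ.1 hline hb hc
  rcases ((mem_strongComponents_iff hG).mp hξ).2 with hole | ⟨p, x, y, hflag, hx⟩
  · obtain ⟨x, hx, y, hy, hxy, hadj⟩ := hole.exists_not_adj
    have htri : H.IsTriplex x a y := Or.inr (Or.inr ⟨hxy, (reversed_of_mem hx).reversed,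
      (reversed_of_mem hy).reversed,
      fun h => hadj (hG.line_of_mem hξ.1 hx hy (hGH.adj_iff.mpr h))⟩)
    exact (hGH.isTriplex_iff.mpr htri).not_arrow_left (reversed_of_mem hx).arrow
  · exact (reversed_of_mem hx).not_isFlag (reversed_of_mem (mem_of_line hξ.1 hx hflag.2.1)) hGH hG
      hH hrA (hline x hx y hflag.2.1) hflag

end IsExtremalReversed

theorem not_arrow_of_wellProtected [Finite V] (hG : G.IsChainGraph) (hH : H.IsChainGraph)
    (hGH : SameTriplexes G H) (hU : ∀ ξ ∈ G.strongComponents, G.Unsplittable ξ)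
    (hW : ∀ a b, G.Arrow a b → G.WellProtected a b) (hab : G.Arrow a b) : ¬ H.Arrow b a := by
  intro hba
  obtain ⟨r, hrA, hrL⟩ := hG.exists_height
  obtain ⟨a, b, h⟩ := IsReversed.exists_isExtremalReversed ⟨hab, hba⟩ r
  have hline {ξ} (hξ : ξ ∈ G.strongComponents) : ∀ x ∈ ξ, ∀ y, G.Line x y → H.Line x y :=
    fun x hx y => (hU ξ hξ).line hG hH hGH hξ.1 hx
  have tail_notMem {ξ} (hξ : ξ ∈ G.strongComponents) : a ∉ ξ :=
    h.tail_notMem hGH hG hH hrA hrL hξ (hline hξ)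
  have head_notMem {ξ} (hξ : ξ ∈ G.strongComponents) : b ∉ ξ :=
    h.head_notMem hGH hG hH hrA hrL hξ (hline hξ)
  rcases (hW a b h.arrow).2 with ⟨c, hca, hcb⟩ | ⟨c, hi⟩ | ⟨c, hac, hcb⟩ | ⟨c, d, hac, had, hi⟩ |
    ⟨c, ⟨-, ξ, hξ, ha, -⟩, -⟩ | ⟨c, ⟨-, ξ, hξ, -, ha⟩, -⟩ | ⟨c, ⟨-, ξ, hξ, hb, -⟩, -⟩ |
    ⟨c, ⟨-, ξ, hξ, hb, -⟩, -⟩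
  · exact hcb (h.adj_of_arrow_tail hGH hG hrA hca)
  · exact h.not_isImmorality hGH hi
  · exact h.not_arrow_arrow hGH hH hrA hac hcb
  · exact h.not_isImmorality_of_line hGH hH hac had hi
  · exact tail_notMem hξ ha
  · exact tail_notMem hξ ha
  · exact head_notMem hξ hb
  · exact head_notMem hξ hb

end Rigid

/-! ### Flexible lines -/

section Flexible

variable {G : MixedGraph V} {W : Set V} {s x y : V}

/-- `W` is a union of chain components of `G` without holes and without flags whose line lies
in `W`. -/
structure IsFlexible (G : MixedGraph V) (W : Set V) : Prop where
  mem_of_line : ∀ {x y}, x ∈ W → G.Line x y → y ∈ W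
  arrow_of_line : ∀ {p a b}, a ∈ W → G.Line a b → G.Arrow p a → G.Arrow p b
  not_hasHole : ¬ HasHole G.lineGraph W

theorem IsFlexible.isSplittable_singleton (hW : G.IsFlexible W)
    (hs : IsSimplicialIn G.lineGraph W s) : G.IsSplittable {s} := by
  refine ⟨?_, ?_, ?_, ?_⟩
  · rintro x rfl y rfl
    exact .refl
  · rintro a k k' - rfl rfl h
    exact h
  · rintro a b k - - rfl ha hb hab
    exact hs.isClique ⟨hW.mem_of_line hs.mem ha.symm, ha.symm⟩
      ⟨hW.mem_of_line hs.mem hb.symm, hb.symm⟩ hab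
  · rintro p a k - rfl h hpa
    exact hW.arrow_of_line (hW.mem_of_line hs.mem h.symm) h hpa

theorem IsFlexible.split_singleton (hW : G.IsFlexible W) :
    (G.split {s}).IsFlexible (W \ {s}) := by
  refine ⟨fun {u v} ⟨hu, hus⟩ huv => ?_, fun {p a b} ⟨ha, has⟩ hab hpa => ?_, fun h => ?_⟩
  · obtain ⟨huv, hiff⟩ := split_line.mp huv
    exact ⟨hW.mem_of_line hu huv, fun h => hus (hiff.mpr h)⟩
  · have hpa' : G.Arrow p a := (split_arrow.mp hpa).resolve_right fun h => has h.2.2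
    exact split_arrow.mpr (Or.inl (hW.arrow_of_line ha (split_line.mp hab).1 hpa'))
  · refine hW.not_hasHole (h.congr Set.sdiff_subset fun u hu v hv => ?_)
    exact split_line.trans (and_iff_left (iff_of_false hu.2 hv.2))

theorem IsFlexible.exists_arrow [Finite V] (hW : G.IsFlexible W) (hG : G.IsChainGraph)
    (hx : x ∈ W) (hxy : G.Line x y) :
    ∃ H : MixedGraph V, H.IsChainGraph ∧ MarkovEquiv G H ∧ H.Arrow x y := by
  induction hn : W.ncard using Nat.strong_induction_on generalizing G W with
  | _ n ih =>
  have hy : y ∈ W := hW.mem_of_line hx hxy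
  rcases (W \ {x, y}).eq_empty_or_nonempty with hempty | hz
  · have hs : IsSimplicialIn G.lineGraph W y := by
      have eq_x {u} (hu : u ∈ W) (hyu : G.Line y u) : u = x :=
        (Set.sdiff_eq_empty.mp hempty hu).resolve_right hyu.ne.symm
      exact ⟨hy, fun u hu v hv huv => absurd ((eq_x hu.1 hu.2).trans (eq_x hv.1 hv.2).symm) huv⟩
    exact ⟨G.split {y}, hG.split {y}, (hW.isSplittable_singleton hs).markovEquiv hG,
      split_arrow.mpr (Or.inr ⟨hxy, hxy.ne, rfl⟩)⟩
  · obtain ⟨s, hs, hsx, hsy⟩ := exists_isSimplicialIn_ne hW.not_hasHole hx hy hxy hz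
    have hxy' : (G.split {s}).Line x y :=
      split_line.mpr ⟨hxy, iff_of_false hsx.symm hsy.symm⟩
    obtain ⟨H, hH, hGH, hA⟩ := ih (W \ {s}).ncard
      (hn ▸ Set.ncard_lt_ncard ⟨Set.sdiff_subset, fun h => (h hs.mem).2 rfl⟩)
      hW.split_singleton (hG.split {s}) ⟨hx, hsx.symm⟩ hxy' rfl
    exact ⟨H, hH, ((hW.isSplittable_singleton hs).markovEquiv hG).trans hGH, hA⟩

theorem isFlexible_of_notMem_strongComponents (hG : G.IsChainGraph) (hW : W ∈ G.chainComponents)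
    (hns : W ∉ G.strongComponents) : G.IsFlexible W := by
  rw [mem_strongComponents_iff hG] at hns
  push Not at hns
  obtain ⟨hhole, hflag⟩ := hns hW
  refine ⟨mem_of_line hW, fun {p a b} ha hab hpa => ?_, hhole⟩
  refine hG.arrow_of_mem hW ha (mem_of_line hW ha hab) hpa ?_
  by_contra hadj
  exact hflag p a b ⟨hpa, hab, hadj⟩ ha

theorem exists_arrow_of_not_strongLine [Finite V] (hG : G.IsChainGraph) (hxy : G.Line x y)
    (hs : ¬ G.StrongLine x y) :
    ∃ H : MixedGraph V, H.IsChainGraph ∧ MarkovEquiv G H ∧ H.Arrow x y := by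
  have hξ : G.component x ∈ G.chainComponents := component_mem_chainComponents
  have hns : G.component x ∉ G.strongComponents := fun h =>
    hs ⟨hxy, _, h, mem_component_self, mem_of_line hξ mem_component_self hxy⟩
  exact (isFlexible_of_notMem_strongComponents hG hξ hns).exists_arrow hG mem_component_self hxy

end Flexible

/-! ### Merging two chain components -/

section AgreeOn

variable {G H : MixedGraph V} {W ζ κ : Set V} {p x y : V}

/-- `G` and `H` have the same edges at every vertex of `W`. -/
def AgreeOn (G H : MixedGraph V) (W : Set V) : Prop :=
  ∀ x ∈ W, ∀ y, (G.Edge x y ↔ H.Edge x y) ∧ (G.Edge y x ↔ H.Edge y x)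

namespace AgreeOn

theorem symm (h : AgreeOn G H W) : AgreeOn H G W := fun x hx y =>
  ⟨(h x hx y).1.symm, (h x hx y).2.symm⟩

theorem line_iff (h : AgreeOn G H W) (hx : x ∈ W) : G.Line x y ↔ H.Line x y :=
  and_congr (h x hx y).1 (h x hx y).2

theorem line_iff' (h : AgreeOn G H W) (hy : y ∈ W) : G.Line x y ↔ H.Line x y :=
  and_congr (h y hy x).2 (h y hy x).1

theorem arrow_iff (h : AgreeOn G H W) (hx : x ∈ W) : G.Arrow p x ↔ H.Arrow p x :=
  and_congr (h x hx p).2 (not_congr (h x hx p).1)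

theorem adj_iff (h : AgreeOn G H W) (hy : y ∈ W) : G.Adj x y ↔ H.Adj x y :=
  or_congr (h y hy x).2 (h y hy x).1

theorem mem_chainComponents (h : AgreeOn G H ζ) (hζ : ζ ∈ G.chainComponents) :
    ζ ∈ H.chainComponents := by
  obtain ⟨x, rfl⟩ := mem_chainComponents_iff.mp hζ
  refine mem_chainComponents_iff.mpr ⟨x, Set.ext fun y => ⟨fun hy => ?_, fun hy => ?_⟩⟩
  · induction (hy : ReflTransGen G.Line x y) with
    | refl => exact .refl
    | tail hu huw ih => exact ih.tail ((h.line_iff hu).mp huw)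
  · induction (hy : ReflTransGen H.Line x y) with
    | refl => exact .refl
    | tail _ huw ih => exact ih.tail ((h.line_iff ih).mpr huw)

theorem mem_strongComponents (h : AgreeOn G H ζ) (hG : G.IsChainGraph) (hH : H.IsChainGraph)
    (hζ : ζ ∈ G.strongComponents) : ζ ∈ H.strongComponents := by
  obtain ⟨hζG, hole | ⟨p, x, y, ⟨hpx, hxy, hpy⟩, hx⟩⟩ := (mem_strongComponents_iff hG).mp hζ
  · exact (mem_strongComponents_iff hH).mpr ⟨h.mem_chainComponents hζG,
      Or.inl (hole.congr subset_rfl fun x hx _ _ => h.line_iff hx)⟩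
  · exact (mem_strongComponents_iff hH).mpr ⟨h.mem_chainComponents hζG, Or.inr ⟨p, x, y,
      ⟨(h.arrow_iff hx).mp hpx, (h.line_iff hx).mp hxy,
        fun hadj => hpy ((h.adj_iff (mem_of_line hζG hx hxy)).mpr hadj)⟩, hx⟩⟩

theorem isSplittable (h : AgreeOn G H ζ) (hζ : ζ ∈ G.chainComponents) (hκ : κ ⊆ ζ)
    (hs : H.IsSplittable κ) : G.IsSplittable κ := by
  have line {u k} (hk : k ∈ κ) : G.Line u k ↔ H.Line u k := h.line_iff' (hκ hk)
  have mem {a k} (hk : k ∈ κ) (hak : G.Line a k) : a ∈ ζ := mem_of_line hζ (hκ hk) hak.symm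
  refine ⟨fun x hx y hy => ?_, fun a k k' ha hk hk' hak => ?_,
    fun a b k ha hb hk hak hbk hab => ?_, fun p a k ha hk hak hpa => ?_⟩
  · exact ReflTransGen.mono (fun _ _ huv => ⟨(line huv.2).mpr huv.1, huv.2⟩) _ _
      (hs.connected x hx y hy)
  · exact (line hk').mpr (hs.covers a k k' ha hk hk' ((line hk).mp hak))
  · exact (h.line_iff (mem hk hak)).mpr
      (hs.complete a b k ha hb hk ((line hk).mp hak) ((line hk).mp hbk) hab)
  · exact (h.arrow_iff (hκ hk)).mpr
      (hs.parents p a k ha hk ((line hk).mp hak) ((h.arrow_iff (mem hk hak)).mp hpa))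

end AgreeOn

end AgreeOn

section Merge

variable {G : MixedGraph V} {σ ξ ζ W : Set V} {a b c p x y u v : V}

theorem IsFlexible.arrow_of_mem (hW : G.IsFlexible ξ) (hξ : ξ ∈ G.chainComponents) (hx : x ∈ ξ)
    (hy : y ∈ ξ) (hp : G.Arrow p x) : G.Arrow p y := by
  have hxy := reflTransGen_line_of_mem hξ hx hy
  clear hy
  induction hxy with
  | refl => exact hp
  | tail hu huw ih => exact hW.arrow_of_line (mem_of_reflTransGen_line hξ hx hu) huw ih

theorem IsFlexible.notMem_strongComponents (hW : G.IsFlexible W) (hG : G.IsChainGraph)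
    (hx : x ∈ ζ) (hxW : x ∈ W) : ζ ∉ G.strongComponents := by
  intro hζs
  obtain ⟨hζ, hstrong⟩ := (mem_strongComponents_iff hG).mp hζs
  have hsub : ζ ⊆ W := by
    intro y hy
    have hxy := reflTransGen_line_of_mem hζ hx hy
    clear hy
    induction hxy with
    | refl => exact hxW
    | tail _ huw ih => exact hW.mem_of_line ih huw
  rcases hstrong with hole | ⟨p, u, w, ⟨hpu, huw, hpw⟩, hu⟩
  · exact hW.not_hasHole (hole.mono hsub)
  · exact hpw (hW.arrow_of_line (hsub hu) huw hpu).adj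

theorem exists_arrow_of_reach (hξ : ξ ∈ G.chainComponents) (huv : G.Reach u v) (hu : u ∉ ξ)
    (hv : v ∈ ξ) : ∃ p, G.Reach u p ∧ ∃ k ∈ ξ, G.Arrow p k := by
  induction huv using ReflTransGen.head_induction_on with
  | refl => exact absurd hv hu
  | @head u w huw _ ih =>
    by_cases hw : w ∈ ξ
    · have hl : ¬ G.Line u w := fun hl => hu (mem_of_line hξ hw hl.symm)
      exact ⟨u, .refl u, w, hw, (edge_iff.mp huw).resolve_left hl⟩
    · obtain ⟨p, hwp, hp⟩ := ih hw
      exact ⟨p, .head huw hwp, hp⟩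

/-- The graph obtained by replacing every arrow from `σ` to `ξ` by a line. -/
def merge (G : MixedGraph V) (σ ξ : Set V) : MixedGraph V where
  Edge x y := G.Edge x y ∨ (x ∈ ξ ∧ y ∈ σ ∧ G.Edge y x)
  irrefl a h := h.elim (G.irrefl a) fun h => G.irrefl a h.2.2

theorem merge_arrow : (G.merge σ ξ).Arrow x y ↔ G.Arrow x y ∧ ¬ (x ∈ σ ∧ y ∈ ξ) := by
  simp only [Arrow, merge]; tauto

theorem reach_merge (h : (G.merge σ ξ).Reach u v) :
    G.Reach u v ∨ ∃ k ∈ ξ, ∃ c ∈ σ, G.Reach u k ∧ G.Reach c v := by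
  induction h with
  | refl => exact Or.inl (.refl u)
  | @tail v w _ hvw ih =>
    rcases hvw with hvw | ⟨hv, hw, -⟩ <;> rcases ih with huv | ⟨k, hk, c, hc, huk, hcv⟩
    · exact Or.inl (huv.tail hvw)
    · exact Or.inr ⟨k, hk, c, hc, huk, hcv.tail hvw⟩
    · exact Or.inr ⟨v, hv, w, hw, huv, .refl w⟩
    · exact Or.inr ⟨k, hk, w, hw, huk, .refl w⟩

theorem agreeOn_merge (hζ : ∀ x ∈ ζ, x ∉ σ ∪ ξ) : AgreeOn (G.merge σ ξ) G ζ := by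
  intro x hx y
  have hx : x ∉ σ ∪ ξ := hζ x hx
  exact ⟨or_iff_left fun h => hx (Or.inr h.1), or_iff_left fun h => hx (Or.inl h.2.1)⟩

/-- The chain components `σ` and `ξ` are not strong, and the parents of `ξ` are those of `σ`
together with a complete subset of `σ`. Then `σ ∪ ξ` is a chain component of `G.merge σ ξ`, and
splitting off `ξ` from it gives back `G`. -/
structure IsMergeable (G : MixedGraph V) (σ ξ : Set V) : Prop where
  left_mem : σ ∈ G.chainComponents
  right_mem : ξ ∈ G.chainComponents
  left_flexible : G.IsFlexible σ
  right_flexible : G.IsFlexible ξ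
  disjoint : Disjoint σ ξ
  parents : ∀ p, ∀ k ∈ ξ, G.Arrow p k → p ∈ σ ∨ ∀ x ∈ σ, G.Arrow p x
  parents_of_left : ∀ p, ∀ x ∈ σ, ∀ k ∈ ξ, G.Arrow p x → G.Arrow p k
  complete : ∀ c ∈ σ, ∀ d ∈ σ, ∀ k ∈ ξ, G.Arrow c k → G.Arrow d k → c ≠ d → G.Line c d

namespace IsMergeable

theorem left_arrow (h : G.IsMergeable σ ξ) (hx : x ∈ σ) (hy : y ∈ σ) (hp : G.Arrow p x) :
    G.Arrow p y :=
  h.left_flexible.arrow_of_mem h.left_mem hx hy hp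

theorem right_arrow (h : G.IsMergeable σ ξ) (hx : x ∈ ξ) (hy : y ∈ ξ) (hp : G.Arrow p x) :
    G.Arrow p y :=
  h.right_flexible.arrow_of_mem h.right_mem hx hy hp

theorem arrow_of_edge (h : G.IsMergeable σ ξ) (hx : x ∈ σ) (hy : y ∈ ξ) (hxy : G.Edge x y) :
    G.Arrow x y :=
  (edge_iff.mp hxy).resolve_left fun hl =>
    Set.disjoint_left.mp h.disjoint hx (mem_of_line h.right_mem hy hl.symm)

theorem merge_line (h : G.IsMergeable σ ξ) : (G.merge σ ξ).Line x y ↔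
    G.Line x y ∨ (x ∈ σ ∧ y ∈ ξ ∧ G.Arrow x y) ∨ (y ∈ σ ∧ x ∈ ξ ∧ G.Arrow y x) := by
  constructor
  · rintro ⟨hxy | ⟨hx, hy, hyx⟩, hyx' | ⟨hy', hx', hxy'⟩⟩
    · exact Or.inl ⟨hxy, hyx'⟩
    · exact Or.inr (Or.inl ⟨hx', hy', h.arrow_of_edge hx' hy' hxy'⟩)
    · exact Or.inr (Or.inr ⟨hy, hx, h.arrow_of_edge hy hx hyx⟩)
    · exact absurd hy' (Set.disjoint_left.mp h.disjoint hy)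
  · rintro (hl | ⟨hx, hy, ha⟩ | ⟨hy, hx, ha⟩)
    · exact ⟨Or.inl hl.1, Or.inl hl.2⟩
    · exact ⟨Or.inl ha.1, Or.inr ⟨hy, hx, ha.1⟩⟩
    · exact ⟨Or.inr ⟨hx, hy, ha.1⟩, Or.inl ha.1⟩

theorem merge_line_of_left (h : G.IsMergeable σ ξ) (hx : x ∈ σ) (hy : y ∈ σ) :
    (G.merge σ ξ).Line x y ↔ G.Line x y :=
  h.merge_line.trans <| or_iff_left <| by
    rintro (⟨-, hy', -⟩ | ⟨-, hx', -⟩)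
    exacts [Set.disjoint_left.mp h.disjoint hy hy', Set.disjoint_left.mp h.disjoint hx hx']

theorem merge_line_of_right (h : G.IsMergeable σ ξ) (hx : x ∈ ξ) (hy : y ∈ ξ) :
    (G.merge σ ξ).Line x y ↔ G.Line x y :=
  h.merge_line.trans <| or_iff_left <| by
    rintro (⟨hx', -⟩ | ⟨hy', -⟩)
    exacts [Set.disjoint_left.mp h.disjoint hx' hx, Set.disjoint_left.mp h.disjoint hy' hy]

theorem merge_line_to_right (h : G.IsMergeable σ ξ) (hy : y ∈ ξ) (hl : (G.merge σ ξ).Line x y) :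
    x ∈ ξ ∨ (x ∈ σ ∧ G.Arrow x y) := by
  rcases h.merge_line.mp hl with hl | ⟨hx, -, hxy⟩ | ⟨hyσ, -⟩
  · exact Or.inl (mem_of_line h.right_mem hy hl.symm)
  · exact Or.inr ⟨hx, hxy⟩
  · exact absurd hy (Set.disjoint_left.mp h.disjoint hyσ)

theorem isChainGraph_merge (h : G.IsMergeable σ ξ) (hG : G.IsChainGraph) :
    (G.merge σ ξ).IsChainGraph := by
  refine isChainGraph_of_not_reach fun x y hxy hyx => ?_
  obtain ⟨hxy, hnot⟩ := merge_arrow.mp hxy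
  obtain hyx | ⟨k, hk, c, hc, hyk, hcx⟩ := reach_merge hyx
  · exact hG.not_reach hxy hyx
  · have reach_of_parent {q} (hq : q ∈ σ ∨ ∀ z ∈ σ, G.Arrow q z) : G.Reach q x :=
      hq.elim (fun hq => (reach_of_mem h.left_mem hq hc).trans hcx)
        fun hq => (hq c hc).reach.trans hcx
    by_cases hy : y ∈ ξ
    · rcases h.parents x y hy hxy with hx | hx
      · exact hnot ⟨hx, hy⟩
      · exact hG.not_reach (hx c hc) hcx
    · obtain ⟨q, hyq, k', hk', hqk'⟩ := exists_arrow_of_reach h.right_mem hyk hy hk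
      exact hG.not_reach hxy (hyq.trans (reach_of_parent (h.parents q k' hk' hqk')))

theorem split_merge (h : G.IsMergeable σ ξ) : (G.merge σ ξ).split ξ = G := by
  ext x y
  constructor
  · rintro ⟨hxy | ⟨hx, hy, hyx⟩, hnot⟩
    · exact hxy
    · exact absurd ⟨hx, Set.disjoint_left.mp h.disjoint hy, Or.inl hyx⟩ hnot
  · refine fun hxy => ⟨Or.inl hxy, ?_⟩
    rintro ⟨hx, hy, hyx | ⟨hy', -⟩⟩
    · exact hy (mem_of_line h.right_mem hx ⟨hxy, hyx⟩)
    · exact hy hy'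

theorem isSplittable_merge (h : G.IsMergeable σ ξ) (hG : G.IsChainGraph) :
    (G.merge σ ξ).IsSplittable ξ := by
  have arrow_of_line {a k} (ha : a ∉ ξ) (hk : k ∈ ξ) (hl : (G.merge σ ξ).Line a k) :
      a ∈ σ ∧ G.Arrow a k := (h.merge_line_to_right hk hl).resolve_left ha
  refine ⟨fun x hx y hy => ?_, fun a k k' ha hk hk' hl => ?_,
    fun a b k ha hb hk hak hbk hab => ?_, fun p a k ha hk hak hpa => ?_⟩
  · have hxy := reflTransGen_line_of_mem h.right_mem hx hy
    clear hy
    induction hxy with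
    | refl => exact .refl
    | tail hu huw ih =>
      have hw := mem_of_line h.right_mem (mem_of_reflTransGen_line h.right_mem hx hu) huw
      exact ih.tail ⟨h.merge_line.mpr (Or.inl huw), hw⟩
  · obtain ⟨haσ, hak⟩ := arrow_of_line ha hk hl
    exact h.merge_line.mpr (Or.inr (Or.inl ⟨haσ, hk', h.right_arrow hk hk' hak⟩))
  · obtain ⟨haσ, hak⟩ := arrow_of_line ha hk hak
    obtain ⟨hbσ, hbk⟩ := arrow_of_line hb hk hbk
    exact h.merge_line.mpr (Or.inl (h.complete a haσ b hbσ k hk hak hbk hab))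
  · obtain ⟨haσ, -⟩ := arrow_of_line ha hk hak
    have hpa : G.Arrow p a := (merge_arrow.mp hpa).1
    exact merge_arrow.mpr ⟨h.parents_of_left p a haσ k hk hpa,
      fun hp => hG.notMem_of_arrow h.left_mem haσ hpa hp.1⟩

theorem markovEquiv_merge [Finite V] (h : G.IsMergeable σ ξ) (hG : G.IsChainGraph) :
    MarkovEquiv (G.merge σ ξ) G := by
  have hsplit := (h.isSplittable_merge hG).markovEquiv (h.isChainGraph_merge hG)
  rwa [h.split_merge] at hsplit

theorem isSimplicialIn_merge (h : G.IsMergeable σ ξ)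
    (hx : IsSimplicialIn (G.merge σ ξ).lineGraph (W ∩ ξ) x) :
    IsSimplicialIn (G.merge σ ξ).lineGraph W x := by
  obtain ⟨⟨hxW, hxξ⟩, hclique⟩ := hx
  refine ⟨hxW, fun u ⟨huW, hu⟩ w ⟨hwW, hw⟩ huw => ?_⟩
  rcases h.merge_line_to_right hxξ (Line.symm hu) with huξ | ⟨huσ, hux⟩ <;>
    rcases h.merge_line_to_right hxξ (Line.symm hw) with hwξ | ⟨hwσ, hwx⟩
  · exact hclique ⟨⟨huW, huξ⟩, hu⟩ ⟨⟨hwW, hwξ⟩, hw⟩ huw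
  · exact h.merge_line.mpr (Or.inr (Or.inr ⟨hwσ, huξ, h.right_arrow hxξ huξ hwx⟩))
  · exact h.merge_line.mpr (Or.inr (Or.inl ⟨huσ, hwξ, h.right_arrow hxξ hwξ hux⟩))
  · exact h.merge_line.mpr (Or.inl (h.complete u huσ w hwσ x hxξ hux hwx huw))

-- The vertices of `ξ` can be eliminated first, then those of `σ`.
theorem not_hasHole_merge [Finite V] (h : G.IsMergeable σ ξ) :
    ¬ HasHole (G.merge σ ξ).lineGraph (σ ∪ ξ) := by
  intro hole
  obtain ⟨U, hU, hne, hnone⟩ := hole.exists_subset_not_isSimplicialIn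
  have not_hasHole_right : ¬ HasHole (G.merge σ ξ).lineGraph (U ∩ ξ) := fun hole =>
    h.right_flexible.not_hasHole (hole.congr Set.inter_subset_right fun _ hx _ hy =>
      h.merge_line_of_right hx.2 hy.2)
  by_cases hUξ : (U ∩ ξ).Nonempty
  · obtain ⟨s, hs⟩ := exists_isSimplicialIn not_hasHole_right hUξ
    exact hnone s (h.isSimplicialIn_merge hs)
  · have hUσ : U ⊆ σ := fun x hx => (hU hx).resolve_right fun hxξ => hUξ ⟨x, hx, hxξ⟩
    have not_hasHole_left : ¬ HasHole (G.merge σ ξ).lineGraph U := fun hole =>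
      h.left_flexible.not_hasHole (hole.congr hUσ fun _ hx _ hy =>
        h.merge_line_of_left (hUσ hx) (hUσ hy))
    obtain ⟨s, hs⟩ := exists_isSimplicialIn not_hasHole_left hne
    exact hnone s hs

theorem isFlexible_merge [Finite V] (h : G.IsMergeable σ ξ) (hG : G.IsChainGraph) :
    (G.merge σ ξ).IsFlexible (σ ∪ ξ) := by
  have mem_of_line {x y} (hx : x ∈ σ ∪ ξ) (hl : (G.merge σ ξ).Line x y) : y ∈ σ ∪ ξ := by
    rcases h.merge_line.mp hl with hl | ⟨-, hy, -⟩ | ⟨hy, -⟩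
    · exact hx.imp (MixedGraph.mem_of_line h.left_mem · hl)
        (MixedGraph.mem_of_line h.right_mem · hl)
    · exact Or.inr hy
    · exact Or.inl hy
  refine ⟨mem_of_line, fun {p a b} ha hab hpa => ?_, h.not_hasHole_merge⟩
  obtain ⟨hpa, hnot⟩ := merge_arrow.mp hpa
  have toLeft : ∀ x ∈ σ, G.Arrow p x := by
    rcases ha with haσ | haξ
    · exact fun x hx => h.left_arrow haσ hx hpa
    · exact (h.parents p a haξ hpa).resolve_left fun hp => hnot ⟨hp, haξ⟩
  obtain ⟨c, rfl⟩ := mem_chainComponents_iff.mp h.left_mem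
  have hpc : G.Arrow p c := toLeft c mem_component_self
  refine merge_arrow.mpr ⟨?_, fun hp =>
    hG.notMem_of_arrow h.left_mem mem_component_self hpc hp.1⟩
  exact (mem_of_line ha hab).elim (toLeft b) fun hb =>
    h.parents_of_left p c mem_component_self b hb hpc

theorem unsplittable_merge [Finite V] (h : G.IsMergeable σ ξ) (hG : G.IsChainGraph)
    (hU : ∀ ζ ∈ G.strongComponents, G.Unsplittable ζ) :
    ∀ ζ ∈ (G.merge σ ξ).strongComponents, (G.merge σ ξ).Unsplittable ζ := by
  intro ζ hζ
  have hM : (G.merge σ ξ).IsChainGraph := h.isChainGraph_merge hG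
  have hagree : AgreeOn (G.merge σ ξ) G ζ := agreeOn_merge fun _ hx hxW =>
    (h.isFlexible_merge hG).notMem_strongComponents hM hx hxW hζ
  have hζG : ζ ∈ G.strongComponents := hagree.mem_strongComponents hM hG hζ
  intro κ hκ hne hs
  exact hU ζ hζG κ hκ hne (hagree.symm.isSplittable hζG.1 hκ.1 hs)

end IsMergeable

theorem exists_strongLine (hs : G.component x ∈ G.strongComponents) :
    ∃ y, G.StrongLine x y := by
  obtain ⟨z, hz, hzx⟩ := hs.2.1.exists_ne x
  rcases ReflTransGen.cases_head hz with h | ⟨y, hxy, -⟩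
  · exact absurd h.symm hzx
  · exact ⟨y, hxy, _, hs, mem_component_self, .single hxy⟩

theorem StrongLine.symm (h : G.StrongLine x y) : G.StrongLine y x :=
  let ⟨hxy, ξ, hξ, hx, hy⟩ := h
  ⟨hxy.symm, ξ, hξ, hy, hx⟩

section NotWellProtected

variable (hG : G.IsChainGraph) (hab : G.Arrow a b) (hn : ¬ G.WellProtected a b)
include hG hab hn

theorem isFlexible_component_left : G.IsFlexible (G.component a) := by
  refine isFlexible_of_notMem_strongComponents hG component_mem_chainComponents fun hs => hn ?_
  obtain ⟨c, hc⟩ := exists_strongLine hs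
  by_cases hcb : G.Adj c b
  · have hcb : G.Arrow c b :=
      arrow_of_adj hcb fun hbc => hG.not_reach hab (hbc.trans hc.1.symm.reach)
    exact ⟨hab, by grind⟩
  · exact ⟨hab, by grind [hc.symm]⟩

theorem isFlexible_component_right : G.IsFlexible (G.component b) := by
  refine isFlexible_of_notMem_strongComponents hG component_mem_chainComponents fun hs => hn ?_
  obtain ⟨c, hc⟩ := exists_strongLine hs
  by_cases hac : G.Adj a c
  · have hac : G.Arrow a c :=
      arrow_of_adj hac fun hca => hG.not_reach hab (hc.1.reach.trans hca)
    exact ⟨hab, by grind⟩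
  · exact ⟨hab, by grind⟩

theorem arrow_of_arrow_left (hpa : G.Arrow p a) : G.Arrow p b := by
  refine arrow_of_adj ?_ fun hbp => hG.not_reach hpa (hab.reach.trans hbp)
  by_contra hadj
  exact hn ⟨hab, Or.inl ⟨p, hpa, hadj⟩⟩

omit hG in
theorem line_or_arrow_of_arrow_right (hpa : p ≠ a) (hpb : G.Arrow p b) :
    G.Line a p ∨ G.Arrow p a := by
  by_cases hadj : G.Adj a p
  · rcases adj_iff.mp hadj with h | h | h
    · exact Or.inl h
    · exact absurd ⟨hab, Or.inr (Or.inr (Or.inl ⟨p, h, hpb⟩))⟩ hn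
    · exact Or.inr h
  · exact absurd ⟨hab, Or.inr (Or.inl ⟨p, hpa.symm, hab, hpb, hadj⟩)⟩ hn

theorem line_of_arrow_right (hx : x ∈ G.component a) (hy : y ∈ G.component a)
    (hxb : G.Arrow x b) (hyb : G.Arrow y b) (hxy : x ≠ y) : G.Line x y := by
  have line {z} (hz : z ∈ G.component a) (hza : z ≠ a) (hzb : G.Arrow z b) : G.Line a z :=
    (line_or_arrow_of_arrow_right hab hn hza hzb).resolve_right fun h =>
      hG.notMem_of_arrow component_mem_chainComponents mem_component_self h hz
  rcases eq_or_ne x a with rfl | hxa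
  · exact line hy hxy.symm hyb
  rcases eq_or_ne y a with rfl | hya
  · exact (line hx hxy hxb).symm
  refine hG.line_of_mem component_mem_chainComponents hx hy ?_
  by_contra hadj
  exact hn ⟨hab, Or.inr (Or.inr (Or.inr (Or.inl
    ⟨x, y, line hx hxa hxb, line hy hya hyb, hxy, hxb, hyb, hadj⟩)))⟩

theorem isMergeable_of_not_wellProtected : G.IsMergeable (G.component a) (G.component b) := by
  have hσ : G.component a ∈ G.chainComponents := component_mem_chainComponents
  have hξ : G.component b ∈ G.chainComponents := component_mem_chainComponents
  have hσflex := isFlexible_component_left hG hab hn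
  have hξflex := isFlexible_component_right hG hab hn
  have arrow_b {p k} (hk : k ∈ G.component b) (hpk : G.Arrow p k) : G.Arrow p b :=
    hξflex.arrow_of_mem hξ hk mem_component_self hpk
  refine ⟨hσ, hξ, hσflex, hξflex, Set.disjoint_left.mpr fun x hx hx' => ?_, fun p k hk hpk => ?_,
    fun p x hx k hk hpx => ?_, fun x hx y hy k hk hxk hyk hxy => ?_⟩
  · exact hG.not_reach hab ((reach_of_mem hξ mem_component_self hx').trans
      (reach_of_mem hσ hx mem_component_self))
  · rcases eq_or_ne p a with rfl | hpa
    · exact Or.inl mem_component_self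
    · exact (line_or_arrow_of_arrow_right hab hn hpa (arrow_b hk hpk)).imp .single
        fun h x hx => hσflex.arrow_of_mem hσ mem_component_self hx h
  · have hpa : G.Arrow p a := hσflex.arrow_of_mem hσ hx mem_component_self hpx
    exact hξflex.arrow_of_mem hξ mem_component_self hk (arrow_of_arrow_left hG hab hn hpa)
  · exact line_of_arrow_right hG hab hn hx hy (arrow_b hk hxk) (arrow_b hk hyk) hxy

end NotWellProtected

end Merge

/-! ### The characterization of AMP essential graphs -/

section Essential

/-- The number of ordered pairs of vertices that are joined by an arrow or a line, so that a line
counts twice and an arrow once. -/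
noncomputable def edgeCount (G : MixedGraph V) : ℕ := {q : V × V | G.Edge q.1 q.2}.ncard

/-- The conditions of the characterization, with properties S and S' replaced by the equivalent
condition that no part of the component can be split off. -/
structure IsWellProtectedChainGraph (G : MixedGraph V) : Prop where
  isChainGraph : G.IsChainGraph
  unsplittable : ∀ ξ ∈ G.strongComponents, G.Unsplittable ξ
  wellProtected : ∀ a b, G.Arrow a b → G.WellProtected a b

theorem isWellProtectedChainGraph_iff_propertyS {G : MixedGraph V} :
    G.IsWellProtectedChainGraph ↔ G.IsChainGraph ∧ (∀ ξ ∈ G.strongComponents, G.PropertyS ξ) ∧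
      ∀ a b, G.Arrow a b → G.WellProtected a b :=
  ⟨fun h => ⟨h.1, fun ξ hξ => (propertyS_iff h.1 hξ.1).mpr (h.2 ξ hξ), h.3⟩,
    fun ⟨hG, hS, hW⟩ => ⟨hG, fun ξ hξ => (propertyS_iff hG hξ.1).mp (hS ξ hξ), hW⟩⟩

theorem isWellProtectedChainGraph_iff_propertyS' {G : MixedGraph V} :
    G.IsWellProtectedChainGraph ↔ G.IsChainGraph ∧ (∀ ξ ∈ G.strongComponents, G.PropertyS' ξ) ∧
      ∀ a b, G.Arrow a b → G.WellProtected a b :=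
  ⟨fun h => ⟨h.1, fun ξ hξ => (propertyS'_iff h.1 hξ.1).mpr (h.2 ξ hξ), h.3⟩,
    fun ⟨hG, hS, hW⟩ => ⟨hG, fun ξ hξ => (propertyS'_iff hG hξ.1).mp (hS ξ hξ), hW⟩⟩

variable [Finite V] {G H : MixedGraph V} {a b : V}

instance : Finite (MixedGraph V) :=
  Finite.of_injective (fun G : MixedGraph V => {q : V × V | G.Edge q.1 q.2}) fun G H h => by
    ext a b
    exact Set.ext_iff.mp h (a, b)

theorem edgeCount_lt (h : ∀ x y, G.Edge x y → H.Edge x y) (hH : H.Edge a b) (hG : ¬ G.Edge a b) :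
    G.edgeCount < H.edgeCount :=
  Set.ncard_lt_ncard ⟨fun q hq => h q.1 q.2 hq, fun hs => hG (hs (show (a, b) ∈ _ from hH))⟩

theorem exists_unsplittable (hG : G.IsChainGraph) : ∃ H : MixedGraph V, H.IsChainGraph ∧
    MarkovEquiv H G ∧ ∀ ξ ∈ H.chainComponents, H.Unsplittable ξ := by
  obtain ⟨H, ⟨hH, hHG⟩, hmin⟩ := Set.exists_min_image (ampClass G) edgeCount (Set.toFinite _)
    ⟨G, hG, .refl G⟩
  refine ⟨H, hH, hHG, fun ξ hξ κ hκ hne hs => ?_⟩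
  obtain ⟨a, ha, k, hk, hak⟩ := nb_nonempty hξ hκ hne
  have hlt : (H.split κ).edgeCount < H.edgeCount :=
    edgeCount_lt (fun _ _ h => h.1) hak.2 fun h => h.2 ⟨hk, ha, hak.1⟩
  exact hlt.not_ge (hmin (H.split κ) ⟨hH.split κ, (hs.markovEquiv hH).symm.trans hHG⟩)

-- Merging preserves unsplittability of the strong components and increases the number of edges.
theorem exists_isWellProtectedChainGraph (hG : G.IsChainGraph) :
    ∃ H : MixedGraph V, MarkovEquiv H G ∧ H.IsWellProtectedChainGraph := by
  obtain ⟨H₀, hH₀, hHG₀, hU₀⟩ := exists_unsplittable hG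
  obtain ⟨H, ⟨⟨hH, hHG⟩, hU⟩, hmax⟩ := Set.exists_max_image
    {H | H ∈ ampClass G ∧ ∀ ξ ∈ H.strongComponents, H.Unsplittable ξ} edgeCount (Set.toFinite _)
    ⟨H₀, ⟨hH₀, hHG₀⟩, fun ξ hξ => hU₀ ξ hξ.1⟩
  refine ⟨H, hHG, hH, hU, fun a b hab => ?_⟩
  by_contra hn
  have hm := isMergeable_of_not_wellProtected hH hab hn
  have hlt : H.edgeCount < (H.merge (H.component a) (H.component b)).edgeCount :=
    edgeCount_lt (fun _ _ h => Or.inl h)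
      (Or.inr ⟨mem_component_self, mem_component_self, hab.1⟩) hab.2
  exact hlt.not_ge (hmax _ ⟨⟨hm.isChainGraph_merge hH, (hm.markovEquiv_merge hH).trans hHG⟩,
    hm.unsplittable_merge hH hU⟩)

namespace IsWellProtectedChainGraph

theorem not_arrow_of_mem_ampClass (hG : G.IsWellProtectedChainGraph) (hH : H ∈ ampClass G)
    (hab : G.Arrow a b) : ¬ H.Arrow b a :=
  not_arrow_of_wellProtected hG.isChainGraph hH.1 (hH.2.symm.sameTriplexes hG.isChainGraph hH.1)
    hG.unsplittable hG.wellProtected hab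

theorem line_of_strongLine (hG : G.IsWellProtectedChainGraph) (hH : H ∈ ampClass G)
    (hab : G.StrongLine a b) : H.Line a b := by
  obtain ⟨hl, ξ, hξ, ha, -⟩ := hab
  exact (hG.unsplittable ξ hξ).line hG.isChainGraph hH.1
    (hH.2.symm.sameTriplexes hG.isChainGraph hH.1) hξ.1 ha hl

theorem exists_mem_ampClass_arrow (hG : G.IsWellProtectedChainGraph) (hl : G.Line a b)
    (hs : ¬ G.StrongLine a b) : ∃ H ∈ ampClass G, H.Arrow a b := by
  obtain ⟨H, hH, hGH, hA⟩ := exists_arrow_of_not_strongLine hG.isChainGraph hl hs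
  exact ⟨H, ⟨hH, hGH.symm⟩, hA⟩

theorem isEssentialGraphOf (hG : G.IsWellProtectedChainGraph) : G.IsEssentialGraphOf G := by
  have hself : G ∈ ampClass G := ⟨hG.isChainGraph, .refl G⟩
  have adj {H a b} (hH : H ∈ ampClass G) (hab : H.Arrow a b) : G.Adj a b :=
    (hH.2.symm.sameTriplexes hG.isChainGraph hH.1).adj_iff.mpr hab.adj
  refine ⟨rfl, fun a b => ⟨fun hab => ?_, ?_⟩, fun a b => ⟨fun hl => ?_, ?_⟩⟩
  · exact ⟨⟨G, hself, hab⟩, fun ⟨H, hH, hba⟩ => hG.not_arrow_of_mem_ampClass hH hab hba⟩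
  · rintro ⟨⟨H, hH, hab⟩, hno⟩
    rcases adj_iff.mp (adj hH hab) with h | h | h
    · by_cases hs : G.StrongLine a b
      · exact absurd (hG.line_of_strongLine hH hs).2 hab.2
      · exact absurd (hG.exists_mem_ampClass_arrow h.symm fun h => hs h.symm) hno
    · exact h
    · exact absurd ⟨G, hself, h⟩ hno
  · by_cases hs : G.StrongLine a b
    · exact Or.inl fun H hH => hG.line_of_strongLine hH hs
    · exact Or.inr ⟨hG.exists_mem_ampClass_arrow hl hs,
        hG.exists_mem_ampClass_arrow hl.symm fun h => hs h.symm⟩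
  · rintro (h | ⟨⟨H, hH, hab⟩, ⟨H', hH', hba⟩⟩)
    · exact h G hself
    · rcases adj_iff.mp (adj hH hab) with h | h | h
      · exact h
      · exact absurd hba (hG.not_arrow_of_mem_ampClass hH' h)
      · exact absurd hab (hG.not_arrow_of_mem_ampClass hH h)

end IsWellProtectedChainGraph

theorem isAMPEssentialGraph_iff : G.IsAMPEssentialGraph ↔ G.IsWellProtectedChainGraph := by
  constructor
  · rintro ⟨G₀, hG₀, hG⟩
    obtain ⟨H, hHG, hH⟩ := exists_isWellProtectedChainGraph hG₀
    have hclass : ampClass H = ampClass G₀ := by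
      ext K
      exact ⟨fun h => ⟨h.1, h.2.trans hHG⟩, fun h => ⟨h.1, h.2.trans hHG.symm⟩⟩
    have hess : H.IsEssentialGraphOf H := hH.isEssentialGraphOf
    have hGH : G = H := ext_arrow_line
      (fun a b => by rw [hG.arrow_iff, hess.arrow_iff, hclass])
      (fun a b => by rw [hG.line_iff, hess.line_iff, hclass])
    exact hGH ▸ hH
  · exact fun hG => ⟨G, hG.isChainGraph, hG.isEssentialGraphOf⟩

end Essential

end MixedGraph

theorem theorem5p1 {V : Type*} [Finite V] (G : MixedGraph V) :
    (G.IsAMPEssentialGraph ↔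
      G.IsChainGraph ∧
      (∀ ξ ∈ G.strongComponents, G.PropertyS ξ) ∧
      (∀ a b, G.Arrow a b → G.WellProtected a b)) ∧
    (G.IsAMPEssentialGraph ↔
      G.IsChainGraph ∧
      (∀ ξ ∈ G.strongComponents, G.PropertyS' ξ) ∧
      (∀ a b, G.Arrow a b → G.WellProtected a b)) :=
  ⟨MixedGraph.isAMPEssentialGraph_iff.trans MixedGraph.isWellProtectedChainGraph_iff_propertyS,
    MixedGraph.isAMPEssentialGraph_iff.trans MixedGraph.isWellProtectedChainGraph_iff_propertyS'⟩
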